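/- Let $\dot{\mathfrak g}$ be a simple finite-dimensional complex Lie algebra with a non-degenerate invariant symmetric bilinear form $(\cdot|\cdot)$, let $N\ge 1$, $\mu,\nu\in\mathbb C$, and $\mathcal R=\mathbb C[t_0^{\pm},\dots,t_N^{\pm}]$. Put $k_a=t_a^{-1}dt_a$, $d_a=t_a\,\partial/\partial t_a$ $(0\le a\le N)$, and let $\mathfrak g=(\mathcal R\otimes\dot{\mathfrak g})\oplus\Omega^1_{\mathcal R}/d\mathcal R\oplus\bigoplus_{a=0}^N\mathcal R d_a$ be the full toroidal Lie algebra, where, for $r,m\in\mathbb Z^{N+1}$, $$[t^rg_1,t^mg_2]=t^{r+m}[g_1,g_2]+(g_1|g_2)\sum_{p=0}^N r_pt^{r+m}k_p,\qquad [t^rd_a,t^mg]=m_at^{r+m}g,$$ $$[t^rd_a,t^mk_b]=m_at^{r+m}k_b+\delta_{ab}\sum_{p=0}^N r_pt^{r+m}k_p,$$ $$[t^rd_a,t^md_b]=m_at^{r+m}d_b-r_bt^{r+m}d_a+(\mu m_ar_b+\nu r_am_b)\sum_{p=0}^N m_pt^{r+m}k_p,$$ and $\Omega^1_{\mathcal R}/d\mathcal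 R$ commutes with itself and with $\mathcal R\otimes\dot{\mathfrak g}$. Let $\mathfrak g_n$ be the part of degree $n$ in $t_0$ and $\mathfrak g_+=\bigoplus_{n>0}\mathfrak g_n$. From now on $t^r=t_1^{r_1}\cdots t_N^{r_N}$ for $r\in\mathbb Z^N$, and $1\le p\le N$. Put $$t_0^jt^r\tilde d_p=t_0^jt^rd_p-\nu r_pt_0^jt^rk_0,\qquad t_0^jt^r\tilde d_0=-t_0^jt^rd_0+(\mu+\nu)(j+\tfrac12)t_0^jt^rk_0,$$ and consider the fields $u(z)=\sum_n u(n)z^{-n-1}$ given by $k_0(r,z)=\sum_jt_0^jt^rk_0z^{-j}$, $k_p(r,z)=\sum_jt_0^jt^rk_pz^{-j-1}$, $g(r,z)=\sum_jt_0^jt^rg\,z^{-j-1}$ $(g\in\dot{\mathfrak g})$, $\tilde d_p(r,z)=\sum_jt_0^jt^r\tilde d_pz^{-j-1}$, $\tilde d_0(r,z)=\sum_jt_0^jt^r\tilde d_0z^{-j-2}$; write $\tilde d_0(z)=\tilde d_0(0,z)$. The coefficients $u(n)$ with $n\ge0$ span a subalgebra $\mathfrak g^{(+)}$. Let $V_{\mathfrak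 g}=\mathrm{Ind}_{\mathfrak g^{(+)}}^{\mathfrak g}(\mathbb C\mathbf 1)$, where $\mathbb C\mathbf 1$ is the trivial one-dimensional module. It carries a vertex algebra structure (the universal enveloping vertex algebra) with vacuum $\mathbf 1$, with translation $D$ satisfying $D\mathbf 1=0$ and $[D,u(n)]=-nu(n-1)$, and with $$Y\big(u_1(-1-n_1)\cdots u_k(-1-n_k)\mathbf 1,z\big)={:}\tfrac1{n_1!}\partial_z^{n_1}u_1(z)\cdots{:}\tfrac1{n_{k-1}!}\partial_z^{n_{k-1}}u_{k-1}(z)\;\tfrac1{n_k!}\partial_z^{n_k}u_k(z){:}\cdots{:}$$ Fix $0\neq c\in\mathbb C$. Let $T_0=\mathbb C[q_1^{\pm},\dots,q_N^{\pm}]\otimes V\otimes W$ be the module over $\mathfrak g_0\oplus\mathfrak g_+$ on which $\mathfrak g_+$ acts by zero and $$(t^rk_0)(q^m\otimes v\otimes w)=c\,q^{m+r}\otimes v\otimes w,\qquad (t^rk_p)(q^m\otimes v\otimes w)=0,\qquad (t^rg)(q^m\otimes v\otimes w)=q^{m+r}\otimes gv\otimes w,$$ $$(t^rd_0)(q^m\otimes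 v\otimes w)=d\,q^{m+r}\otimes v\otimes w,\qquad (t^rd_j)(q^m\otimes v\otimes w)=(m_j+\alpha_j)q^{m+r}\otimes v\otimes w+\sum_{p=1}^Nr_pq^{m+r}\otimes v\otimes E_{pj}w,$$ with $\alpha=0$, $d=\frac12(\mu+\nu)c$, $V$ the trivial one-dimensional $\dot{\mathfrak g}$-module, and $W$ the one-dimensional $gl_N$-module on which $sl_N$ acts trivially and the identity matrix acts as $h=N\nu c$; thus $T_0=\mathbb C[q_1^{\pm},\dots,q_N^{\pm}]$. Let $M(T_0)=\mathrm{Ind}_{\mathfrak g_0\oplus\mathfrak g_+}^{\mathfrak g}(T_0)$; it has a unique maximal submodule $M^{rad}$, and $L(T_0)=M(T_0)/M^{rad}$. **Proposition.** Let $R(S)$ be the $\mathfrak g$-submodule of $V_{\mathfrak g}$ generated by $$S=\{k_0\mathbf 1-c\mathbf 1\}\cup\{(t^rk_0)(t^mk_0)\mathbf 1-c(t^{r+m}k_0)\mathbf 1\mid r,m\in\mathbb Z^N\},$$ and let $V_{\mathfrak g}(c)=V_{\mathfrak g}/R(S)$. (a) $V_{\mathfrak g}(c)$ is a factor-module of $M(T_0)$: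 there is a surjective $\mathfrak g$-homomorphism $\pi:M(T_0)\to V_{\mathfrak g}(c)$ with $\pi(q^r)=\frac1c(t^rk_0)\mathbf 1$ for all $r\in\mathbb Z^N$. (b) $V_{\mathfrak g}(c)$ inherits a vertex algebra structure from $V_{\mathfrak g}$, i.e. it has one for which the projection $V_{\mathfrak g}\to V_{\mathfrak g}(c)$ is a homomorphism of vertex algebras. (c) With $\omega=(t_0^{-2}\tilde d_0)\mathbf 1$, $V_{\mathfrak g}(c)$ is a VOA of rank $12(\mu+\nu)c$ with Virasoro field $Y(\omega,z)=\tilde d_0(z)$. (d) The projection $M(T_0)\to L(T_0)$ factors through $\pi$ as $M(T_0)\to V_{\mathfrak g}(c)\to L(T_0)$, and $L(T_0)$ has a VOA structure of rank $12(\mu+\nu)c$ for which $V_{\mathfrak g}(c)\to L(T_0)$ is a surjective homomorphism of vertex operator algebras (so $L(T_0)$ is a factor-VOA of $V_{\mathfrak g}(c)$). Here a VOA is a vertex algebra with a vector $\omega$ such that the $L(n)=\omega_{(n+1)}$ satisfy the Virasoro relations with central charge the rank, $D=L(-1)$, and $L(0)$ is diagonalizable with integer eigenvalues. -/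

import Mathlib

open scoped TensorProduct

noncomputable section

/-- A non-degenerate invariant symmetric bilinear form `( · | · )` on a complex Lie algebra. -/
structure InvForm (L : Type*) [LieRing L] [LieAlgebra ℂ L] where
  form : LinearMap.BilinForm ℂ L
  symm : ∀ x y, form x y = form y x
  invariant : ∀ x y z, form ⁅x, y⁆ z = form x ⁅y, z⁆
  nondegenerate : form.Nondegenerate

/-! ### The full toroidal Lie algebra -/

/-- The coefficient space of one monomial `t^r`: a triple `(g, κ, δ)` stands for
`t^r g + ∑ a, κ a • t^r k_a + ∑ a, δ a • t^r d_a`, with `a = 0, …, N`. -/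
abbrev TorCoeff (N : ℕ) (L : Type*) := L × (Fin (N + 1) → ℂ) × (Fin (N + 1) → ℂ)

/-- `(R ⊗ L) ⊕ Ω¹ ⊕ D`, where `R` is the algebra of Laurent polynomials in `t_0, …, t_N`, `Ω¹`
is the free `R`-module on the forms `k_a = t_a⁻¹ dt_a`, and `D` is the free `R`-module on the vector
fields `d_a = t_a ∂/∂t_a`.  The element is written through its coefficients at the
monomials `t^r`, `r ∈ ℤ^(N+1)`. -/
abbrev PreToroidal (N : ℕ) (L : Type*) [AddCommGroup L] :=
  (Fin (N + 1) → ℤ) →₀ TorCoeff N L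

/-- An exponent vector, as a complex vector. -/
def cvec {n : ℕ} (r : Fin n → ℤ) : Fin n → ℂ := fun a => (r a : ℂ)

section
variable (N : ℕ) {L : Type*} [LieRing L] [LieAlgebra ℂ L]

/-- The exact forms `d(R) ⊆ Ω¹`, spanned by `d(t^r) = ∑ a, r_a t^r k_a`. -/
def exactForms : Submodule ℂ (PreToroidal N L) :=
  Submodule.span ℂ (Set.range fun r : Fin (N + 1) → ℤ => Finsupp.single r ((0 : L), cvec r, 0))

variable {N}

/-- The coefficient (at the monomial `t^(r+m)`) of the bracket `[t^r x, t^m y]` for `x = (g, κ, δ)`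
and `y = (g', κ', δ')`, before `Ω¹` is reduced modulo exact forms.  The terms are
`[t^r g, t^m g'] = t^(r+m) [g, g'] + (g | g') t^m d(t^r)`,
`[t^r d_a, t^m g] = m_a t^(r+m) g`,
`[t^r d_a, t^m k_b] = m_a t^(r+m) k_b + δ_ab ∑ p, r_p t^(r+m) k_p`,
`[t^r d_a, t^m d_b] = m_a t^(r+m) d_b - r_b t^(r+m) d_a
  + (μ m_a r_b + ν r_a m_b) ∑ p, m_p t^(r+m) k_p`. -/
def torBracketCoeff (B : InvForm L) (μ ν : ℂ) (r m : Fin (N + 1) → ℤ) :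
    TorCoeff N L →ₗ[ℂ] TorCoeff N L →ₗ[ℂ] TorCoeff N L :=
  LinearMap.mk₂ ℂ
    (fun x y =>
      (⁅x.1, y.1⁆ + (x.2.2 ⬝ᵥ cvec m) • y.1 - (y.2.2 ⬝ᵥ cvec r) • x.1,
       B.form x.1 y.1 • cvec r
        + ((x.2.2 ⬝ᵥ cvec m) • y.2.1 + (x.2.2 ⬝ᵥ y.2.1) • cvec r)
        - ((y.2.2 ⬝ᵥ cvec r) • x.2.1 + (y.2.2 ⬝ᵥ x.2.1) • cvec m)
        + (μ * ((x.2.2 ⬝ᵥ cvec m) * (y.2.2 ⬝ᵥ cvec r))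
            + ν * ((x.2.2 ⬝ᵥ cvec r) * (y.2.2 ⬝ᵥ cvec m))) • cvec m,
       (x.2.2 ⬝ᵥ cvec m) • y.2.2 - (y.2.2 ⬝ᵥ cvec r) • x.2.2))
    (fun x x' y => by
      refine Prod.ext ?_ (Prod.ext ?_ ?_)
      · simp [add_dotProduct]; module
      · simp [add_dotProduct, dotProduct_add]; module
      · simp [add_dotProduct]; module)
    (fun s x y => by
      refine Prod.ext ?_ (Prod.ext ?_ ?_)
      · simp [smul_dotProduct]; module
      · simp [smul_dotProduct, dotProduct_smul]; module
      · simp [smul_dotProduct]; module)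
    (fun x y y' => by
      refine Prod.ext ?_ (Prod.ext ?_ ?_)
      · simp [add_dotProduct]; module
      · simp [add_dotProduct, dotProduct_add]; module
      · simp [add_dotProduct]; module)
    (fun s x y => by
      refine Prod.ext ?_ (Prod.ext ?_ ?_)
      · simp [smul_dotProduct]; module
      · simp [smul_dotProduct, dotProduct_smul]; module
      · simp [smul_dotProduct]; module)

/-- The bilinear extension of the bracket of monomials to `(R ⊗ L) ⊕ Ω¹ ⊕ D`. -/
def preTorBracket (B : InvForm L) (μ ν : ℂ) :
    PreToroidal N L →ₗ[ℂ] PreToroidal N L →ₗ[ℂ] PreToroidal N L :=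
  Finsupp.lsum ℂ fun r => LinearMap.flip <| Finsupp.lsum ℂ fun m => LinearMap.flip <|
    (torBracketCoeff B μ ν r m).compr₂ (Finsupp.lsingle (r + m))

theorem preTorBracket_single (B : InvForm L) (μ ν : ℂ) (r m : Fin (N + 1) → ℤ)
    (x y : TorCoeff N L) :
    preTorBracket B μ ν (Finsupp.single r x) (Finsupp.single m y) =
      Finsupp.single (r + m) (torBracketCoeff B μ ν r m x y) := by
  simp [preTorBracket]

theorem single_mem_exactForms (r : Fin (N + 1) → ℤ) (s : ℂ) {x : TorCoeff N L}
    (hx : x = (0, s • cvec r, 0)) : Finsupp.single r x ∈ exactForms N (L := L) := by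
  have h : Finsupp.single r x =
      s • Finsupp.single r ((0 : L), cvec r, (0 : Fin (N + 1) → ℂ)) := by
    simp [Finsupp.smul_single, hx]
  rw [h]
  exact Submodule.smul_mem _ _ (Submodule.subset_span ⟨r, rfl⟩)

theorem cvec_add {n : ℕ} (r m : Fin n → ℤ) : cvec (r + m) = cvec r + cvec m := by
  ext a; simp [cvec]

theorem preTorBracket_exact_left (B : InvForm L) (μ ν : ℂ) (x y : PreToroidal N L)
    (hx : x ∈ exactForms N) : preTorBracket B μ ν x y ∈ exactForms N := by
  induction hx using Submodule.span_induction with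
  | zero => simp
  | add a b _ _ ha hb => simpa using add_mem ha hb
  | smul s a _ ha => simpa using Submodule.smul_mem _ s ha
  | mem a ha =>
    obtain ⟨r, rfl⟩ := ha
    induction y using Finsupp.induction_linear with
    | zero => simp
    | add a b ha hb => simpa using add_mem ha hb
    | single m y =>
      rw [preTorBracket_single]
      refine single_mem_exactForms (L := L) (r + m) (-(y.2.2 ⬝ᵥ cvec r))
        (Prod.ext ?_ (Prod.ext ?_ ?_))
      · simp [torBracketCoeff]
      · simp [torBracketCoeff, cvec_add]; module
      · simp [torBracketCoeff]

theorem preTorBracket_skew (B : InvForm L) (μ ν : ℂ) (x y : PreToroidal N L) :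
    preTorBracket B μ ν x y + preTorBracket B μ ν y x ∈ exactForms N := by
  induction x using Finsupp.induction_linear with
  | zero => simp
  | add a b ha hb =>
    convert add_mem ha hb using 1
    simp only [map_add, LinearMap.add_apply]; abel
  | single r x =>
    induction y using Finsupp.induction_linear with
    | zero => simp
    | add a b ha hb =>
      convert add_mem ha hb using 1
      simp only [map_add, LinearMap.add_apply]; abel
    | single m y =>
      rw [preTorBracket_single, preTorBracket_single, add_comm m r, ← Finsupp.single_add]
      refine single_mem_exactForms (L := L) (r + m)
        (B.form x.1 y.1 + (μ * ((x.2.2 ⬝ᵥ cvec m) * (y.2.2 ⬝ᵥ cvec r))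
            + ν * ((x.2.2 ⬝ᵥ cvec r) * (y.2.2 ⬝ᵥ cvec m))))
        (Prod.ext ?_ (Prod.ext ?_ ?_))
      · simp only [torBracketCoeff, LinearMap.mk₂_apply, Prod.fst_add]
        rw [← lie_skew x.1 y.1]; module
      · simp only [torBracketCoeff, LinearMap.mk₂_apply, Prod.snd_add, Prod.fst_add, cvec_add]
        rw [B.symm y.1 x.1]; module
      · simp only [torBracketCoeff, LinearMap.mk₂_apply, Prod.snd_add]; module

theorem preTorBracket_exact_right (B : InvForm L) (μ ν : ℂ) (x y : PreToroidal N L)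
    (hy : y ∈ exactForms N) : preTorBracket B μ ν x y ∈ exactForms N := by
  have h := sub_mem (preTorBracket_skew B μ ν x y) (preTorBracket_exact_left B μ ν y x hy)
  simpa using h

set_option maxHeartbeats 1000000 in
theorem preTorBracket_jacobi (B : InvForm L) (μ ν : ℂ) (x y z : PreToroidal N L) :
    preTorBracket B μ ν x (preTorBracket B μ ν y z)
      - preTorBracket B μ ν (preTorBracket B μ ν x y) z
      - preTorBracket B μ ν y (preTorBracket B μ ν x z) ∈ exactForms N := by
  induction x using Finsupp.induction_linear with
  | zero => simp
  | add a b ha hb =>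
    convert add_mem ha hb using 1
    simp only [map_add, LinearMap.add_apply]; abel
  | single r x =>
  induction y using Finsupp.induction_linear with
  | zero => simp
  | add a b ha hb =>
    convert add_mem ha hb using 1
    simp only [map_add, LinearMap.add_apply]; abel
  | single m y =>
  induction z using Finsupp.induction_linear with
  | zero => simp
  | add a b ha hb =>
    convert add_mem ha hb using 1
    simp only [map_add]; abel
  | single n z =>
  simp only [preTorBracket_single]
  rw [show r + m + n = r + (m + n) from add_assoc _ _ _,
    show m + (r + n) = r + (m + n) from add_left_comm _ _ _,
    ← Finsupp.single_sub, ← Finsupp.single_sub]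
  obtain ⟨g, κ, δ⟩ := x
  obtain ⟨g', κ', δ'⟩ := y
  obtain ⟨g'', κ'', δ''⟩ := z
  have h1 : B.form g' ⁅g, g''⁆ = -B.form g ⁅g', g''⁆ := by
    rw [← B.invariant, ← B.invariant, ← lie_skew g' g, map_neg, LinearMap.neg_apply]
  refine single_mem_exactForms (L := L) (r + (m + n))
    (B.form g g' * (δ'' ⬝ᵥ cvec r)
      + (δ ⬝ᵥ cvec n) * (μ * ((δ' ⬝ᵥ cvec n) * (δ'' ⬝ᵥ cvec m))
          + ν * ((δ' ⬝ᵥ cvec m) * (δ'' ⬝ᵥ cvec n)))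
      - (μ * ((δ' ⬝ᵥ cvec (r + n)) *
            (((δ ⬝ᵥ cvec n) • δ'' - (δ'' ⬝ᵥ cvec r) • δ) ⬝ᵥ cvec m))
          + ν * ((δ' ⬝ᵥ cvec m) *
            (((δ ⬝ᵥ cvec n) • δ'' - (δ'' ⬝ᵥ cvec r) • δ) ⬝ᵥ cvec (r + n)))))
    (Prod.ext ?_ (Prod.ext ?_ ?_))
  · simp only [torBracketCoeff, LinearMap.mk₂_apply, Prod.fst_sub, cvec_add, dotProduct_add,
      sub_dotProduct, smul_dotProduct, lie_add, lie_sub, add_lie, sub_lie, lie_smul, smul_lie,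
      smul_eq_mul]
    rw [leibniz_lie g g' g'', ← lie_skew g g']
    module
  · simp only [torBracketCoeff, LinearMap.mk₂_apply, Prod.snd_sub, Prod.fst_sub, cvec_add,
      dotProduct_add, sub_dotProduct, smul_dotProduct, dotProduct_sub, dotProduct_smul, map_add,
      map_sub, map_smul, LinearMap.add_apply, LinearMap.sub_apply, LinearMap.smul_apply,
      smul_eq_mul, h1, B.invariant g g' g'', B.symm g' g]
    module
  · simp only [torBracketCoeff, LinearMap.mk₂_apply, Prod.snd_sub, cvec_add, dotProduct_add,
      sub_dotProduct, smul_dotProduct, smul_eq_mul]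
    module

/-- The full toroidal Lie algebra `𝔤(μ, ν) = (R ⊗ L) ⊕ Ω¹/d(R) ⊕ D`. -/
def Toroidal (N : ℕ) {L : Type*} [LieRing L] [LieAlgebra ℂ L] (_B : InvForm L) (_μ _ν : ℂ) :=
  PreToroidal N L ⧸ exactForms N (L := L)

namespace Toroidal
variable {B : InvForm L} {μ ν : ℂ}

instance : AddCommGroup (Toroidal N B μ ν) :=
  Submodule.Quotient.addCommGroup (exactForms N (L := L))

instance : Module ℂ (Toroidal N B μ ν) :=
  Submodule.Quotient.module (exactForms N (L := L))

/-- The canonical projection. -/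
def proj : PreToroidal N L →ₗ[ℂ] Toroidal N B μ ν := (exactForms N (L := L)).mkQ

theorem proj_surjective : Function.Surjective (proj : PreToroidal N L →ₗ[ℂ] Toroidal N B μ ν) :=
  (exactForms N (L := L)).mkQ_surjective

theorem proj_eq_zero {x : PreToroidal N L} :
    (proj x : Toroidal N B μ ν) = 0 ↔ x ∈ exactForms N :=
  Submodule.Quotient.mk_eq_zero _

/-- Linear maps out of `𝔤` are linear maps that kill the exact forms. -/
def lift {M : Type*} [AddCommGroup M] [Module ℂ M] (f : PreToroidal N L →ₗ[ℂ] M)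
    (hf : ∀ x ∈ exactForms N, f x = 0) : Toroidal N B μ ν →ₗ[ℂ] M :=
  (exactForms N (L := L)).liftQ f hf

theorem lift_proj {M : Type*} [AddCommGroup M] [Module ℂ M] (f : PreToroidal N L →ₗ[ℂ] M)
    (hf : ∀ x ∈ exactForms N, f x = 0) (x : PreToroidal N L) :
    lift f hf (proj x : Toroidal N B μ ν) = f x := rfl

/-- The bracket of `𝔤(μ, ν)`, induced by `preTorBracket`. -/
def bracket : Toroidal N B μ ν →ₗ[ℂ] Toroidal N B μ ν →ₗ[ℂ] Toroidal N B μ ν :=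
  lift (LinearMap.flip (lift (LinearMap.flip ((preTorBracket B μ ν).compr₂ proj))
      (fun y hy => LinearMap.ext fun x =>
        proj_eq_zero.2 (preTorBracket_exact_right B μ ν x y hy))))
    (fun x hx => LinearMap.ext fun y => by
      obtain ⟨y, rfl⟩ := proj_surjective y
      exact proj_eq_zero.2 (preTorBracket_exact_left B μ ν x y hx))

theorem bracket_proj (x y : PreToroidal N L) :
    bracket (proj x : Toroidal N B μ ν) (proj y) = proj (preTorBracket B μ ν x y) := rfl

instance : LieRing (Toroidal N B μ ν) where
  bracket x y := bracket x y
  add_lie x y z := by simp only [map_add, LinearMap.add_apply]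
  lie_add x y z := by simp only [map_add]
  lie_self x := by
    obtain ⟨x, rfl⟩ := proj_surjective x
    have h := proj_eq_zero (B := B) (μ := μ) (ν := ν).2 (preTorBracket_skew B μ ν x x)
    rw [map_add, ← two_smul ℂ] at h
    exact (smul_eq_zero.1 h).resolve_left two_ne_zero
  leibniz_lie x y z := by
    obtain ⟨x, rfl⟩ := proj_surjective x
    obtain ⟨y, rfl⟩ := proj_surjective y
    obtain ⟨z, rfl⟩ := proj_surjective z
    have h := proj_eq_zero (B := B) (μ := μ) (ν := ν).2 (preTorBracket_jacobi B μ ν x y z)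
    rw [map_sub, map_sub, sub_sub, sub_eq_zero] at h
    exact h

instance : LieAlgebra ℂ (Toroidal N B μ ν) where
  lie_smul s x y := map_smul (bracket x) s y

/-- The element `t^r g + ∑ a, κ a • t^r k_a + ∑ a, δ a • t^r d_a` of `𝔤`, for `x = (g, κ, δ)`. -/
def mono (r : Fin (N + 1) → ℤ) : TorCoeff N L →ₗ[ℂ] Toroidal N B μ ν :=
  proj ∘ₗ Finsupp.lsingle r

/-- `t^r g`, for `g` in the simple Lie algebra. -/
def tg (r : Fin (N + 1) → ℤ) (g : L) : Toroidal N B μ ν := mono r (g, 0, 0)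

/-- `t^r k_a`, the class of the 1-form `t^r t_a⁻¹ dt_a`. -/
def tk (r : Fin (N + 1) → ℤ) (a : Fin (N + 1)) : Toroidal N B μ ν := mono r (0, Pi.single a 1, 0)

/-- `t^r d_a`, the vector field `t^r t_a ∂/∂t_a`. -/
def td (r : Fin (N + 1) → ℤ) (a : Fin (N + 1)) : Toroidal N B μ ν := mono r (0, 0, Pi.single a 1)

theorem lie_mono (r m : Fin (N + 1) → ℤ) (x y : TorCoeff N L) :
    ⁅(mono r x : Toroidal N B μ ν), (mono m y : Toroidal N B μ ν)⁆ = mono (r + m) (torBracketCoeff B μ ν r m x y) :=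
  congrArg proj (preTorBracket_single B μ ν r m x y)

theorem mono_exact (r : Fin (N + 1) → ℤ) (s : ℂ) :
    (mono r (0, s • cvec r, 0) : Toroidal N B μ ν) = 0 :=
  proj_eq_zero.2 (single_mem_exactForms r s rfl)

theorem sum_tk (r : Fin (N + 1) → ℤ) (κ : Fin (N + 1) → ℂ) :
    ∑ p, κ p • (tk r p : Toroidal N B μ ν) = mono r (0, κ, 0) := by
  simp only [tk, ← map_smul, ← map_sum]
  congr 1
  refine Prod.ext ?_ (Prod.ext ?_ ?_)
  · simp [Prod.fst_sum]
  · ext i; simp [Prod.fst_sum, Prod.snd_sum, Finset.sum_apply, Pi.single_apply]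
  · simp [Prod.snd_sum]

/-! The defining relations of `𝔤(μ, ν)`. -/

theorem sum_tk_eq_zero (r : Fin (N + 1) → ℤ) :
    ∑ p, (r p : ℂ) • (tk r p : Toroidal N B μ ν) = 0 := by
  rw [sum_tk]
  have h := mono_exact (B := B) (μ := μ) (ν := ν) r 1
  rw [one_smul] at h
  exact h

theorem lie_tg_tg (r m : Fin (N + 1) → ℤ) (g g' : L) :
    ⁅(tg r g : Toroidal N B μ ν), (tg m g' : Toroidal N B μ ν)⁆ =
      tg (r + m) ⁅g, g'⁆ + B.form g g' • ∑ p, (r p : ℂ) • tk (r + m) p := by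
  rw [sum_tk, tg, tg, lie_mono, tg, ← map_smul, ← map_add]
  congr 1
  simp [torBracketCoeff]; rfl

theorem lie_tg_tk (r m : Fin (N + 1) → ℤ) (g : L) (a : Fin (N + 1)) :
    ⁅(tg r g : Toroidal N B μ ν), (tk m a : Toroidal N B μ ν)⁆ = 0 := by
  rw [tg, tk, lie_mono]
  simp only [torBracketCoeff, LinearMap.mk₂_apply]; simp; exact map_zero _

theorem lie_tk_tk (r m : Fin (N + 1) → ℤ) (a b : Fin (N + 1)) :
    ⁅(tk r a : Toroidal N B μ ν), (tk m b : Toroidal N B μ ν)⁆ = 0 := by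
  rw [tk, tk, lie_mono]
  simp only [torBracketCoeff, LinearMap.mk₂_apply]; simp; exact map_zero _

theorem lie_td_tg (r m : Fin (N + 1) → ℤ) (a : Fin (N + 1)) (g : L) :
    ⁅(td r a : Toroidal N B μ ν), (tg m g : Toroidal N B μ ν)⁆ = (m a : ℂ) • tg (r + m) g := by
  rw [td, tg, lie_mono, tg, ← map_smul]
  simp [torBracketCoeff, cvec]

theorem lie_td_tk (r m : Fin (N + 1) → ℤ) (a b : Fin (N + 1)) :
    ⁅(td r a : Toroidal N B μ ν), (tk m b : Toroidal N B μ ν)⁆ = (m a : ℂ) • tk (r + m) b +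
      if a = b then ∑ p, (r p : ℂ) • tk (r + m) p else 0 := by
  rw [sum_tk, td, tk, lie_mono, tk, ← map_smul]
  split_ifs with h
  · subst h
    rw [← map_add]; simp [torBracketCoeff, cvec]; rfl
  · simp [torBracketCoeff, cvec, h]

theorem lie_td_td (r m : Fin (N + 1) → ℤ) (a b : Fin (N + 1)) :
    ⁅(td r a : Toroidal N B μ ν), (td m b : Toroidal N B μ ν)⁆ =
      (m a : ℂ) • td (r + m) b - (r b : ℂ) • td (r + m) a
        + (μ * (m a * r b) + ν * (r a * m b)) • ∑ p, (m p : ℂ) • tk (r + m) p := by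
  rw [sum_tk, td, td, lie_mono, td, td, ← map_smul, ← map_smul, ← map_smul, ← map_sub, ← map_add]
  simp [torBracketCoeff, cvec]; rfl

theorem lie_mem_span {S : Set (Toroidal N B μ ν)}
    (hS : ∀ x ∈ S, ∀ y ∈ S, ⁅x, y⁆ ∈ Submodule.span ℂ S) {x y : Toroidal N B μ ν}
    (hx : x ∈ Submodule.span ℂ S) (hy : y ∈ Submodule.span ℂ S) : ⁅x, y⁆ ∈ Submodule.span ℂ S := by
  induction hx, hy using Submodule.span_induction₂ with
  | mem_mem x y hx hy => exact hS x hx y hy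
  | zero_left y hy => simp
  | zero_right x hx => simp
  | add_left x y z _ _ _ h h' => rw [add_lie]; exact add_mem h h'
  | add_right x y z _ _ _ h h' => rw [lie_add]; exact add_mem h h'
  | smul_left s x y _ _ h => rw [smul_lie]; exact Submodule.smul_mem _ _ h
  | smul_right s x y _ _ h => rw [lie_smul]; exact Submodule.smul_mem _ _ h

variable (B μ ν) in
/-- `𝔤₀ ⊕ 𝔤₊`, the part of `𝔤` of non-negative degree in `t_0`. -/
def nonneg : LieSubalgebra ℂ (Toroidal N B μ ν) where
  toSubmodule := Submodule.span ℂ {x | ∃ r : Fin (N + 1) → ℤ, 0 ≤ r 0 ∧ ∃ y, x = mono r y}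
  lie_mem' := lie_mem_span (by
    rintro _ ⟨r, hr, x, rfl⟩ _ ⟨m, hm, y, rfl⟩
    exact Submodule.subset_span ⟨r + m, add_nonneg hr hm, _, lie_mono r m x y⟩)

end Toroidal

/-! ### The vertex Lie algebra structure: generating fields and their moments -/

/-- Labels of the generating fields of `𝔤`; here `r ∈ ℤ^N`, `p = 1, …, N` (counted from `0`). -/
inductive GenField (N : ℕ) (L : Type*)
  | k0 (r : Fin N → ℤ)
  | k (r : Fin N → ℤ) (p : Fin N)
  | g (r : Fin N → ℤ) (x : L)
  | d (r : Fin N → ℤ) (p : Fin N)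
  | d0 (r : Fin N → ℤ)

namespace Toroidal
variable {B : InvForm L} {μ ν : ℂ}

/-- The coefficient `u(n)` at `z^(-n-1)` of the generating field `u(z)` of `𝔤`, for the fields
`k_0(r,z) = ∑ j, t_0^j t^r k_0 z^(-j)`, `k_p(r,z) = ∑ j, t_0^j t^r k_p z^(-j-1)`,
`g(r,z) = ∑ j, t_0^j t^r g z^(-j-1)`, `d̃_p(r,z) = ∑ j, t_0^j t^r d̃_p z^(-j-1)`,
`d̃_0(r,z) = ∑ j, t_0^j t^r d̃_0 z^(-j-2)`, where
`t_0^j t^r d̃_p = t_0^j t^r d_p - ν r_p t_0^j t^r k_0` and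
`t_0^j t^r d̃_0 = - t_0^j t^r d_0 + (μ + ν) (j + 1/2) t_0^j t^r k_0`. -/
def moment : GenField N L → ℤ → Toroidal N B μ ν
  | .k0 r, n => tk (Fin.cons (n + 1) r) 0
  | .k r p, n => tk (Fin.cons n r) p.succ
  | .g r x, n => tg (Fin.cons n r) x
  | .d r p, n => td (Fin.cons n r) p.succ - (ν * r p) • tk (Fin.cons n r) 0
  | .d0 r, n => -td (Fin.cons (n - 1) r) 0
      + ((μ + ν) * (((n - 1 : ℤ) : ℂ) + 1 / 2)) • tk (Fin.cons (n - 1) r) 0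

/-- A spanning condition: `t_0^j t^r x` lies in the span of the `u(n)`, `n ≥ 0`. -/
def IsPlus (μ ν : ℂ) (r : Fin (N + 1) → ℤ) (x : TorCoeff N L) : Prop :=
  1 ≤ r 0 ∨
  (r 0 = 0 ∧ x.2.1 0 + ν * (x.2.2 ⬝ᵥ cvec r) + (μ + ν) / 2 * x.2.2 0 = 0) ∨
  (r 0 = -1 ∧ x.1 = 0 ∧ ∃ e s : ℂ, x.2.2 = Pi.single 0 e ∧
    x.2.1 = Pi.single 0 ((μ + ν) / 2 * e) + s • cvec r)

theorem mono_eq_sum (r : Fin (N + 1) → ℤ) (x : TorCoeff N L) :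
    (mono r x : Toroidal N B μ ν) =
      tg r x.1 + ∑ a, x.2.1 a • tk r a + ∑ a, x.2.2 a • td r a := by
  rw [sum_tk]
  simp only [tg, td, ← map_smul, ← map_sum, ← map_add]
  congr 1
  refine Prod.ext ?_ (Prod.ext ?_ ?_)
  · simp [Prod.fst_sum]
  · simp [Prod.fst_sum, Prod.snd_sum]
  · ext i; simp [Prod.snd_sum, Finset.sum_apply, Pi.single_apply]

theorem dot_cvec (δ : Fin (N + 1) → ℂ) (r : Fin (N + 1) → ℤ) :
    δ ⬝ᵥ cvec r = δ 0 * r 0 + Fin.tail δ ⬝ᵥ cvec (Fin.tail r) := by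
  simp [dotProduct, Fin.sum_univ_succ, cvec, Fin.tail]

theorem mono_mem_plus {r : Fin (N + 1) → ℤ} {x : TorCoeff N L} (h : IsPlus μ ν r x) :
    (mono r x : Toroidal N B μ ν) ∈ Submodule.span ℂ
      {x : Toroidal N B μ ν | ∃ (u : GenField N L) (n : ℤ), 0 ≤ n ∧ x = moment u n} := by
  set S : Submodule ℂ (Toroidal N B μ ν) := Submodule.span ℂ
      {x : Toroidal N B μ ν | ∃ (u : GenField N L) (n : ℤ), 0 ≤ n ∧ x = moment u n} with hS
  have hmem : ∀ (u : GenField N L) (n : ℤ), 0 ≤ n → (moment u n : Toroidal N B μ ν) ∈ S :=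
    fun u n hn => Submodule.subset_span ⟨u, n, hn, rfl⟩
  obtain ⟨j, q, rfl⟩ : ∃ j q, r = Fin.cons j q := ⟨r 0, Fin.tail r, (Fin.cons_self_tail r).symm⟩
  -- expansion in terms of the moments
  have key : (mono (Fin.cons j q) x : Toroidal N B μ ν) =
      moment (.g q x.1) j + ∑ p, x.2.1 (Fin.succ p) • moment (.k q p) j
        + ∑ p, x.2.2 (Fin.succ p) • moment (.d q p) j - x.2.2 0 • moment (.d0 q) (j + 1)
        + (x.2.1 0 + ν * (Fin.tail x.2.2 ⬝ᵥ cvec q) + (μ + ν) * (j + 1 / 2) * x.2.2 0) •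
            moment (.k0 q) (j - 1) := by
    rw [mono_eq_sum, Fin.sum_univ_succ, Fin.sum_univ_succ]
    simp only [moment, sub_add_cancel, add_sub_cancel_right, smul_sub, Finset.sum_sub_distrib,
      smul_smul, ← Finset.sum_smul]
    have : ∑ p, x.2.2 (Fin.succ p) * (ν * (q p : ℂ)) = ν * (Fin.tail x.2.2 ⬝ᵥ cvec q) := by
      simp only [dotProduct, Finset.mul_sum, cvec, Fin.tail]
      exact Finset.sum_congr rfl fun p _ => by ring
    rw [this]
    module
  have hsum : ∀ (f : Fin N → ℂ) (u : Fin N → GenField N L), 0 ≤ j →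
      ∑ p, f p • (moment (u p) j : Toroidal N B μ ν) ∈ S := fun f u hj =>
    Submodule.sum_mem _ fun p _ => Submodule.smul_mem _ _ (hmem _ _ hj)
  rcases h with h | ⟨h, h'⟩ | ⟨h, h1, e, s, h2, h3⟩
  · rw [Fin.cons_zero] at h
    rw [key]
    exact add_mem (sub_mem (add_mem (add_mem (hmem _ _ (by lia)) (hsum _ _ (by lia)))
      (hsum _ _ (by lia))) (Submodule.smul_mem _ _ (hmem _ _ (by lia))))
      (Submodule.smul_mem _ _ (hmem _ _ (by lia)))
  · rw [Fin.cons_zero] at h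
    subst h
    rw [dot_cvec] at h'
    rw [key, show x.2.1 0 + ν * (Fin.tail x.2.2 ⬝ᵥ cvec q)
        + (μ + ν) * (((0 : ℤ) : ℂ) + 1 / 2) * x.2.2 0 = 0 by
      rw [← h']; simp only [Fin.cons_zero, Fin.tail_cons, Int.cast_zero]; ring, zero_smul, add_zero]
    exact sub_mem (add_mem (add_mem (hmem _ _ le_rfl) (hsum _ _ le_rfl))
      (hsum _ _ le_rfl)) (Submodule.smul_mem _ _ (hmem _ _ (by lia)))
  · rw [Fin.cons_zero] at h
    subst h
    obtain ⟨g, κ, δ⟩ := x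
    obtain rfl : g = 0 := h1
    obtain rfl : δ = _ := h2
    obtain rfl : κ = _ := h3
    have e1 : ((0 : L), Pi.single 0 ((μ + ν) / 2 * e) + s • cvec (Fin.cons (-1) q),
        (Pi.single 0 e : Fin (N + 1) → ℂ)) =
      (-e) • (-(0, 0, Pi.single 0 1)
        + ((μ + ν) * ((((0 : ℤ) - 1 : ℤ) : ℂ) + 1 / 2)) • (0, Pi.single 0 1, 0))
      + (0, s • cvec (Fin.cons (-1) q), 0) := by
      refine Prod.ext ?_ (Prod.ext ?_ ?_)
      · simp
      · ext i
        simp [Pi.single_apply]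
        split_ifs <;> ring
      · ext i
        simp [Pi.single_apply]
    rw [e1, map_add, mono_exact, add_zero, map_smul]
    refine Submodule.smul_mem _ _ ?_
    have := hmem (.d0 q) 0 le_rfl
    rw [map_add, map_neg, map_smul]
    exact this

theorem moment_eq_mono (u : GenField N L) {n : ℤ} (hn : 0 ≤ n) :
    ∃ r x, IsPlus μ ν r x ∧ (moment u n : Toroidal N B μ ν) = mono r x := by
  cases u with
  | k0 r => exact ⟨_, _, Or.inl (by simpa using hn), rfl⟩
  | k r p =>
    refine ⟨_, _, ?_, rfl⟩
    rcases hn.lt_or_eq with h | h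
    · exact Or.inl (by rw [Fin.cons_zero]; lia)
    · exact Or.inr (Or.inl ⟨by simp [← h], by simp⟩)
  | g r x =>
    refine ⟨_, _, ?_, rfl⟩
    rcases hn.lt_or_eq with h | h
    · exact Or.inl (by rw [Fin.cons_zero]; lia)
    · exact Or.inr (Or.inl ⟨by simp [← h], by simp⟩)
  | d r p =>
    refine ⟨Fin.cons n r, (0, 0, Pi.single p.succ 1) - (ν * r p) • (0, Pi.single 0 1, 0), ?_, ?_⟩
    · rcases hn.lt_or_eq with h | h
      · exact Or.inl (by rw [Fin.cons_zero]; lia)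
      · exact Or.inr (Or.inl ⟨by simp [← h], by simp [cvec]⟩)
    · rw [map_sub, map_smul]; rfl
  | d0 r =>
    refine ⟨Fin.cons (n - 1) r, -(0, 0, Pi.single 0 1)
      + ((μ + ν) * (((n - 1 : ℤ) : ℂ) + 1 / 2)) • (0, Pi.single 0 1, 0), ?_, ?_⟩
    · rcases lt_trichotomy n 1 with h | h | h
      · obtain rfl : n = 0 := by lia
        refine Or.inr (Or.inr ⟨by simp, by simp, -1, 0, ?_, ?_⟩)
        · ext i; simp [Pi.single_apply]; split_ifs <;> simp
        · ext i
          simp [Pi.single_apply]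
          split_ifs <;> ring
      · subst h
        exact Or.inr (Or.inl ⟨by simp, by simp [cvec]; ring⟩)
      · exact Or.inl (by rw [Fin.cons_zero]; lia)
    · rw [map_add, map_neg, map_smul]; rfl

theorem isPlus_minus {r : Fin (N + 1) → ℤ} {x : TorCoeff N L} (h : IsPlus μ ν r x)
    (hr : r 0 = -1) : ∃ e : ℂ, (mono r x : Toroidal N B μ ν) =
      mono r (0, Pi.single 0 ((μ + ν) / 2 * e), Pi.single 0 e) := by
  rcases h with h | ⟨h, -⟩ | ⟨-, h1, e, s, h2, h3⟩
  · lia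
  · lia
  · refine ⟨e, ?_⟩
    obtain ⟨g, κ, δ⟩ := x
    obtain rfl : g = 0 := h1
    obtain rfl : δ = _ := h2
    obtain rfl : κ = _ := h3
    rw [← sub_eq_zero, ← map_sub]
    convert mono_exact (B := B) (μ := μ) (ν := ν) r s using 2
    refine Prod.ext ?_ (Prod.ext ?_ ?_) <;> simp

theorem cvec_apply {n : ℕ} (r : Fin n → ℤ) (a : Fin n) : cvec r a = (r a : ℂ) := rfl

theorem lie_mono_mem_plus_aux {r m : Fin (N + 1) → ℤ} (e : ℂ) {y : TorCoeff N L}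
    (hr : r 0 = -1) (hy : IsPlus μ ν m y) :
    ⁅(mono r (0, Pi.single 0 ((μ + ν) / 2 * e), Pi.single 0 e) : Toroidal N B μ ν),
      (mono m y : Toroidal N B μ ν)⁆ ∈ Submodule.span ℂ
      {x : Toroidal N B μ ν | ∃ (u : GenField N L) (n : ℤ), 0 ≤ n ∧ x = moment u n} := by
  have hrc : cvec r 0 = -1 := by simp [cvec, hr]
  by_cases hm : m 0 = -1
  · obtain ⟨e', he'⟩ := isPlus_minus (B := B) hy hm
    have hmc : cvec m 0 = -1 := by simp [cvec, hm]
    rw [he', lie_mono]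
    convert Submodule.zero_mem _
    convert mono_exact (B := B) (μ := μ) (ν := ν) (r + m) ((μ + ν) / 2 * e * e') using 2
    refine Prod.ext ?_ (Prod.ext ?_ ?_)
    · simp [torBracketCoeff]
    · simp only [torBracketCoeff, LinearMap.mk₂_apply, single_dotProduct, Pi.single_eq_same,
        hrc, hmc, cvec_add, map_zero]
      ext i
      simp [Pi.single_apply]
      split_ifs <;> ring
    · simp only [torBracketCoeff, LinearMap.mk₂_apply, single_dotProduct, hrc, hmc]
      ext i
      simp [Pi.single_apply]
      split_ifs <;> ring
  rw [lie_mono]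
  apply mono_mem_plus
  obtain ⟨g, κ, δ⟩ := y
  rcases hy with h | ⟨h, h'⟩ | ⟨h, -⟩
  · by_cases h1 : m 0 = 1
    · have hmc : cvec m 0 = 1 := by simp [cvec, h1]
      refine Or.inr (Or.inl ⟨by simp [hr, h1], ?_⟩)
      simp only [torBracketCoeff, LinearMap.mk₂_apply, single_dotProduct, hrc, hmc, cvec_add,
        dotProduct_add, sub_dotProduct, smul_dotProduct, dotProduct_single]
      simp [hrc, hmc]
      ring
    · exact Or.inl (by rw [Pi.add_apply]; lia)
  · have hmc : cvec m 0 = 0 := by simp [cvec, h]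
    refine Or.inr (Or.inr ⟨by simp [hr, h], ?_, -(δ ⬝ᵥ cvec r) * e, e * κ 0, ?_, ?_⟩)
    · simp [torBracketCoeff, hmc]
    · simp only [torBracketCoeff, LinearMap.mk₂_apply, single_dotProduct, hmc]
      ext i
      simp [Pi.single_apply]
      split_ifs <;> simp
    · have h'' : κ 0 = -(ν * (δ ⬝ᵥ cvec m) + (μ + ν) / 2 * δ 0) := by linear_combination h'
      simp only [torBracketCoeff, LinearMap.mk₂_apply, single_dotProduct, hrc, hmc, cvec_add,
        dotProduct_single, h'']
      ext i
      simp [Pi.single_apply]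
      split_ifs <;> ring
  · exact absurd h hm

theorem lie_mono_mem_plus {r m : Fin (N + 1) → ℤ} {x y : TorCoeff N L}
    (hx : IsPlus μ ν r x) (hy : IsPlus μ ν m y) :
    ⁅(mono r x : Toroidal N B μ ν), (mono m y : Toroidal N B μ ν)⁆ ∈ Submodule.span ℂ
      {x : Toroidal N B μ ν | ∃ (u : GenField N L) (n : ℤ), 0 ≤ n ∧ x = moment u n} := by
  by_cases hr : r 0 = -1
  · obtain ⟨e, he⟩ := isPlus_minus (B := B) hx hr
    rw [he]
    exact lie_mono_mem_plus_aux e hr hy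
  by_cases hm : m 0 = -1
  · obtain ⟨e, he⟩ := isPlus_minus (B := B) hy hm
    rw [← lie_skew, he]
    exact Submodule.neg_mem _ (lie_mono_mem_plus_aux e hm hx)
  rw [lie_mono]
  apply mono_mem_plus
  have hr0 : 0 ≤ r 0 := by rcases hx with h | ⟨h, -⟩ | ⟨h, -⟩ <;> lia
  have hm0 : 0 ≤ m 0 := by rcases hy with h | ⟨h, -⟩ | ⟨h, -⟩ <;> lia
  by_cases hp : 1 ≤ (r + m) 0
  · exact Or.inl hp
  rw [Pi.add_apply] at hp
  have hr1 : r 0 = 0 := by lia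
  have hm1 : m 0 = 0 := by lia
  refine Or.inr (Or.inl ⟨by simp [hr1, hm1], ?_⟩)
  have hrc : cvec r 0 = 0 := by simp [cvec, hr1]
  have hmc : cvec m 0 = 0 := by simp [cvec, hm1]
  have hx' : x.2.1 0 + ν * (x.2.2 ⬝ᵥ cvec r) + (μ + ν) / 2 * x.2.2 0 = 0 := by
    rcases hx with h | ⟨-, h⟩ | ⟨h, -⟩
    · lia
    · exact h
    · lia
  have hy' : y.2.1 0 + ν * (y.2.2 ⬝ᵥ cvec m) + (μ + ν) / 2 * y.2.2 0 = 0 := by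
    rcases hy with h | ⟨-, h⟩ | ⟨h, -⟩
    · lia
    · exact h
    · lia
  simp only [torBracketCoeff, LinearMap.mk₂_apply, cvec_add, dotProduct_add, sub_dotProduct,
    smul_dotProduct, Pi.add_apply, Pi.sub_apply, Pi.smul_apply, smul_eq_mul, hrc, hmc]
  linear_combination (x.2.2 ⬝ᵥ cvec m) * hy' - (y.2.2 ⬝ᵥ cvec r) * hx'

variable (B μ ν) in
/-- The subalgebra `𝔤^(+)` of the vertex Lie algebra `𝔤`, spanned by the moments `u(n)`, `n ≥ 0`,
of the generating fields. -/
def plus : LieSubalgebra ℂ (Toroidal N B μ ν) where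
  toSubmodule := Submodule.span ℂ
    {x | ∃ (u : GenField N L) (n : ℤ), 0 ≤ n ∧ x = moment u n}
  lie_mem' := lie_mem_span (by
    rintro _ ⟨u, n, hn, rfl⟩ _ ⟨u', n', hn', rfl⟩
    obtain ⟨r, x, hx, e⟩ := moment_eq_mono (B := B) (μ := μ) (ν := ν) u hn
    obtain ⟨m, y, hy, e'⟩ := moment_eq_mono (B := B) (μ := μ) (ν := ν) u' hn'
    rw [e, e']
    exact lie_mono_mem_plus hx hy)

end Toroidal

end

/-! ### Induced modules -/

section
attribute [local instance 100] LieRing.ofAssociativeRing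

variable {𝔤 : Type*} [LieRing 𝔤] [LieAlgebra ℂ 𝔤] (p : LieSubalgebra ℂ 𝔤)
  (T : Type*) [AddCommGroup T] [Module ℂ T] [LieRingModule p T]

/-- The `U(𝔤)`-submodule of `U(𝔤) ⊗ T` generated by `x ⊗ t - 1 ⊗ x t` for `x ∈ p`, `t ∈ T`. -/
def indRelations :
    Submodule (UniversalEnvelopingAlgebra ℂ 𝔤) (UniversalEnvelopingAlgebra ℂ 𝔤 ⊗[ℂ] T) :=
  Submodule.span _ {w | ∃ (x : p) (t : T),
    w = UniversalEnvelopingAlgebra.ι ℂ (x : 𝔤) ⊗ₜ[ℂ] t - 1 ⊗ₜ[ℂ] ⁅x, t⁆}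

/-- The induced module `Ind_p^𝔤 T = U(𝔤) ⊗_{U(p)} T`. -/
def IndModule := (UniversalEnvelopingAlgebra ℂ 𝔤 ⊗[ℂ] T) ⧸ indRelations p T

namespace IndModule

instance : AddCommGroup (IndModule p T) :=
  Submodule.Quotient.addCommGroup (indRelations p T)

instance : Module (UniversalEnvelopingAlgebra ℂ 𝔤) (IndModule p T) :=
  Submodule.Quotient.module (indRelations p T)

instance : Module ℂ (IndModule p T) :=
  Submodule.Quotient.module' (indRelations p T)

instance : IsScalarTower ℂ (UniversalEnvelopingAlgebra ℂ 𝔤) (IndModule p T) :=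
  inferInstanceAs (IsScalarTower ℂ (UniversalEnvelopingAlgebra ℂ 𝔤)
    ((UniversalEnvelopingAlgebra ℂ 𝔤 ⊗[ℂ] T) ⧸ indRelations p T))

instance : LieRingModule 𝔤 (IndModule p T) where
  bracket x v := UniversalEnvelopingAlgebra.ι ℂ x • v
  add_lie x y v := by rw [map_add, add_smul]
  lie_add x v w := smul_add _ _ _
  leibniz_lie x y v := by
    rw [LieHom.map_lie, LieRing.of_associative_ring_bracket, sub_smul, mul_smul, mul_smul,
      sub_add_cancel]

instance : LieModule ℂ 𝔤 (IndModule p T) where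
  smul_lie s x v := by
    change UniversalEnvelopingAlgebra.ι ℂ (s • x) • v = s • (UniversalEnvelopingAlgebra.ι ℂ x • v)
    rw [map_smul, smul_assoc]
  lie_smul s x v := smul_algebra_smul_comm s (UniversalEnvelopingAlgebra.ι ℂ x) v

variable {T}

/-- The image `1 ⊗ t` of `t ∈ T` in the induced module. -/
def of (t : T) : IndModule p T := (indRelations p T).mkQ (1 ⊗ₜ[ℂ] t)

/-- `x (1 ⊗ t) = 1 ⊗ x t` for `x ∈ p`. -/
theorem lie_of (x : p) (t : T) : ⁅(x : 𝔤), of p t⁆ = of p ⁅x, t⁆ := by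
  refine (Submodule.Quotient.eq (indRelations p T)).2 (Submodule.subset_span ⟨x, t, ?_⟩)
  simp [TensorProduct.smul_tmul']

end IndModule

/-! ### Tensor modules over `𝔤₀ ⊕ 𝔤₊` and generalized Verma modules -/

section
variable {N : ℕ} {L : Type*} [LieRing L] [LieAlgebra ℂ L]

/-- The space `T = ℂ[q_1^±, …, q_N^±] ⊗ V ⊗ W`, where `V` is a module for the simple Lie algebra
and `W` is a `gl_N`-module; `q^m ⊗ u` is `Finsupp.single m u`.  Its structure of a module over
`𝔤₀ ⊕ 𝔤₊` depends on the parameters `c`, `d`, `α`. -/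
@[nolint unusedArguments]
def TensorTop (_B : InvForm L) (_μ _ν : ℂ) (V W : Type*) [AddCommGroup V] [Module ℂ V]
    [AddCommGroup W] [Module ℂ W] (_c _d : ℂ) (_α : Fin N → ℂ) :=
  (Fin N → ℤ) →₀ (V ⊗[ℂ] W)

namespace TensorTop

variable {B : InvForm L} {μ ν : ℂ}
  {V W : Type*} [AddCommGroup V] [Module ℂ V] [AddCommGroup W] [Module ℂ W]
  {c d : ℂ} {α : Fin N → ℂ}

instance : AddCommGroup (TensorTop B μ ν V W c d α) :=
  inferInstanceAs (AddCommGroup ((Fin N → ℤ) →₀ (V ⊗[ℂ] W)))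

instance : Module ℂ (TensorTop B μ ν V W c d α) :=
  inferInstanceAs (Module ℂ ((Fin N → ℤ) →₀ (V ⊗[ℂ] W)))

/-- `q^m ⊗ u`. -/
def q (m : Fin N → ℤ) : V ⊗[ℂ] W →ₗ[ℂ] TensorTop B μ ν V W c d α := Finsupp.lsingle m

/-- Linear maps out of `T` are determined by their values on `q^m ⊗ u`. -/
def lift {M : Type*} [AddCommGroup M] [Module ℂ M] (f : (Fin N → ℤ) → V ⊗[ℂ] W →ₗ[ℂ] M) :
    TensorTop B μ ν V W c d α →ₗ[ℂ] M := Finsupp.lsum ℂ f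

theorem lift_q {M : Type*} [AddCommGroup M] [Module ℂ M] (f : (Fin N → ℤ) → V ⊗[ℂ] W →ₗ[ℂ] M)
    (m : Fin N → ℤ) (u : V ⊗[ℂ] W) :
    lift f (q m u : TensorTop B μ ν V W c d α) = f m u :=
  Finsupp.lsum_single ℂ f m u

theorem hom_ext {M : Type*} [AddCommGroup M] [Module ℂ M]
    {f f' : TensorTop B μ ν V W c d α →ₗ[ℂ] M}
    (h : ∀ m v w, f (q m (v ⊗ₜ w)) = f' (q m (v ⊗ₜ w))) : f = f' :=
  Finsupp.lhom_ext' fun m => TensorProduct.ext' fun v w => h m v w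

variable [LieRingModule L V] [LieModule ℂ L V] [LieRingModule (Matrix (Fin N) (Fin N) ℂ) W]
  [LieModule ℂ (Matrix (Fin N) (Fin N) ℂ) W]

theorem tail_add' {R : Type*} [Add R] (a b : Fin (N + 1) → R) :
    Fin.tail (a + b) = Fin.tail a + Fin.tail b := rfl

theorem tail_sub' {R : Type*} [Sub R] (a b : Fin (N + 1) → R) :
    Fin.tail (a - b) = Fin.tail a - Fin.tail b := rfl

theorem tail_smul' (s : ℂ) (a : Fin (N + 1) → ℂ) : Fin.tail (s • a) = s • Fin.tail a := rfl

/-- The operator on `V ⊗ W` through which `t^r x`, `x = (g, κ, δ)`, sends `q^m ⊗ u` to `q^(m+r) ⊗ u'`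
when `r_0 = 0`:
`c κ_0 + d δ_0 + ∑ j, δ_j (m_j + α_j) + g ⊗ 1 + 1 ⊗ ∑ p j, r_p δ_j E_pj` (with `p, j = 1, …, N`). -/
def actCoeff (c d : ℂ) (α : Fin N → ℂ) (r : Fin (N + 1) → ℤ) (m : Fin N → ℤ)
    (x : TorCoeff N L) : Module.End ℂ (V ⊗[ℂ] W) :=
  (c * x.2.1 0 + d * x.2.2 0 + ∑ j, x.2.2 (Fin.succ j) * (m j + α j)) • LinearMap.id
    + (LieModule.toEnd ℂ L V x.1).rTensor W
    + (LieModule.toEnd ℂ (Matrix (Fin N) (Fin N) ℂ) W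
        (Matrix.of fun p j => (r (Fin.succ p) : ℂ) * x.2.2 (Fin.succ j))).lTensor V

theorem actCoeff_tmul (r : Fin (N + 1) → ℤ) (m : Fin N → ℤ) (x : TorCoeff N L) (v : V) (w : W) :
    actCoeff c d α r m x (v ⊗ₜ[ℂ] w) =
      (c * x.2.1 0 + d * x.2.2 0 + Fin.tail x.2.2 ⬝ᵥ (cvec m + α)) • (v ⊗ₜ[ℂ] w)
        + ⁅x.1, v⁆ ⊗ₜ w
        + v ⊗ₜ ⁅Matrix.vecMulVec (cvec (Fin.tail r)) (Fin.tail x.2.2), w⁆ := by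
  rfl

theorem actCoeff_add (r : Fin (N + 1) → ℤ) (m : Fin N → ℤ) (x y : TorCoeff N L) :
    actCoeff (V := V) (W := W) c d α r m (x + y) = actCoeff c d α r m x + actCoeff c d α r m y := by
  refine TensorProduct.ext' fun v w => ?_
  simp only [LinearMap.add_apply, actCoeff_tmul]
  simp only [tail_add', Prod.fst_add, Prod.snd_add, Pi.add_apply, add_dotProduct, add_lie,
    Matrix.vecMulVec_add, TensorProduct.add_tmul, TensorProduct.tmul_add]
  module

theorem actCoeff_smul (r : Fin (N + 1) → ℤ) (m : Fin N → ℤ) (s : ℂ) (x : TorCoeff N L) :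
    actCoeff (V := V) (W := W) c d α r m (s • x) = s • actCoeff c d α r m x := by
  refine TensorProduct.ext' fun v w => ?_
  simp only [LinearMap.smul_apply, actCoeff_tmul]
  simp only [tail_smul', Prod.smul_fst, Prod.smul_snd, Pi.smul_apply, smul_dotProduct, smul_lie,
    Matrix.vecMulVec_smul, TensorProduct.tmul_smul, ← TensorProduct.smul_tmul', smul_eq_mul]
  module

variable (B μ ν V W c d α) in
/-- The action of `(R ⊗ L) ⊕ Ω¹ ⊕ D` on `T`: the terms of degree `0` in `t_0` act through
`actCoeff`, the others act by zero. -/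
def preAct : PreToroidal N L →ₗ[ℂ] Module.End ℂ (TensorTop B μ ν V W c d α) :=
  Finsupp.lsum ℂ fun r =>
    { toFun := fun x => if r 0 = 0 then
        lift fun m => q (m + Fin.tail r) ∘ₗ actCoeff c d α r m x else 0
      map_add' := fun x y => by
        split_ifs
        · refine hom_ext fun m v w => ?_
          simp only [lift_q, LinearMap.add_apply, actCoeff_add, LinearMap.comp_apply, map_add]
        · simp
      map_smul' := fun s x => by
        split_ifs
        · refine hom_ext fun m v w => ?_
          simp only [lift_q, LinearMap.smul_apply, actCoeff_smul, LinearMap.comp_apply, map_smul,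
            RingHom.id_apply]
        · simp }

theorem preAct_single (r : Fin (N + 1) → ℤ) (x : TorCoeff N L) :
    preAct B μ ν V W c d α (Finsupp.single r x) = if r 0 = 0 then
        lift fun m => q (m + Fin.tail r) ∘ₗ actCoeff c d α r m x else 0 :=
  Finsupp.lsum_single ℂ _ r x

variable (B μ ν V W c d α) in
/-- The induced map on `𝔤`; on `𝔤₀ ⊕ 𝔤₊` it is a representation. -/
def act : Toroidal N B μ ν →ₗ[ℂ] Module.End ℂ (TensorTop B μ ν V W c d α) :=
  Toroidal.lift (preAct B μ ν V W c d α) (fun x hx => by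
    induction hx using Submodule.span_induction with
    | zero => simp
    | add a b _ _ ha hb => rw [map_add, ha, hb, add_zero]
    | smul s a _ ha => rw [map_smul, ha, smul_zero]
    | mem a ha =>
      obtain ⟨r, rfl⟩ := ha
      rw [preAct_single]
      split_ifs with h
      · refine hom_ext fun m v w => ?_
        rw [lift_q, LinearMap.comp_apply, actCoeff_tmul]
        have : Fin.tail (0 : Fin (N + 1) → ℂ) = 0 := rfl
        simp [cvec, h, this]
      · rfl)

theorem act_mono (r : Fin (N + 1) → ℤ) (x : TorCoeff N L) :
    act B μ ν V W c d α (Toroidal.mono r x) = if r 0 = 0 then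
        lift fun m => q (m + Fin.tail r) ∘ₗ actCoeff c d α r m x else 0 :=
  preAct_single r x

theorem act_lie_mono {r s : Fin (N + 1) → ℤ} (hr : 0 ≤ r 0) (hs : 0 ≤ s 0) (x y : TorCoeff N L) :
    act B μ ν V W c d α ⁅(Toroidal.mono r x : Toroidal N B μ ν),
        (Toroidal.mono s y : Toroidal N B μ ν)⁆ =
      ⁅act B μ ν V W c d α (Toroidal.mono r x), act B μ ν V W c d α (Toroidal.mono s y)⁆ := by
  rw [Toroidal.lie_mono, act_mono, act_mono, act_mono]
  by_cases h : r 0 = 0 ∧ s 0 = 0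
  · obtain ⟨hr0, hs0⟩ := h
    rw [if_pos (by simp [hr0, hs0]), if_pos hr0, if_pos hs0]
    refine hom_ext fun m v w => ?_
    rw [LieRing.of_associative_ring_bracket]
    simp only [LinearMap.sub_apply, Module.End.mul_apply, lift_q, LinearMap.comp_apply]
    have e1 : m + Fin.tail s + Fin.tail r = m + Fin.tail (r + s) := by
      rw [add_assoc, add_comm (Fin.tail s)]; rfl
    have e2 : m + Fin.tail r + Fin.tail s = m + Fin.tail (r + s) := by rw [add_assoc]; rfl
    rw [e1, e2, ← map_sub]
    refine congrArg _ ?_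
    have hrc : (r 0 : ℂ) = 0 := by simp [hr0]
    have hsc : (s 0 : ℂ) = 0 := by simp [hs0]
    have hrc' : cvec r 0 = 0 := hrc
    have hM : ⁅Matrix.vecMulVec (cvec (Fin.tail r)) (Fin.tail x.2.2),
          ⁅Matrix.vecMulVec (cvec (Fin.tail s)) (Fin.tail y.2.2), w⁆⁆ =
        ⁅Matrix.vecMulVec (cvec (Fin.tail s)) (Fin.tail y.2.2),
          ⁅Matrix.vecMulVec (cvec (Fin.tail r)) (Fin.tail x.2.2), w⁆⁆
        + (Fin.tail x.2.2 ⬝ᵥ cvec (Fin.tail s)) •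
            ⁅Matrix.vecMulVec (cvec (Fin.tail r)) (Fin.tail y.2.2), w⁆
        - (Fin.tail y.2.2 ⬝ᵥ cvec (Fin.tail r)) •
            ⁅Matrix.vecMulVec (cvec (Fin.tail s)) (Fin.tail x.2.2), w⁆ := by
      rw [leibniz_lie, LieRing.of_associative_ring_bracket, Matrix.vecMulVec_mul_vecMulVec,
        Matrix.vecMulVec_mul_vecMulVec, sub_lie, Matrix.vecMulVec_smul, Matrix.vecMulVec_smul,
        smul_lie, smul_lie]
      abel
    have hL : ⁅x.1, ⁅y.1, v⁆⁆ = ⁅⁅x.1, y.1⁆, v⁆ + ⁅y.1, ⁅x.1, v⁆⁆ := leibniz_lie _ _ _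
    simp only [actCoeff_tmul, map_add, map_smul, torBracketCoeff, LinearMap.mk₂_apply,
      tail_add', tail_sub', tail_smul', cvec_add, add_lie, sub_lie, smul_lie, hM, hL,
      TensorProduct.add_tmul, TensorProduct.tmul_add, TensorProduct.sub_tmul,
      TensorProduct.tmul_sub, ← TensorProduct.smul_tmul', TensorProduct.tmul_smul,
      Matrix.vecMulVec_sub, Matrix.vecMulVec_smul, Matrix.add_vecMulVec,
      sub_dotProduct, smul_dotProduct, dotProduct_add, Pi.add_apply,
      Pi.sub_apply, Pi.smul_apply, smul_eq_mul, Toroidal.dot_cvec, hrc, hsc, hrc',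
      show cvec s 0 = 0 from hsc]
    module
  · rw [not_and_or] at h
    have h1 : ¬ (r + s) 0 = 0 := by rw [Pi.add_apply]; lia
    rw [if_neg h1]
    rcases h with h | h
    · rw [if_neg h]; simp
    · rw [if_neg h]; simp

theorem act_lie {x y : Toroidal N B μ ν} (hx : x ∈ Toroidal.nonneg B μ ν (N := N))
    (hy : y ∈ Toroidal.nonneg B μ ν (N := N)) :
    act B μ ν V W c d α ⁅x, y⁆ = ⁅act B μ ν V W c d α x, act B μ ν V W c d α y⁆ := by
  induction hx, hy using Submodule.span_induction₂ with
  | mem_mem x y hx hy =>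
    obtain ⟨r, hr, x, rfl⟩ := hx
    obtain ⟨s, hs, y, rfl⟩ := hy
    exact act_lie_mono hr hs x y
  | zero_left y hy => simp
  | zero_right x hx => simp
  | add_left x y z _ _ _ h h' => rw [add_lie, map_add, h, h', map_add, add_lie]
  | add_right x y z _ _ _ h h' => rw [lie_add, map_add, h, h', map_add, lie_add]
  | smul_left s x y _ _ h => rw [smul_lie, map_smul, h, map_smul, smul_lie]
  | smul_right s x y _ _ h => rw [lie_smul, map_smul, h, map_smul, lie_smul]

instance : LieRingModule (Toroidal.nonneg B μ ν (N := N)) (TensorTop B μ ν V W c d α) where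
  bracket x t := act B μ ν V W c d α x t
  add_lie x y t := by simp
  lie_add x t t' := map_add _ _ _
  leibniz_lie x y t := by
    have h := act_lie (V := V) (W := W) (c := c) (d := d) (α := α) x.2 y.2
    rw [LieRing.of_associative_ring_bracket] at h
    have h' := LinearMap.congr_fun h t
    rw [LinearMap.sub_apply, eq_sub_iff_add_eq] at h'
    exact h'.symm

instance : LieModule ℂ (Toroidal.nonneg B μ ν (N := N)) (TensorTop B μ ν V W c d α) where
  smul_lie s x t := by
    change act B μ ν V W c d α (s • x : Toroidal N B μ ν) t = s • act B μ ν V W c d α x t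
    rw [map_smul]; rfl
  lie_smul s x t := map_smul (act B μ ν V W c d α x) s t

end TensorTop

/-- The one-dimensional `gl_N`-module on which `sl_N` acts trivially and the identity matrix acts as
multiplication by `h`. -/
@[nolint unusedArguments]
def GLLine (_N : ℕ) (_h : ℂ) := ℂ

namespace GLLine
variable {N : ℕ} {h : ℂ}

instance : AddCommGroup (GLLine N h) := inferInstanceAs (AddCommGroup ℂ)

instance : Module ℂ (GLLine N h) := inferInstanceAs (Module ℂ ℂ)

/-- The basis vector of the module. -/
def one : GLLine N h := (1 : ℂ)

instance : LieRingModule (Matrix (Fin N) (Fin N) ℂ) (GLLine N h) where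
  bracket A w := (h / N * A.trace) • w
  add_lie A A' w := by rw [Matrix.trace_add, mul_add, add_smul]
  lie_add A w w' := smul_add _ _ _
  leibniz_lie A A' w := by
    have : (⁅A, A'⁆ : Matrix (Fin N) (Fin N) ℂ).trace = 0 := by
      rw [LieRing.of_associative_ring_bracket, Matrix.trace_sub, Matrix.trace_mul_comm, sub_self]
    rw [this, mul_zero, zero_smul, zero_add, smul_comm]

instance : LieModule ℂ (Matrix (Fin N) (Fin N) ℂ) (GLLine N h) where
  smul_lie s A w := by
    change (h / N * (s • A).trace) • w = s • (h / N * A.trace) • w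
    rw [Matrix.trace_smul, smul_smul, smul_eq_mul]
    congr 1; ring
  lie_smul s A w := smul_comm _ _ _

end GLLine

variable (N) in
/-- The top `T₀ = ℂ[q_1^±, …, q_N^±]`: the tensor module with `α = 0`, `d = (μ + ν) c / 2`, trivial
one-dimensional `V`, and one-dimensional `W` with trivial action of `sl_N` and `h = N ν c`. -/
abbrev TopZero (B : InvForm L) (μ ν c : ℂ) :=
  TensorTop (N := N) B μ ν (TrivialLieModule ℂ L ℂ) (GLLine N (N * ν * c)) c ((μ + ν) * c / 2) 0

/-- The element `q^r` of `T₀`. -/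
def TopZero.q {B : InvForm L} {μ ν c : ℂ} (r : Fin N → ℤ) : TopZero N B μ ν c :=
  TensorTop.q r (((TrivialLieModule.equiv ℂ L ℂ).symm 1) ⊗ₜ[ℂ] GLLine.one)

variable (N) in
/-- The generalized Verma module `M(T) = Ind_{𝔤₀ ⊕ 𝔤₊}^𝔤 T`. -/
abbrev GenVerma (B : InvForm L) (μ ν : ℂ) (T : Type*) [AddCommGroup T] [Module ℂ T]
    [LieRingModule (Toroidal.nonneg B μ ν (N := N)) T] :=
  IndModule (Toroidal.nonneg B μ ν (N := N)) T

variable (N) in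
/-- The sum of all proper submodules of `M(T)`; it is the maximal submodule `M^rad` of `M(T)` when
that exists and is unique. -/
def vermaRad (B : InvForm L) (μ ν : ℂ) (T : Type*) [AddCommGroup T] [Module ℂ T]
    [LieRingModule (Toroidal.nonneg B μ ν (N := N)) T] :
    LieSubmodule ℂ (Toroidal N B μ ν) (GenVerma N B μ ν T) :=
  sSup {U | U ≠ ⊤}

variable (N) in
/-- The quotient `L(T) = M(T) / M^rad`. -/
abbrev IrrQuot (B : InvForm L) (μ ν : ℂ) (T : Type*) [AddCommGroup T] [Module ℂ T]
    [LieRingModule (Toroidal.nonneg B μ ν (N := N)) T] :=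
  GenVerma N B μ ν T ⧸ vermaRad N B μ ν T

end
end

/-! ### Vertex algebras -/

section
variable {V : Type*} [AddCommGroup V] [Module ℂ V]

/-- The derivative of the series `a(z) = ∑ n, a_n z^(-n-1)`. -/
def fieldDeriv (a : ℤ → Module.End ℂ V) : ℤ → Module.End ℂ V :=
  fun n => (-n : ℂ) • a (n - 1)

/-- `(:a(z) b(z):)_m v`, where
`:a(z) b(z): = ∑_{n<0} a_n z^(-n-1) b(z) + ∑_{n≥0} b(z) a_n z^(-n-1)`.
Both sums are finite when `a(z)`, `b(z)` are fields. -/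
def normalOrder (a b : ℤ → Module.End ℂ V) (m : ℤ) (v : V) : V :=
  (∑ᶠ i : ℕ, a (-1 - i) (b (m + i) v)) + ∑ᶠ i : ℕ, b (m - 1 - i) (a i v)

/-- A vertex algebra structure on a complex vector space `V`; `Y a n` is the mode `a_(n)` in
`Y(a, z) = ∑ n, a_(n) z^(-n-1)`. -/
structure VertexAlgebra (V : Type*) [AddCommGroup V] [Module ℂ V] where
  vacuum : V
  D : Module.End ℂ V
  Y : V →ₗ[ℂ] (ℤ → Module.End ℂ V)
  /-- `a_(n) b = 0` for `n` sufficiently large. -/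
  truncation : ∀ a b, ∃ n₀ : ℤ, ∀ n ≥ n₀, Y a n b = 0
  /-- `[D, Y(a, z)] = Y(D a, z)`. -/
  commutator_D : ∀ a n, D * Y a n - Y a n * D = Y (D a) n
  /-- `Y(D a, z) = d/dz Y(a, z)`. -/
  Y_D : ∀ a, Y (D a) = fieldDeriv (Y a)
  /-- `Y(1, z) = id`. -/
  Y_vacuum : ∀ n, Y vacuum n = if n = -1 then 1 else 0
  /-- `Y(a, z) 1 ∈ V[[z]]`. -/
  creation : ∀ a n, 0 ≤ n → Y a n vacuum = 0
  /-- `Y(a, z) 1` equals `a` at `z = 0`. -/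
  creation_zero : ∀ a, Y a (-1) vacuum = a
  /-- `(z - w)^k [Y(a, z), Y(b, w)] = 0` for `k` sufficiently large (coefficientwise). -/
  locality : ∀ a b, ∃ k₀ : ℕ, ∀ k ≥ k₀, ∀ m n : ℤ,
    ∑ i ∈ Finset.range (k + 1), ((-1 : ℂ) ^ i * (k.choose i : ℂ)) •
      (Y a (m + k - i) * Y b (n + i) - Y b (n + i) * Y a (m + k - i)) = 0

/-- `ω` is a Virasoro element that makes the vertex algebra a vertex operator algebra of the given
rank; here `L(n) = ω_(n+1)`. -/
structure VertexAlgebra.IsVOA (𝒱 : VertexAlgebra V) (ω : V) (rank : ℂ) : Prop where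
  virasoro : ∀ n m : ℤ,
    𝒱.Y ω (n + 1) * 𝒱.Y ω (m + 1) - 𝒱.Y ω (m + 1) * 𝒱.Y ω (n + 1) =
      ((n : ℂ) - m) • 𝒱.Y ω (n + m + 1)
        + if n = -m then (((n : ℂ) ^ 3 - n) / 12 * rank) • (1 : Module.End ℂ V) else 0
  D_eq : 𝒱.D = 𝒱.Y ω 0
  grading : DirectSum.IsInternal fun n : ℤ => Module.End.eigenspace (𝒱.Y ω 1) (n : ℂ)

/-- Homomorphisms of vertex algebras. -/
structure VertexAlgebra.IsHom {W : Type*} [AddCommGroup W] [Module ℂ W]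
    (𝒱 : VertexAlgebra V) (𝒲 : VertexAlgebra W) (f : V →ₗ[ℂ] W) : Prop where
  map_vacuum : f 𝒱.vacuum = 𝒲.vacuum
  map_D : ∀ a, f (𝒱.D a) = 𝒲.D (f a)
  map_Y : ∀ a n b, f (𝒱.Y a n b) = 𝒲.Y (f a) n (f b)

end

/-! ### The enveloping vertex algebra of the toroidal Lie algebra and its level `c` quotient -/

section
variable (N : ℕ) {L : Type*} [LieRing L] [LieAlgebra ℂ L] (B : InvForm L) (μ ν : ℂ)

/-- The space `V_𝔤 = Ind_{𝔤^(+)}^𝔤 (ℂ 1)`, where `ℂ 1` is the trivial module. -/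
abbrev Vg :=
  IndModule (Toroidal.plus B μ ν (N := N)) (TrivialLieModule ℂ (Toroidal.plus B μ ν (N := N)) ℂ)

/-- The vacuum vector `1` of `V_𝔤`. -/
def Vg.one : Vg N B μ ν := IndModule.of _ ((TrivialLieModule.equiv ℂ _ ℂ).symm 1)

variable {N B μ ν}

variable (N B μ ν) in
/-- The field `u(z)` acting on a `𝔤`-module. -/
def genField (M : Type*) [AddCommGroup M] [Module ℂ M] [LieRingModule (Toroidal N B μ ν) M]
    [LieModule ℂ (Toroidal N B μ ν) M] (u : GenField N L) : ℤ → Module.End ℂ M :=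
  fun n => LieModule.toEnd ℂ (Toroidal N B μ ν) M (Toroidal.moment u n)

/-- The vertex algebra structure of the universal enveloping vertex algebra on `V_𝔤`: the vacuum is
`1`, `D` is the natural extension of the derivation `D(u(n)) = -n u(n-1)` of `𝔤`, and
`Y(u_1(-1-n_1) ⋯ u_k(-1-n_k) 1, z)` is the normally ordered product, nested from right to left, of
the fields `(1/n_i!) (d/dz)^{n_i} u_i(z)`. -/
structure IsEnveloping (𝒱 : VertexAlgebra (Vg N B μ ν)) : Prop where
  vacuum_eq : 𝒱.vacuum = Vg.one N B μ ν
  D_one : 𝒱.D (Vg.one N B μ ν) = 0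
  D_lie : ∀ (u : GenField N L) (n : ℤ) (v : Vg N B μ ν),
    𝒱.D ⁅(Toroidal.moment u n : Toroidal N B μ ν), v⁆ =
      (-n : ℂ) • ⁅(Toroidal.moment u (n - 1) : Toroidal N B μ ν), v⁆
        + ⁅(Toroidal.moment u n : Toroidal N B μ ν), 𝒱.D v⁆
  Y_one : ∀ n, 𝒱.Y (Vg.one N B μ ν) n = if n = -1 then 1 else 0
  Y_lie : ∀ (u : GenField N L) (n : ℕ) (a : Vg N B μ ν) (m : ℤ) (b : Vg N B μ ν),
    𝒱.Y ⁅(Toroidal.moment u (-1 - n) : Toroidal N B μ ν), a⁆ m b =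
      normalOrder ((n.factorial : ℂ)⁻¹ • fieldDeriv^[n] (genField N B μ ν (Vg N B μ ν) u)) (𝒱.Y a) m b

variable (N B μ ν) in
/-- The set `S` of relations `k_0 1 - c 1` and `(t^r k_0)(t^m k_0) 1 - c (t^(r+m) k_0) 1`. -/
def levelRelations (c : ℂ) : Set (Vg N B μ ν) :=
  {⁅(Toroidal.tk 0 0 : Toroidal N B μ ν), Vg.one N B μ ν⁆ - c • Vg.one N B μ ν} ∪
  {x | ∃ r m : Fin N → ℤ, x =
    ⁅(Toroidal.tk (Fin.cons 0 r) 0 : Toroidal N B μ ν),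
      ⁅(Toroidal.tk (Fin.cons 0 m) 0 : Toroidal N B μ ν), Vg.one N B μ ν⁆⁆
    - c • ⁅(Toroidal.tk (Fin.cons 0 (r + m)) 0 : Toroidal N B μ ν), Vg.one N B μ ν⁆}

variable (N B μ ν) in
/-- The `𝔤`-submodule `R(S)` of `V_𝔤` generated by `S`. -/
def levelSubmodule (c : ℂ) : LieSubmodule ℂ (Toroidal N B μ ν) (Vg N B μ ν) :=
  LieSubmodule.lieSpan ℂ (Toroidal N B μ ν) (levelRelations N B μ ν c)

variable (N B μ ν) in
/-- `V_𝔤(c) = V_𝔤 / R(S)`. -/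
abbrev VgLevel (c : ℂ) := Vg N B μ ν ⧸ levelSubmodule N B μ ν c

variable (N B μ ν) in
/-- The projection `V_𝔤 → V_𝔤(c)`. -/
abbrev VgLevel.mk (c : ℂ) : Vg N B μ ν →ₗ⁅ℂ, Toroidal N B μ ν⁆ VgLevel N B μ ν c :=
  LieSubmodule.Quotient.mk' (levelSubmodule N B μ ν c)

variable (N B μ ν) in
/-- The vector `(t_0^(-2) d̃_0) 1` of `V_𝔤(c)`. -/
def VgLevel.omega (c : ℂ) : VgLevel N B μ ν c :=
  VgLevel.mk N B μ ν c ⁅(Toroidal.moment (.d0 0) (-1) : Toroidal N B μ ν), Vg.one N B μ ν⁆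

end
end

/-! All three vertex algebras come from one construction. Call a vector of a 𝔤-module a vacuum
vector if it generates the module and is killed by 𝔤^(+) (`IsVacuumVector`). On such a module the
fields u(z) satisfy the hypotheses of the reconstruction theorem. They are local because [u(m - i),
v(n + i)] is polynomial in i (`Toroidal.exists_mulSub_pow_lie_moment`). They are covariant for
-t_0^(-1) d_0, an element of 𝔤^(+) (`Toroidal.lie_translation_moment`). They are fields because
elements of high degree kill any given vector. Hence the module is a vertex algebra, and
𝔤-homomorphisms preserving vacuum vectors are vertex algebra homomorphisms. The modes of d̃_0(z)
satisfy the Virasoro relations with central term (μ + ν)(n³ - n) k_0; where k_0 acts by c, this is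
rank 12(μ + ν)c (`IsVacuumVector.isVOA`). It remains to find vacuum vectors in V_𝔤, V_𝔤(c) and
L(T₀).

For V_𝔤 and V_𝔤(c) the vector 1 serves. For L(T₀), the parameters of T₀ are those for which t^r x of
degree zero acts on q^m by c λ(x) + δ·m, where λ is the functional whose vanishing describes the
degree-zero part of 𝔤^(+) (`TopZero.act_q`). So the part of 𝔤^(+) of non-negative degree kills q^0
already in M(T₀). The part of degree -1 sends q^0 to vectors of positive weight killed by 𝔤₊; these
generate proper submodules and vanish in L(T₀) (`TopZero.isVacuumVector_mk`). The same scalars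
describe 𝔤₀ ⊕ 𝔤₊ on the vectors (t^m k_0)1 of V_𝔤(c) (`IsVacuumVector.lie_mono_lie_tk`), which gives
π. The vacuum vector of L(T₀) satisfies the relations S, which gives V_𝔤(c) → L(T₀); the composite
is checked on the q^r.

That M^rad is proper and maximal follows from the L(0)-grading. M(T₀) is T₀ in weight zero plus
positive weights, and T₀ is irreducible, so proper submodules have positive weights only
(`TopZero.le_posPart`). This needs T₀ to embed into M(T₀), which is shown without a PBW basis by
mapping M(T₀) to a module of functions on words, where evaluation at the empty word recovers T₀
(`IndModule.of_injective_of_projection`).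

The reconstruction theorem rests on Dong's lemma, proved coefficientwise with residues
(`mulSub_pow_resDiff_eq_zero`), and on the uniqueness of the field of a state
(`IsStateField.unique`). -/

noncomputable section

set_option linter.unusedSectionVars false

/-! ### Residues of formal distributions -/

/-- The coefficient `(-1)^i * binom(n, i)` of `(1 - x)^n`. -/
def signedChoose (n : ℤ) : ℕ → ℂ
  | 0 => 1
  | i + 1 => -(signedChoose n i * (n - i) / (i + 1))

theorem signedChoose_zero (n : ℤ) : signedChoose n 0 = 1 := rfl

theorem signedChoose_succ_mul (n : ℤ) (i : ℕ) :
    ((i : ℂ) + 1) * signedChoose n (i + 1) = -((n - i) * signedChoose n i) := by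
  have h : (i : ℂ) + 1 ≠ 0 := by exact_mod_cast Nat.succ_ne_zero i
  rw [signedChoose]
  field_simp

theorem signedChoose_pascal (n : ℤ) (i : ℕ) :
    signedChoose (n + 1) (i + 1) = signedChoose n (i + 1) - signedChoose n i := by
  induction i with
  | zero => simp [signedChoose]; ring
  | succ i ih =>
    have h : ((i + 1 : ℕ) : ℂ) + 1 ≠ 0 := by exact_mod_cast Nat.succ_ne_zero (i + 1)
    refine mul_left_cancel₀ h ?_
    have h1 := signedChoose_succ_mul (n + 1) (i + 1)
    have h2 := signedChoose_succ_mul n (i + 1)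
    have h3 := signedChoose_succ_mul n i
    rw [mul_sub, h1, h2, ih]
    push_cast
    linear_combination h3

theorem signedChoose_zero_succ (i : ℕ) : signedChoose 0 (i + 1) = 0 := by
  induction i with
  | zero => simp [signedChoose]
  | succ i ih => rw [signedChoose, ih]; simp

/-- The coefficients of (1 - x)^(-1-n). Negative exponents are the ones that produce normally
ordered products. -/
theorem signedChoose_neg (n i : ℕ) : signedChoose (-1 - n) i = (n + i).choose i := by
  induction i with
  | zero => simp [signedChoose]
  | succ i ih =>
    have h : (i : ℂ) + 1 ≠ 0 := by exact_mod_cast Nat.succ_ne_zero i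
    refine mul_left_cancel₀ h ?_
    rw [signedChoose_succ_mul, ih]
    have := Nat.add_one_mul_choose_eq (n + i) i
    have h2 : (((n + i + 1) * (n + i).choose i : ℕ) : ℂ) = ((n + i + 1).choose (i + 1) * (i + 1) : ℕ) := by
      exact_mod_cast this
    push_cast at h2 ⊢
    rw [← add_assoc]
    linear_combination h2

section Residues
variable {E : Type*} [AddCommGroup E] [Module ℂ E]

/-- The coefficients of `(z - w) f(z, w)`. -/
def mulSub : Module.End ℂ (ℤ → ℤ → E) where
  toFun f m n := f (m + 1) n - f m (n + 1)
  map_add' f g := by ext m n; simp only [Pi.add_apply]; abel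
  map_smul' s f := by ext m n; simp [smul_sub]

theorem mulSub_apply (f : ℤ → ℤ → E) (m n : ℤ) : mulSub f m n = f (m + 1) n - f m (n + 1) := rfl

/-- Multiplication by z and by w are commuting shifts of the two indices, so this is the binomial
theorem. The sum has the shape used in the axiom `VertexAlgebra.locality`. -/
theorem mulSub_pow_apply (k : ℕ) (f : ℤ → ℤ → E) (m n : ℤ) :
    (mulSub ^ k) f m n = ∑ i ∈ Finset.range (k + 1),
      ((-1 : ℂ) ^ i * (k.choose i : ℂ)) • f (m + k - i) (n + i) := by
  let S : Module.End ℂ (ℤ → ℤ → E) :=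
    { toFun := fun f m n => f (m + 1) n, map_add' := fun _ _ => rfl, map_smul' := fun _ _ => rfl }
  let T : Module.End ℂ (ℤ → ℤ → E) :=
    { toFun := fun f m n => f m (n + 1), map_add' := fun _ _ => rfl, map_smul' := fun _ _ => rfl }
  have hS : ∀ (k : ℕ) f m n, (S ^ k) f m n = f (m + k) n := by
    intro k
    induction k with
    | zero => simp
    | succ k ih =>
      intro f m n
      rw [pow_succ, Module.End.mul_apply, ih]
      change f (m + k + 1) n = _
      congr 1; push_cast; ring
  have hT : ∀ (k : ℕ) f m n, (T ^ k) f m n = f m (n + k) := by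
    intro k
    induction k with
    | zero => simp
    | succ k ih =>
      intro f m n
      rw [pow_succ, Module.End.mul_apply, ih]
      change f m (n + k + 1) = _
      congr 1; push_cast; ring
  have hST : Commute S T := rfl
  have e : (mulSub : Module.End ℂ (ℤ → ℤ → E)) = (-1 : ℂ) • T + S := by
    ext f m n
    simp [S, T, mulSub_apply]; abel
  rw [e, ((hST.symm.smul_left (-1 : ℂ))).add_pow]
  simp only [LinearMap.sum_apply, Finset.sum_apply]
  refine Finset.sum_congr rfl fun i hi => ?_
  rw [Finset.mem_range] at hi
  rw [smul_pow, smul_mul_assoc, ← nsmul_eq_mul', ← Nat.cast_smul_eq_nsmul ℂ]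
  simp only [LinearMap.smul_apply, Pi.smul_apply, Module.End.mul_apply, hT, hS, smul_smul]
  rw [mul_comm, Nat.cast_sub (by lia), add_sub_assoc]

/-- `Res_z` of `(z - w)^n f(z, w)`, where `(z - w)^n` is expanded for `|z| > |w|`. -/
def resL (n : ℤ) (f : ℤ → ℤ → E) (m : ℤ) : E := ∑ᶠ i : ℕ, signedChoose n i • f (n - i) (m + i)

/-- `Res_z` of `(z - w)^n f(z, w)`, where `(z - w)^n` is expanded for `|w| > |z|`. -/
def resR (n : ℤ) (f : ℤ → ℤ → E) (m : ℤ) : E :=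
  ∑ᶠ i : ℕ, ((-1) ^ n * signedChoose n i) • f i (m + n - i)

/-- `f(z, w)` is bounded in `w`, uniformly in `z`. -/
def BddR (f : ℤ → ℤ → E) : Prop := ∃ M : ℤ, ∀ m ≥ M, ∀ l, f l m = 0

/-- `f(z, w)` is bounded in `z`, uniformly in `w`. -/
def BddL (f : ℤ → ℤ → E) : Prop := ∃ M : ℤ, ∀ l ≥ M, ∀ m, f l m = 0

/-- In the expansion for |z| > |w| the index of w only increases, so a bound in w truncates the sum;
for `resR` the index of z increases and a bound in z plays this role. -/
theorem resL_eq_sum {f : ℤ → ℤ → E} {m : ℤ} {K : ℕ} (h : ∀ m' ≥ m + K, ∀ l, f l m' = 0) (n : ℤ) :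
    resL n f m = ∑ i ∈ Finset.range K, signedChoose n i • f (n - i) (m + i) := by
  refine finsum_eq_sum_of_support_subset _ fun i hi => ?_
  by_contra hK
  refine hi ?_
  simp only [Finset.coe_range, Set.mem_Iio, not_lt] at hK
  change _ • _ = _
  rw [h _ (by lia), smul_zero]

theorem resR_eq_sum {f : ℤ → ℤ → E} {K : ℕ} (h : ∀ l ≥ (K : ℤ), ∀ m, f l m = 0) (n m : ℤ) :
    resR n f m = ∑ i ∈ Finset.range K, ((-1) ^ n * signedChoose n i) • f i (m + n - i) := by
  refine finsum_eq_sum_of_support_subset _ fun i hi => ?_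
  by_contra hK
  refine hi ?_
  simp only [Finset.coe_range, Set.mem_Iio, not_lt] at hK
  change _ • _ = _
  rw [h _ (by lia), smul_zero]

theorem BddR.exists_nat {f : ℤ → ℤ → E} (h : BddR f) (m : ℤ) :
    ∃ K : ℕ, ∀ m' ≥ m + K, ∀ l, f l m' = 0 := by
  obtain ⟨M, hM⟩ := h
  exact ⟨(M - m).toNat, fun m' hm' => hM m' (by lia)⟩

theorem BddL.exists_nat {f : ℤ → ℤ → E} (h : BddL f) :
    ∃ K : ℕ, ∀ l ≥ (K : ℤ), ∀ m, f l m = 0 := by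
  obtain ⟨M, hM⟩ := h
  exact ⟨M.toNat, fun m' hm' => hM m' (by lia)⟩

theorem BddR.add {f g : ℤ → ℤ → E} (hf : BddR f) (hg : BddR g) : BddR (f + g) := by
  obtain ⟨M, hM⟩ := hf
  obtain ⟨M', hM'⟩ := hg
  exact ⟨max M M', fun m hm l => by
    simp [hM m (le_trans (le_max_left _ _) hm), hM' m (le_trans (le_max_right _ _) hm)]⟩

theorem BddL.add {f g : ℤ → ℤ → E} (hf : BddL f) (hg : BddL g) : BddL (f + g) := by
  obtain ⟨M, hM⟩ := hf
  obtain ⟨M', hM'⟩ := hg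
  exact ⟨max M M', fun m hm l => by
    simp [hM m (le_trans (le_max_left _ _) hm), hM' m (le_trans (le_max_right _ _) hm)]⟩

theorem BddR.smul {f : ℤ → ℤ → E} (s : ℂ) (hf : BddR f) : BddR (s • f) := by
  obtain ⟨M, hM⟩ := hf
  exact ⟨M, fun m hm l => by simp [hM m hm]⟩

theorem BddL.smul {f : ℤ → ℤ → E} (s : ℂ) (hf : BddL f) : BddL (s • f) := by
  obtain ⟨M, hM⟩ := hf
  exact ⟨M, fun m hm l => by simp [hM m hm]⟩

theorem BddR.mulSub {f : ℤ → ℤ → E} (hf : BddR f) : BddR (mulSub f) := by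
  obtain ⟨M, hM⟩ := hf
  exact ⟨M, fun m hm l => by rw [mulSub_apply, hM m hm, hM (m + 1) (by lia), sub_zero]⟩

theorem BddL.mulSub {f : ℤ → ℤ → E} (hf : BddL f) : BddL (mulSub f) := by
  obtain ⟨M, hM⟩ := hf
  exact ⟨M, fun m hm l => by rw [mulSub_apply, hM m hm, hM (m + 1) (by lia), sub_zero]⟩

theorem resL_add {f g : ℤ → ℤ → E} (hf : BddR f) (hg : BddR g) (n m : ℤ) :
    resL n (f + g) m = resL n f m + resL n g m := by
  obtain ⟨K, hK⟩ := hf.exists_nat m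
  obtain ⟨K', hK'⟩ := hg.exists_nat m
  have h1 : ∀ m' ≥ m + (K + K' : ℕ), ∀ l, f l m' = 0 := fun m' hm' => hK m' (by push_cast at hm'; lia)
  have h2 : ∀ m' ≥ m + (K + K' : ℕ), ∀ l, g l m' = 0 := fun m' hm' => hK' m' (by push_cast at hm'; lia)
  rw [resL_eq_sum h1, resL_eq_sum h2,
    resL_eq_sum (f := f + g) (K := K + K') fun m' hm' l => by simp [h1 m' hm' l, h2 m' hm' l],
    ← Finset.sum_add_distrib]
  exact Finset.sum_congr rfl fun i _ => smul_add _ _ _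

theorem resR_add {f g : ℤ → ℤ → E} (hf : BddL f) (hg : BddL g) (n m : ℤ) :
    resR n (f + g) m = resR n f m + resR n g m := by
  obtain ⟨K, hK⟩ := hf.exists_nat
  obtain ⟨K', hK'⟩ := hg.exists_nat
  have h1 : ∀ m' ≥ ((K + K' : ℕ) : ℤ), ∀ l, f m' l = 0 :=
    fun m' hm' => hK m' (by push_cast at hm'; lia)
  have h2 : ∀ m' ≥ ((K + K' : ℕ) : ℤ), ∀ l, g m' l = 0 :=
    fun m' hm' => hK' m' (by push_cast at hm'; lia)
  rw [resR_eq_sum h1, resR_eq_sum h2,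
    resR_eq_sum (f := f + g) (K := K + K') fun m' hm' l => by simp [h1 m' hm' l, h2 m' hm' l],
    ← Finset.sum_add_distrib]
  exact Finset.sum_congr rfl fun i _ => smul_add _ _ _

theorem resL_map {E' : Type*} [AddCommGroup E'] [Module ℂ E'] (φ : E →ₗ[ℂ] E') {f : ℤ → ℤ → E}
    (hf : BddR f) (n m : ℤ) : resL n (fun l k => φ (f l k)) m = φ (resL n f m) := by
  obtain ⟨K, hK⟩ := hf.exists_nat m
  rw [resL_eq_sum hK, resL_eq_sum (K := K) fun m' hm' l => by rw [hK m' hm' l, map_zero], map_sum]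
  simp

theorem resR_map {E' : Type*} [AddCommGroup E'] [Module ℂ E'] (φ : E →ₗ[ℂ] E') {f : ℤ → ℤ → E}
    (hf : BddL f) (n m : ℤ) : resR n (fun l k => φ (f l k)) m = φ (resR n f m) := by
  obtain ⟨K, hK⟩ := hf.exists_nat
  rw [resR_eq_sum hK, resR_eq_sum (K := K) fun m' hm' l => by rw [hK m' hm' l, map_zero], map_sum]
  simp

theorem resL_smul (s : ℂ) {f : ℤ → ℤ → E} (hf : BddR f) (n m : ℤ) :
    resL n (s • f) m = s • resL n f m := resL_map (LinearMap.lsmul ℂ E s) hf n m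

theorem resR_smul (s : ℂ) {f : ℤ → ℤ → E} (hf : BddL f) (n m : ℤ) :
    resR n (s • f) m = s • resR n f m := resR_map (LinearMap.lsmul ℂ E s) hf n m

theorem resL_sub {f g : ℤ → ℤ → E} (hf : BddR f) (hg : BddR g) (n m : ℤ) :
    resL n (f - g) m = resL n f m - resL n g m := by
  have := resL_add hf (hg.smul (-1)) n m
  rw [resL_smul _ hg, neg_one_smul, neg_one_smul] at this
  rw [sub_eq_add_neg, this, sub_eq_add_neg]

theorem resR_sub {f g : ℤ → ℤ → E} (hf : BddL f) (hg : BddL g) (n m : ℤ) :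
    resR n (f - g) m = resR n f m - resR n g m := by
  have := resR_add hf (hg.smul (-1)) n m
  rw [resR_smul _ hg, neg_one_smul, neg_one_smul] at this
  rw [sub_eq_add_neg, this, sub_eq_add_neg]

@[simp] theorem resL_zero (n m : ℤ) : resL n (0 : ℤ → ℤ → E) m = 0 := by simp [resL]

@[simp] theorem resR_zero (n m : ℤ) : resR n (0 : ℤ → ℤ → E) m = 0 := by simp [resR]

/-- Pascal's rule for (z - w)^n (z - w) = (z - w)^(n+1), after a shift of the summation index. The
extra term created by the shift lies beyond the bound and vanishes. -/
theorem resL_mulSub {f : ℤ → ℤ → E} (hf : BddR f) (n m : ℤ) :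
    resL n (mulSub f) m = resL (n + 1) f m := by
  obtain ⟨K, hK⟩ := hf.exists_nat m
  rw [resL_eq_sum (K := K) (f := mulSub f) fun m' hm' l => by
      rw [mulSub_apply, hK m' hm', hK (m' + 1) (by lia), sub_zero],
    resL_eq_sum (K := K + 1) fun m' hm' => hK m' (by push_cast at hm'; lia), Finset.sum_range_succ']
  simp only [signedChoose_pascal, mulSub_apply, smul_sub, sub_smul, Finset.sum_sub_distrib]
  have e : ∑ i ∈ Finset.range K, signedChoose n i • f (n - i + 1) (m + i) =
      ∑ i ∈ Finset.range (K + 1), signedChoose n i • f (n - i + 1) (m + i) := by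
    rw [Finset.sum_range_succ, hK _ le_rfl, smul_zero, add_zero]
  rw [e, Finset.sum_range_succ']
  have e1 : ∀ i : ℕ, n - (i + 1 : ℕ) + 1 = n - i := fun i => by push_cast; ring
  have e2 : ∀ i : ℕ, n + 1 - (i + 1 : ℕ) = n - i := fun i => by push_cast; ring
  have e3 : ∀ i : ℕ, m + (i + 1 : ℕ) = m + i + 1 := fun i => by push_cast; ring
  simp only [e1, e2, e3, signedChoose_zero, Nat.cast_zero, sub_zero, add_zero]
  abel

theorem resR_mulSub {f : ℤ → ℤ → E} (hf : BddL f) (n m : ℤ) :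
    resR n (mulSub f) m = resR (n + 1) f m := by
  obtain ⟨K, hK⟩ := hf.exists_nat
  rw [resR_eq_sum (K := K) (f := mulSub f) fun m' hm' l => by
      rw [mulSub_apply, hK m' hm', hK (m' + 1) (by lia), sub_zero],
    resR_eq_sum (K := K + 1) fun m' hm' => hK m' (by push_cast at hm'; lia), Finset.sum_range_succ']
  have hs : ((-1 : ℂ)) ^ (n + 1) = -(-1) ^ n := by rw [zpow_add_one₀ (by norm_num)]; ring
  simp only [signedChoose_pascal, mulSub_apply, smul_sub, hs, neg_mul, mul_sub, sub_smul,
    Finset.sum_sub_distrib]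
  have e : ∑ i ∈ Finset.range K, ((-1) ^ n * signedChoose n i) • f i (m + n - i + 1) =
      ∑ i ∈ Finset.range (K + 1), ((-1) ^ n * signedChoose n i) • f i (m + n - i + 1) := by
    rw [Finset.sum_range_succ, hK _ le_rfl, smul_zero, add_zero]
  rw [e, Finset.sum_range_succ']
  have e1 : ∀ i : ℕ, m + (n + 1) - ((i : ℤ) + 1) = m + n - i := fun i => by ring
  have e2 : ∀ i : ℕ, m + n - ((i : ℤ) + 1) + 1 = m + n - i := fun i => by ring
  have e3 : ∀ i : ℕ, ((i + 1 : ℕ) : ℤ) = i + 1 := fun i => by push_cast; ring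
  simp only [e1, e2, e3, signedChoose_zero, Nat.cast_zero, sub_zero, mul_one, neg_smul, add_assoc,
    Finset.sum_neg_distrib]
  abel

theorem BddR.mulSub_pow {f : ℤ → ℤ → E} (hf : BddR f) (k : ℕ) : BddR ((_root_.mulSub ^ k) f) := by
  induction k with
  | zero => simpa
  | succ k ih => rw [pow_succ', Module.End.mul_apply]; exact ih.mulSub

theorem BddL.mulSub_pow {f : ℤ → ℤ → E} (hf : BddL f) (k : ℕ) : BddL ((_root_.mulSub ^ k) f) := by
  induction k with
  | zero => simpa
  | succ k ih => rw [pow_succ', Module.End.mul_apply]; exact ih.mulSub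

theorem resL_mulSub_pow {f : ℤ → ℤ → E} (hf : BddR f) (k : ℕ) (n m : ℤ) :
    resL n ((mulSub ^ k) f) m = resL (n + k) f m := by
  induction k generalizing n with
  | zero => simp
  | succ k ih =>
    rw [pow_succ', Module.End.mul_apply, resL_mulSub (hf.mulSub_pow k), ih]
    congr 1; push_cast; ring

theorem resR_mulSub_pow {f : ℤ → ℤ → E} (hf : BddL f) (k : ℕ) (n m : ℤ) :
    resR n ((mulSub ^ k) f) m = resR (n + k) f m := by
  induction k generalizing n with
  | zero => simp
  | succ k ih =>
    rw [pow_succ', Module.End.mul_apply, resR_mulSub (hf.mulSub_pow k), ih]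
    congr 1; push_cast; ring

/-- For exponent zero there is nothing to expand, so `resL` and `resR` agree. All comparisons of the
two expansions reduce to this case. -/
theorem resL_exp_zero (f : ℤ → ℤ → E) (m : ℤ) : resL 0 f m = f 0 m := by
  rw [resL, finsum_eq_single _ 0]
  · simp [signedChoose]
  · intro i hi
    obtain ⟨j, rfl⟩ := Nat.exists_eq_succ_of_ne_zero hi
    rw [Nat.succ_eq_add_one, signedChoose_zero_succ, zero_smul]

theorem resR_exp_zero (f : ℤ → ℤ → E) (m : ℤ) : resR 0 f m = f 0 m := by
  rw [resR, finsum_eq_single _ 0]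
  · simp [signedChoose]
  · intro i hi
    obtain ⟨j, rfl⟩ := Nat.exists_eq_succ_of_ne_zero hi
    rw [Nat.succ_eq_add_one, signedChoose_zero_succ, mul_zero, zero_smul]

/-- Write n = j + r. Both sides are residues with exponent zero, of (z - w)^n f and of (z - w)^n g,
and these two distributions are equal. -/
theorem resL_eq_resR {f g : ℤ → ℤ → E} (hf : BddR f) (hg : BddL g) {r : ℕ}
    (h : (mulSub ^ r) (f - g) = 0) {n : ℤ} (hn : (r : ℤ) ≤ n) (m : ℤ) :
    resL n f m = resR n g m := by
  obtain ⟨j, rfl⟩ : ∃ j : ℕ, n = 0 + (j + r : ℕ) := ⟨(n - r).toNat, by push_cast; lia⟩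
  rw [← resL_mulSub_pow hf, ← resR_mulSub_pow hg, resL_exp_zero, resR_exp_zero, ← sub_eq_zero]
  have : (mulSub ^ (j + r)) (f - g) 0 m = 0 := by
    rw [pow_add, Module.End.mul_apply, h, map_zero]; rfl
  rwa [map_sub] at this

/-- A distribution bounded in `z` and killed by a power of `z - w` vanishes. -/
theorem BddL.eq_zero_of_mulSub_pow {f : ℤ → ℤ → E} (hf : BddL f) {k : ℕ}
    (h : (_root_.mulSub ^ k) f = 0) : f = 0 := by
  induction k with
  | zero => simpa using h
  | succ k ih =>
    apply ih
    rw [pow_succ', Module.End.mul_apply] at h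
    obtain ⟨M, hM⟩ := hf.mulSub_pow k
    set g := (_root_.mulSub ^ k) f with hg
    -- The relation (z - w) g = 0 makes g constant along antidiagonals, so every coefficient equals
    -- one whose first index is at least M.
    have hs : ∀ m n, g (m + 1) n = g m (n + 1) := fun m n => sub_eq_zero.1 (congrFun₂ h m n)
    have hj : ∀ (j : ℕ) m n, g m n = g (m + j) (n - j) := by
      intro j
      induction j with
      | zero => simp
      | succ j ihj =>
        intro m n
        rw [ihj, show n - (j : ℤ) = n - (j + 1 : ℕ) + 1 by push_cast; ring, ← hs]
        congr 1
        push_cast; ring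
    ext m n
    rw [hj (M - m).toNat, hM _ (by lia)]
    rfl

end Residues

/-! ### Dong's lemma -/

section Dong
variable {E : Type*} [AddCommGroup E] [Module ℂ E]

/-- Multiplication of `f(x, y, z)` by `x - y`. -/
def mulSub₁₂ : Module.End ℂ (ℤ → ℤ → ℤ → E) where
  toFun f l m n := f (l + 1) m n - f l (m + 1) n
  map_add' f g := by ext l m n; simp only [Pi.add_apply]; abel
  map_smul' s f := by ext l m n; simp [smul_sub]

/-- Multiplication of `f(x, y, z)` by `x - z`. -/
def mulSub₁₃ : Module.End ℂ (ℤ → ℤ → ℤ → E) where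
  toFun f l m n := f (l + 1) m n - f l m (n + 1)
  map_add' f g := by ext l m n; simp only [Pi.add_apply]; abel
  map_smul' s f := by ext l m n; simp [smul_sub]

/-- Multiplication of `f(x, y, z)` by `y - z`. -/
def mulSub₂₃ : Module.End ℂ (ℤ → ℤ → ℤ → E) where
  toFun f l m n := f l (m + 1) n - f l m (n + 1)
  map_add' f g := by ext l m n; simp only [Pi.add_apply]; abel
  map_smul' s f := by ext l m n; simp [smul_sub]

/-- The identity y - z = (x - z) - (x - y) drives Dong's lemma: it trades the factor visible after
the residue in x for factors on which locality gives information. -/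
theorem mulSub₂₃_eq : (mulSub₂₃ : Module.End ℂ (ℤ → ℤ → ℤ → E)) = mulSub₁₃ - mulSub₁₂ := by
  refine LinearMap.ext fun f => ?_
  ext l m n
  change _ = (f (l + 1) m n - f l m (n + 1)) - (f (l + 1) m n - f l (m + 1) n)
  change f l (m + 1) n - f l m (n + 1) = _
  abel

theorem commute_mulSub₁₂_mulSub₁₃ :
    Commute (mulSub₁₂ : Module.End ℂ (ℤ → ℤ → ℤ → E)) mulSub₁₃ := by
  refine LinearMap.ext fun f => ?_
  ext l m n
  change (f (l + 1 + 1) m n - f (l + 1) m (n + 1)) - (f (l + 1) (m + 1) n - f l (m + 1) (n + 1)) =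
    (f (l + 1 + 1) m n - f (l + 1) (m + 1) n) - (f (l + 1) m (n + 1) - f l (m + 1) (n + 1))
  abel

theorem commute_mulSub₁₂_mulSub₂₃ :
    Commute (mulSub₁₂ : Module.End ℂ (ℤ → ℤ → ℤ → E)) mulSub₂₃ := by
  rw [mulSub₂₃_eq]
  exact commute_mulSub₁₂_mulSub₁₃.sub_right (Commute.refl _)

theorem commute_mulSub₁₃_mulSub₂₃ :
    Commute (mulSub₁₃ : Module.End ℂ (ℤ → ℤ → ℤ → E)) mulSub₂₃ := by
  rw [mulSub₂₃_eq]
  exact (Commute.refl _).sub_right commute_mulSub₁₂_mulSub₁₃.symm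

theorem mulSub₁₂_pow_apply (k : ℕ) (f : ℤ → ℤ → ℤ → E) (l m n : ℤ) :
    (mulSub₁₂ ^ k) f l m n = (mulSub ^ k) (fun l m => f l m n) l m := by
  induction k generalizing f with
  | zero => rfl
  | succ k ih => rw [pow_succ, pow_succ, Module.End.mul_apply, Module.End.mul_apply, ih]; rfl

theorem mulSub₁₃_pow_apply (k : ℕ) (f : ℤ → ℤ → ℤ → E) (l m n : ℤ) :
    (mulSub₁₃ ^ k) f l m n = (mulSub ^ k) (fun l n => f l m n) l n := by
  induction k generalizing f with
  | zero => rfl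
  | succ k ih => rw [pow_succ, pow_succ, Module.End.mul_apply, Module.End.mul_apply, ih]; rfl

theorem mulSub₂₃_pow_apply (k : ℕ) (f : ℤ → ℤ → ℤ → E) (l m n : ℤ) :
    (mulSub₂₃ ^ k) f l m n = (mulSub ^ k) (fun m n => f l m n) m n := by
  induction k generalizing f with
  | zero => rfl
  | succ k ih => rw [pow_succ, pow_succ, Module.End.mul_apply, Module.End.mul_apply, ih]; rfl

/-- `f(x, y, z)` is bounded in `y`, uniformly in `x`, for each power of `z`. -/
def BddMid : Submodule ℂ (ℤ → ℤ → ℤ → E) where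
  carrier := {f | ∀ n, BddR fun l m => f l m n}
  add_mem' hf hg n := (hf n).add (hg n)
  zero_mem' _ := ⟨0, fun _ _ _ => rfl⟩
  smul_mem' s _ hf n := (hf n).smul s

/-- `f(x, y, z)` is bounded in `x`, uniformly in `y`, for each power of `z`. -/
def BddFst : Submodule ℂ (ℤ → ℤ → ℤ → E) where
  carrier := {f | ∀ n, BddL fun l m => f l m n}
  add_mem' hf hg n := (hf n).add (hg n)
  zero_mem' _ := ⟨0, fun _ _ _ => rfl⟩
  smul_mem' s _ hf n := (hf n).smul s

theorem mulSub₁₂_mem_bddMid {f : ℤ → ℤ → ℤ → E} (hf : f ∈ BddMid) : mulSub₁₂ f ∈ BddMid :=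
  fun n => (hf n).mulSub

theorem mulSub₁₂_mem_bddFst {f : ℤ → ℤ → ℤ → E} (hf : f ∈ BddFst) : mulSub₁₂ f ∈ BddFst :=
  fun n => (hf n).mulSub

theorem mulSub₁₃_mem_bddMid {f : ℤ → ℤ → ℤ → E} (hf : f ∈ BddMid) : mulSub₁₃ f ∈ BddMid := by
  intro n
  obtain ⟨M, hM⟩ := hf n
  obtain ⟨M', hM'⟩ := hf (n + 1)
  refine ⟨max M M', fun m hm l => ?_⟩
  have h1 : f (l + 1) m n = 0 := hM m (by lia) _
  have h2 : f l m (n + 1) = 0 := hM' m (by lia) _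
  change f _ _ _ - f _ _ _ = 0
  rw [h1, h2, sub_zero]

theorem mulSub₁₃_mem_bddFst {f : ℤ → ℤ → ℤ → E} (hf : f ∈ BddFst) : mulSub₁₃ f ∈ BddFst := by
  intro n
  obtain ⟨M, hM⟩ := hf n
  obtain ⟨M', hM'⟩ := hf (n + 1)
  refine ⟨max M M', fun l hl m => ?_⟩
  have h1 : f (l + 1) m n = 0 := hM (l + 1) (by lia) _
  have h2 : f l m (n + 1) = 0 := hM' l (by lia) _
  change f _ _ _ - f _ _ _ = 0
  rw [h1, h2, sub_zero]

theorem mulSub₂₃_mem_bddMid {f : ℤ → ℤ → ℤ → E} (hf : f ∈ BddMid) : mulSub₂₃ f ∈ BddMid := by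
  rw [mulSub₂₃_eq]
  exact sub_mem (mulSub₁₃_mem_bddMid hf) (mulSub₁₂_mem_bddMid hf)

theorem mulSub₂₃_mem_bddFst {f : ℤ → ℤ → ℤ → E} (hf : f ∈ BddFst) : mulSub₂₃ f ∈ BddFst := by
  rw [mulSub₂₃_eq]
  exact sub_mem (mulSub₁₃_mem_bddFst hf) (mulSub₁₂_mem_bddFst hf)

theorem pow_apply_mem {M : Type*} [AddCommMonoid M] [Module ℂ M] {S : Submodule ℂ M}
    {T : Module.End ℂ M} (h : ∀ x ∈ S, T x ∈ S) (k : ℕ) {x : M} (hx : x ∈ S) : (T ^ k) x ∈ S := by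
  induction k with
  | zero => simpa
  | succ k ih => rw [pow_succ', Module.End.mul_apply]; exact h _ ih

/-- The residue in `x` of `(x - y)^n` times a difference `F - G` of distributions in `x`, `y`, `z`,
with the expansion for `|x| > |y|` on `F` and that for `|y| > |x|` on `G`. -/
def resDiff (n : ℤ) (F G : ℤ → ℤ → ℤ → E) (m k : ℤ) : E :=
  resL n (fun l m => F l m k) m - resR n (fun l m => G l m k) m

theorem resDiff_sub {F F' G G' : ℤ → ℤ → ℤ → E} (hF : F ∈ BddMid) (hF' : F' ∈ BddMid)
    (hG : G ∈ BddFst) (hG' : G' ∈ BddFst) (n : ℤ) :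
    resDiff n (F - F') (G - G') = resDiff n F G - resDiff n F' G' := by
  ext m k
  have h1 := resL_sub (hF k) (hF' k) n m
  have h2 := resR_sub (hG k) (hG' k) n m
  simp only [resDiff, Pi.sub_apply]
  change resL n ((fun l m => F l m k) - fun l m => F' l m k) m
    - resR n ((fun l m => G l m k) - fun l m => G' l m k) m = _
  rw [h1, h2]; abel

/-- The factor y - z does not involve the residue variable x, so it passes through the residue. -/
theorem resDiff_mulSub₂₃ {F G : ℤ → ℤ → ℤ → E} (hF : F ∈ BddMid) (hG : G ∈ BddFst) (n : ℤ) :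
    resDiff n (mulSub₂₃ F) (mulSub₂₃ G) = mulSub (resDiff n F G) := by
  have sL : ∀ k, BddR fun l m => F l (m + 1) k := fun k => by
    obtain ⟨M, hM⟩ := hF k
    exact ⟨M, fun m hm l => hM _ (by lia) l⟩
  have sR : ∀ k, BddL fun l m => G l (m + 1) k := fun k => by
    obtain ⟨M, hM⟩ := hG k
    exact ⟨M, fun m hm l => hM _ hm _⟩
  ext m k
  have h1 := resL_sub (sL k) (hF (k + 1)) n m
  have h2 := resR_sub (sR k) (hG (k + 1)) n m
  have e1 : resL n (fun l m => F l (m + 1) k) m = resL n (fun l m => F l m k) (m + 1) := by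
    refine finsum_congr fun i => ?_
    simp only [add_right_comm m]
  have e2 : resR n (fun l m => G l (m + 1) k) m = resR n (fun l m => G l m k) (m + 1) := by
    refine finsum_congr fun i => ?_
    rw [show m + 1 + n - (i : ℤ) = m + n - i + 1 by ring]
  rw [mulSub_apply]
  change resL n ((fun l m => F l (m + 1) k) - fun l m => F l m (k + 1)) m
    - resR n ((fun l m => G l (m + 1) k) - fun l m => G l m (k + 1)) m = _
  rw [h1, h2, e1, e2]
  simp only [resDiff]
  abel

theorem resDiff_mulSub₂₃_pow {F G : ℤ → ℤ → ℤ → E} (hF : F ∈ BddMid) (hG : G ∈ BddFst) (n : ℤ)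
    (k : ℕ) : resDiff n ((mulSub₂₃ ^ k) F) ((mulSub₂₃ ^ k) G) = (mulSub ^ k) (resDiff n F G) := by
  induction k with
  | zero => rfl
  | succ k ih =>
    simp only [pow_succ', Module.End.mul_apply]
    rw [resDiff_mulSub₂₃ (pow_apply_mem (fun _ => mulSub₂₃_mem_bddMid) k hF)
      (pow_apply_mem (fun _ => mulSub₂₃_mem_bddFst) k hG), ih]

/-- The factors (x - y)^s raise the exponent of the residue to n + s ≥ r, where the two expansions
no longer differ. -/
theorem resDiff_mulSub₁₂_pow_eq_zero {F G : ℤ → ℤ → ℤ → E} (hF : F ∈ BddMid) (hG : G ∈ BddFst)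
    {r s : ℕ} {n : ℤ} (h : (mulSub₁₂ ^ r) (F - G) = 0) (hs : (r : ℤ) ≤ n + s) :
    resDiff n ((mulSub₁₂ ^ s) F) ((mulSub₁₂ ^ s) G) = 0 := by
  ext m k
  have h1 : (fun l m => (mulSub₁₂ ^ s) F l m k) = (mulSub ^ s) fun l m => F l m k := by
    ext l m; exact mulSub₁₂_pow_apply _ _ _ _ _
  have h2 : (fun l m => (mulSub₁₂ ^ s) G l m k) = (mulSub ^ s) fun l m => G l m k := by
    ext l m; exact mulSub₁₂_pow_apply _ _ _ _ _
  rw [resDiff, h1, h2, resL_mulSub_pow (hF k), resR_mulSub_pow (hG k),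
    resL_eq_resR (hF k) (hG k) (r := r) _ hs, sub_self]
  · rfl
  · ext l m
    have := congrFun₃ h l m k
    rw [mulSub₁₂_pow_apply] at this
    exact this

/-- Dong's lemma for distributions in three variables. -/
theorem mulSub_pow_resDiff_eq_zero {F G : ℤ → ℤ → ℤ → E} (hF : F ∈ BddMid) (hG : G ∈ BddFst)
    {r : ℕ} {n : ℤ} (hn : 0 ≤ n + r) (h : (mulSub₁₂ ^ r) (F - G) = 0)
    (hF' : (mulSub₁₃ ^ r) ((mulSub₂₃ ^ r) F) = 0) (hG' : (mulSub₁₃ ^ r) ((mulSub₂₃ ^ r) G) = 0) :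
    (mulSub ^ (4 * r)) (resDiff n F G) = 0 := by
  have mF₂₃ : ∀ w, (mulSub₂₃ ^ w) F ∈ BddMid := fun w =>
    pow_apply_mem (S := BddMid) (T := mulSub₂₃) (fun _ => mulSub₂₃_mem_bddMid) _ hF
  have mF' : ∀ t w, (mulSub₁₃ ^ t) ((mulSub₂₃ ^ w) F) ∈ BddMid := fun t w =>
    pow_apply_mem (S := BddMid) (T := mulSub₁₃) (fun _ => mulSub₁₃_mem_bddMid) _ (mF₂₃ w)
  have mF : ∀ s t w, (mulSub₁₂ ^ s) ((mulSub₁₃ ^ t) ((mulSub₂₃ ^ w) F)) ∈ BddMid := fun s t w =>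
    pow_apply_mem (S := BddMid) (T := mulSub₁₂) (fun _ => mulSub₁₂_mem_bddMid) _ (mF' t w)
  have mG₂₃ : ∀ w, (mulSub₂₃ ^ w) G ∈ BddFst := fun w =>
    pow_apply_mem (S := BddFst) (T := mulSub₂₃) (fun _ => mulSub₂₃_mem_bddFst) _ hG
  have mG' : ∀ t w, (mulSub₁₃ ^ t) ((mulSub₂₃ ^ w) G) ∈ BddFst := fun t w =>
    pow_apply_mem (S := BddFst) (T := mulSub₁₃) (fun _ => mulSub₁₃_mem_bddFst) _ (mG₂₃ w)
  have mG : ∀ s t w, (mulSub₁₂ ^ s) ((mulSub₁₃ ^ t) ((mulSub₂₃ ^ w) G)) ∈ BddFst := fun s t w =>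
    pow_apply_mem (S := BddFst) (T := mulSub₁₂) (fun _ => mulSub₁₂_mem_bddFst) _ (mG' t w)
  have step : ∀ (H : ℤ → ℤ → ℤ → E) (s t w : ℕ),
      (mulSub₁₂ ^ s) ((mulSub₁₃ ^ t) ((mulSub₂₃ ^ (w + 1)) H)) =
      (mulSub₁₂ ^ s) ((mulSub₁₃ ^ (t + 1)) ((mulSub₂₃ ^ w) H))
        - (mulSub₁₂ ^ (s + 1)) ((mulSub₁₃ ^ t) ((mulSub₂₃ ^ w) H)) := by
    intro H s t w
    rw [pow_succ', Module.End.mul_apply]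
    generalize (mulSub₂₃ ^ w) H = K
    have e : mulSub₂₃ K = mulSub₁₃ K - mulSub₁₂ K := by rw [mulSub₂₃_eq]; rfl
    have e' : (mulSub₁₃ ^ t) (mulSub₁₂ K) = mulSub₁₂ ((mulSub₁₃ ^ t) K) :=
      (LinearMap.congr_fun ((commute_mulSub₁₂_mulSub₁₃ (E := E)).pow_right t).eq K).symm
    rw [e, map_sub, map_sub, e', pow_succ mulSub₁₃, pow_succ mulSub₁₂, Module.End.mul_apply,
      Module.End.mul_apply]
  have vanish : ∀ {H : ℤ → ℤ → ℤ → E}, (mulSub₁₃ ^ r) ((mulSub₂₃ ^ r) H) = 0 → ∀ s t,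
      (mulSub₁₂ ^ s) ((mulSub₁₃ ^ (t + r)) ((mulSub₂₃ ^ r) H)) = 0 := by
    intro H hH s t
    rw [pow_add, Module.End.mul_apply, hH, map_zero, map_zero]
  -- Of the 4r factors y - z, r are kept and the other 3r are traded one at a time for x - z or x -
  -- y. The induction on w keeps the total s + t + w at 3r or more.
  have main : ∀ w s t : ℕ, 3 * r ≤ s + t + w →
      resDiff n ((mulSub₁₂ ^ s) ((mulSub₁₃ ^ t) ((mulSub₂₃ ^ (r + w)) F)))
        ((mulSub₁₂ ^ s) ((mulSub₁₃ ^ t) ((mulSub₂₃ ^ (r + w)) G))) = 0 := by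
    intro w
    induction w with
    | zero =>
      intro s t hst
      rw [add_zero]
      -- If t ≥ r, the factors (x - z)^r (y - z)^r kill F and G separately. Otherwise s > 2r, and n
      -- ≥ -r gives n + s ≥ r, so the residues of F and G cancel.
      by_cases ht : r ≤ t
      · obtain ⟨t, rfl⟩ := Nat.exists_eq_add_of_le' ht
        rw [vanish hF', vanish hG']
        ext m k
        change resL n (0 : ℤ → ℤ → E) m - resR n (0 : ℤ → ℤ → E) m = 0
        simp
      · refine resDiff_mulSub₁₂_pow_eq_zero (mF' _ _) (mG' _ _) (r := r) ?_ (by lia)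
        have e1 : ∀ K : ℤ → ℤ → ℤ → E, (mulSub₁₂ ^ r) ((mulSub₁₃ ^ t) K) =
            (mulSub₁₃ ^ t) ((mulSub₁₂ ^ r) K) :=
          LinearMap.congr_fun ((commute_mulSub₁₂_mulSub₁₃ (E := E)).pow_pow r t).eq
        have e2 : ∀ K : ℤ → ℤ → ℤ → E, (mulSub₁₂ ^ r) ((mulSub₂₃ ^ r) K) =
            (mulSub₂₃ ^ r) ((mulSub₁₂ ^ r) K) :=
          LinearMap.congr_fun ((commute_mulSub₁₂_mulSub₂₃ (E := E)).pow_pow r r).eq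
        rw [← map_sub, ← map_sub, e1, e2, h, map_zero, map_zero]
    | succ w ih =>
      intro s t hst
      rw [← add_assoc, step, step, resDiff_sub (mF _ _ _) (mF _ _ _) (mG _ _ _) (mG _ _ _),
        ih s (t + 1) (by lia), ih (s + 1) t (by lia), sub_zero]
  have := main (3 * r) 0 0 (by lia)
  rw [show r + 3 * r = 4 * r by ring] at this
  simp only [pow_zero, Module.End.one_apply] at this
  rw [← resDiff_mulSub₂₃_pow hF hG, this]

end Dong

/-! ### Fields and their products -/

section Fields

theorem mulSub_pow_map {E E' : Type*} [AddCommGroup E] [Module ℂ E] [AddCommGroup E'] [Module ℂ E']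
    (φ : E →ₗ[ℂ] E') (k : ℕ) (f : ℤ → ℤ → E) (m n : ℤ) :
    (mulSub ^ k) (fun m n => φ (f m n)) m n = φ ((mulSub ^ k) f m n) := by
  rw [mulSub_pow_apply, mulSub_pow_apply, map_sum]
  simp

theorem mulSub_pow_map_eq_zero {E E' : Type*} [AddCommGroup E] [Module ℂ E] [AddCommGroup E']
    [Module ℂ E'] (φ : E →ₗ[ℂ] E') {k : ℕ} {f : ℤ → ℤ → E} (h : (mulSub ^ k) f = 0) :
    (mulSub ^ k) (fun m n => φ (f m n)) = 0 := by
  ext m n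
  rw [mulSub_pow_map, h]
  exact map_zero φ

theorem mulSub_pow_eq_zero_of_le {E : Type*} [AddCommGroup E] [Module ℂ E] {r s : ℕ}
    {f : ℤ → ℤ → E} (h : (mulSub ^ r) f = 0) (hrs : r ≤ s) : (mulSub ^ s) f = 0 := by
  obtain ⟨t, rfl⟩ := Nat.exists_eq_add_of_le' hrs
  rw [pow_add, Module.End.mul_apply, h, map_zero]

/-- The sign (-1)^k compares (z - w)^k with (w - z)^k; it makes locality a symmetric relation. -/
theorem mulSub_pow_swap {E : Type*} [AddCommGroup E] [Module ℂ E] (k : ℕ) (f : ℤ → ℤ → E)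
    (m n : ℤ) : (mulSub ^ k) (fun m n => f n m) m n = (-1 : ℂ) ^ k • (mulSub ^ k) f n m := by
  induction k generalizing m n with
  | zero => simp
  | succ k ih =>
    rw [pow_succ' mulSub, Module.End.mul_apply, mulSub_apply, ih, ih, Module.End.mul_apply,
      mulSub_apply, pow_succ, ← smul_sub, mul_smul, neg_one_smul, neg_sub]

/-- Multiplication of `f(z, w)` by powers of `z - w` and differentiation in `w`. -/
theorem mulSub_pow_deriv {E : Type*} [AddCommGroup E] [Module ℂ E] (k : ℕ) (f : ℤ → ℤ → E)
    (m n : ℤ) : (mulSub ^ (k + 1)) (fun (m n : ℤ) => (-n : ℂ) • f m (n - 1)) m n =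
      (-n : ℂ) • (mulSub ^ (k + 1)) f m (n - 1) + ((k : ℂ) + 1) • (mulSub ^ k) f m n := by
  -- The product rule in the form (z - w) ∂_w g = ∂_w((z - w) g) + g.
  have h1 : ∀ (g : ℤ → ℤ → E), mulSub (fun (m n : ℤ) => (-n : ℂ) • g m (n - 1)) =
      (fun (m n : ℤ) => (-n : ℂ) • mulSub g m (n - 1)) + g := by
    intro g
    ext m n
    simp only [mulSub_apply, Pi.add_apply, sub_add_cancel, add_sub_cancel_right]
    push_cast
    module
  induction k generalizing f with
  | zero =>
    rw [zero_add, pow_one, pow_zero, h1, Nat.cast_zero, zero_add, one_smul]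
    rfl
  | succ k ih =>
    rw [pow_succ, Module.End.mul_apply, h1, map_add, Pi.add_apply, Pi.add_apply, ih,
      ← Module.End.mul_apply, ← pow_succ, ← Module.End.mul_apply, ← pow_succ]
    push_cast
    module

variable {V : Type*} [AddCommGroup V] [Module ℂ V]

/-- `a(z)` is a field: `a(z) v` is a Laurent series for every `v`. -/
def IsVertexField (a : ℤ → Module.End ℂ V) : Prop := ∀ v, ∃ M : ℤ, ∀ n ≥ M, a n v = 0

/-- `(z - w)^r [a(z), b(w)] = 0` for some `r`. -/
def MutuallyLocal (a b : ℤ → Module.End ℂ V) : Prop :=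
  ∃ r : ℕ, (mulSub ^ r) (fun m n => a m * b n - b n * a m) = 0

/-- `[D, a(z)] = ∂a(z)`. -/
def IsCovariant (D : Module.End ℂ V) (a : ℤ → Module.End ℂ V) : Prop :=
  ∀ n, D * a n - a n * D = fieldDeriv a n

variable {a a' b c : ℤ → Module.End ℂ V} {D : Module.End ℂ V}

theorem IsVertexField.add (ha : IsVertexField a) (hb : IsVertexField b) : IsVertexField (a + b) := by
  intro v
  obtain ⟨M, hM⟩ := ha v
  obtain ⟨M', hM'⟩ := hb v
  exact ⟨max M M', fun n hn => by simp [hM n (by lia), hM' n (by lia)]⟩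

theorem IsVertexField.smul (s : ℂ) (ha : IsVertexField a) : IsVertexField (s • a) := by
  intro v
  obtain ⟨M, hM⟩ := ha v
  exact ⟨M, fun n hn => by simp [hM n hn]⟩

theorem IsVertexField.fieldDeriv (ha : IsVertexField a) : IsVertexField (fieldDeriv a) := by
  intro v
  obtain ⟨M, hM⟩ := ha v
  exact ⟨M + 1, fun n hn => by simp [_root_.fieldDeriv, hM (n - 1) (by lia)]⟩

theorem IsCovariant.add (ha : IsCovariant D a) (hb : IsCovariant D b) : IsCovariant D (a + b) := by
  intro n
  have h1 := ha n
  have h2 := hb n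
  simp only [fieldDeriv, Pi.add_apply, smul_add] at *
  rw [← h1, ← h2, mul_add, add_mul]; abel

theorem IsCovariant.smul (s : ℂ) (ha : IsCovariant D a) : IsCovariant D (s • a) := by
  intro n
  have h1 := ha n
  simp only [fieldDeriv, Pi.smul_apply] at *
  rw [smul_comm, ← h1, mul_smul_comm, smul_mul_assoc, smul_sub]

theorem IsCovariant.fieldDeriv (ha : IsCovariant D a) : IsCovariant D (fieldDeriv a) := by
  intro n
  have h1 := ha (n - 1)
  simp only [_root_.fieldDeriv] at *
  rw [← h1, mul_smul_comm, smul_mul_assoc, smul_sub]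

theorem MutuallyLocal.symm (h : MutuallyLocal a b) : MutuallyLocal b a := by
  obtain ⟨r, hr⟩ := h
  refine ⟨r, ?_⟩
  ext1 m; ext1 n
  have h := mulSub_pow_swap r (fun m n => -(a m * b n - b n * a m)) m n
  have h0 : (mulSub ^ r) (fun m n => -(a m * b n - b n * a m)) = 0 :=
    mulSub_pow_map_eq_zero (-LinearMap.id) hr
  rw [h0] at h
  simpa only [neg_sub, Pi.zero_apply, smul_zero] using h

theorem MutuallyLocal.add_right (h : MutuallyLocal a b) (h' : MutuallyLocal a c) :
    MutuallyLocal a (b + c) := by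
  obtain ⟨r, hr⟩ := h
  obtain ⟨s, hs⟩ := h'
  refine ⟨max r s, ?_⟩
  have e : (fun m n => a m * (b + c) n - (b + c) n * a m) =
      (fun m n => a m * b n - b n * a m) + fun m n => a m * c n - c n * a m := by
    ext1 m; ext1 n
    simp only [Pi.add_apply, mul_add, add_mul]; abel
  rw [e, map_add, mulSub_pow_eq_zero_of_le hr (le_max_left _ _),
    mulSub_pow_eq_zero_of_le hs (le_max_right _ _), add_zero]

theorem MutuallyLocal.smul_right (s : ℂ) (h : MutuallyLocal a b) : MutuallyLocal a (s • b) := by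
  obtain ⟨r, hr⟩ := h
  refine ⟨r, ?_⟩
  have e : (fun m n => a m * (s • b) n - (s • b) n * a m) =
      s • fun m n => a m * b n - b n * a m := by
    ext1 m; ext1 n
    simp only [Pi.smul_apply, smul_sub, mul_smul_comm, smul_mul_assoc]
  rw [e, map_smul, hr, smul_zero]

/-- By the product rule, differentiation in w costs one power of z - w, so the exponent r + 1
suffices. -/
theorem MutuallyLocal.fieldDeriv_right (h : MutuallyLocal a b) :
    MutuallyLocal a (fieldDeriv b) := by
  obtain ⟨r, hr⟩ := h
  refine ⟨r + 1, ?_⟩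
  have e : (fun m n => a m * fieldDeriv b n - fieldDeriv b n * a m) =
      fun (m n : ℤ) => (-n : ℂ) • (fun m n => a m * b n - b n * a m) m (n - 1) := by
    ext1 m; ext1 n
    simp only [fieldDeriv, mul_smul_comm, smul_mul_assoc, smul_sub]
  ext1 m; ext1 n
  rw [e, mulSub_pow_deriv r (fun m n => a m * b n - b n * a m) m n, hr, mulSub_pow_eq_zero_of_le hr (Nat.le_succ r)]
  simp

theorem MutuallyLocal.eventually (h : MutuallyLocal a b) : ∃ k₀ : ℕ, ∀ k ≥ k₀, ∀ m n : ℤ,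
    ∑ i ∈ Finset.range (k + 1), ((-1 : ℂ) ^ i * (k.choose i : ℂ)) •
      (a (m + k - i) * b (n + i) - b (n + i) * a (m + k - i)) = 0 := by
  obtain ⟨r, hr⟩ := h
  refine ⟨r, fun k hk m n => ?_⟩
  have := congrFun₂ (mulSub_pow_eq_zero_of_le hr hk) m n
  rwa [mulSub_pow_apply] at this

/-- The field `1`. -/
def idField : ℤ → Module.End ℂ V := fun n => if n = -1 then 1 else 0

theorem isVertexField_idField : IsVertexField (idField : ℤ → Module.End ℂ V) :=
  fun v => ⟨0, fun n hn => by rw [idField, if_neg (by lia)]; rfl⟩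

theorem isCovariant_idField : IsCovariant D idField := by
  intro n
  rw [fieldDeriv, idField, idField]
  split_ifs with h1 h2 h2
  · lia
  · simp
  · obtain rfl : n = 0 := by lia
    simp
  · simp

theorem mutuallyLocal_idField : MutuallyLocal a idField := by
  refine ⟨0, ?_⟩
  rw [pow_zero, Module.End.one_apply]
  ext1 m; ext1 n
  rw [idField]
  split_ifs <;> simp

/-- The mode `m` of the product `a(z)_(n) b(z)`, applied to `v`. -/
def nthProd (a : ℤ → Module.End ℂ V) (n : ℤ) (b : ℤ → Module.End ℂ V) (m : ℤ) (v : V) : V :=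
  resL n (fun l k => a l (b k v)) m - resR n (fun l k => b k (a l v)) m

theorem IsVertexField.bddR (hb : IsVertexField b) (a : ℤ → Module.End ℂ V) (v : V) :
    BddR fun l k => a l (b k v) := by
  obtain ⟨M, hM⟩ := hb v
  exact ⟨M, fun m hm l => by simp [hM m hm]⟩

theorem IsVertexField.bddL (ha : IsVertexField a) (b : ℤ → Module.End ℂ V) (v : V) :
    BddL fun l k => b k (a l v) := by
  obtain ⟨M, hM⟩ := ha v
  exact ⟨M, fun m hm l => by simp [hM m hm]⟩

/-- The field `a(z)_(n) b(z)`. -/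
def nthProdField (ha : IsVertexField a) (n : ℤ) (hb : IsVertexField b) : ℤ → Module.End ℂ V := fun m =>
  { toFun := nthProd a n b m
    map_add' := fun v w => by
      have h1 := resL_add (hb.bddR a v) (hb.bddR a w) n m
      have h2 := resR_add (ha.bddL b v) (ha.bddL b w) n m
      simp only [nthProd, map_add]
      change resL n ((fun l k => a l (b k v)) + fun l k => a l (b k w)) m
        - resR n ((fun l k => b k (a l v)) + fun l k => b k (a l w)) m = _
      rw [h1, h2]; abel
    map_smul' := fun s v => by
      have h1 := resL_smul s (hb.bddR a v) n m
      have h2 := resR_smul s (ha.bddL b v) n m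
      simp only [nthProd, map_smul, RingHom.id_apply, smul_sub]
      change resL n (s • fun l k => a l (b k v)) m - resR n (s • fun l k => b k (a l v)) m = _
      rw [h1, h2] }

theorem nthProdField_apply (ha : IsVertexField a) (n : ℤ) (hb : IsVertexField b) (m : ℤ) (v : V) :
    nthProdField ha n hb m v = nthProd a n b m v := rfl

/-- For large m the first residue vanishes because b(w)v is bounded. The second involves only the
finitely many non-zero a_i v with i ≥ 0, and a common bound for the series b(w) a_i v exists. -/
theorem isVertexField_nthProdField (ha : IsVertexField a) (n : ℤ) (hb : IsVertexField b) :
    IsVertexField (nthProdField ha n hb) := by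
  intro v
  obtain ⟨M, hM⟩ := hb v
  obtain ⟨K, hK⟩ := (ha.bddL b v).exists_nat
  have h : ∀ K' : ℕ, ∃ M : ℤ, ∀ i < K', ∀ k ≥ M, b k (a i v) = 0 := by
    intro K'
    induction K' with
    | zero => exact ⟨0, by simp⟩
    | succ j ih =>
      obtain ⟨M, hM⟩ := ih
      obtain ⟨M', hM'⟩ := hb (a j v)
      refine ⟨max M M', fun i hi k hk => ?_⟩
      rcases Nat.lt_succ_iff_lt_or_eq.1 hi with h | rfl
      · exact hM i h k (by lia)
      · exact hM' k (by lia)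
  obtain ⟨M', hM'⟩ := h K
  refine ⟨max M (M' + K - n), fun m hm => ?_⟩
  rw [nthProdField_apply, nthProd, resL_eq_sum (K := 0) fun m' hm' l => by
    simp [hM m' (by lia)], resR_eq_sum hK]
  rw [Finset.range_zero, Finset.sum_empty, zero_sub, neg_eq_zero]
  refine Finset.sum_eq_zero fun i hi => ?_
  rw [Finset.mem_range] at hi
  rw [hM' i hi _ (by lia), smul_zero]

/-- Dong's lemma. -/
theorem MutuallyLocal.nthProdField (ha : IsVertexField a) (hb : IsVertexField b)
    (hab : MutuallyLocal a b) (hac : MutuallyLocal a c) (hbc : MutuallyLocal b c) (n : ℤ) :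
    MutuallyLocal (nthProdField ha n hb) c := by
  obtain ⟨r₁, h₁⟩ := hab
  obtain ⟨r₂, h₂⟩ := hac
  obtain ⟨r₃, h₃⟩ := hbc
  obtain ⟨r, hr₁, hr₂, hr₃, hn⟩ : ∃ r : ℕ, r₁ ≤ r ∧ r₂ ≤ r ∧ r₃ ≤ r ∧ 0 ≤ n + r :=
    ⟨r₁ + r₂ + r₃ + n.natAbs, by lia, by lia, by lia, by lia⟩
  replace h₁ := mulSub_pow_eq_zero_of_le h₁ hr₁
  replace h₂ := mulSub_pow_eq_zero_of_le h₂ hr₂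
  replace h₃ := mulSub_pow_eq_zero_of_le h₃ hr₃
  refine ⟨4 * r, ?_⟩
  ext1 m; ext1 k
  refine LinearMap.ext fun v => ?_
  let ev (w : V) : Module.End ℂ V →ₗ[ℂ] V := LinearMap.applyₗ w
  -- F and G are the coefficients of [a(x) b(y), c(z)]v and [b(y) a(x), c(z)]v. The residue of (x -
  -- y)^n times F minus that for G is the commutator of a_(n) b with c, applied to v.
  let F : ℤ → ℤ → ℤ → V := fun l m k => a l (b m (c k v)) - c k (a l (b m v))
  let G : ℤ → ℤ → ℤ → V := fun l m k => b m (a l (c k v)) - c k (b m (a l v))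
  have hF : F ∈ BddMid := by
    intro k
    obtain ⟨M, hM⟩ := hb v
    obtain ⟨M', hM'⟩ := hb (c k v)
    refine ⟨max M M', fun m hm l => ?_⟩
    simp [F, hM m (by lia), hM' m (by lia)]
  have hG : G ∈ BddFst := by
    intro k
    obtain ⟨M, hM⟩ := ha v
    obtain ⟨M', hM'⟩ := ha (c k v)
    refine ⟨max M M', fun m hm l => ?_⟩
    simp [G, hM m (by lia), hM' m (by lia)]
  have comm := fun H : ℤ → ℤ → ℤ → V =>
    LinearMap.congr_fun ((commute_mulSub₁₃_mulSub₂₃ (E := V)).pow_pow r r).eq H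
  have key := mulSub_pow_resDiff_eq_zero hF hG (r := r) hn
    (by
      ext l m k
      rw [mulSub₁₂_pow_apply]
      have := mulSub_pow_map_eq_zero (ev (c k v) - (c k) ∘ₗ ev v) h₁
      have e : (fun l m => (F - G) l m k) = fun l m =>
          (ev (c k v) - (c k) ∘ₗ ev v) (a l * b m - b m * a l) := by
        ext l m
        simp [F, G, ev]
        abel
      rw [e, this]
      rfl)
    (by
      -- The Leibniz rule [ab, c] = a[b, c] + [a, c]b: the first term is killed by (y - z)^r, the
      -- second by (x - z)^r.
      have e : F = (fun l m k => a l ((b m * c k - c k * b m) v))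
          + fun l m k => (a l * c k - c k * a l) (b m v) := by
        ext l m k
        simp [F]
      have e1 : (mulSub₂₃ ^ r) (fun l m k => a l ((b m * c k - c k * b m) v)) = 0 := by
        ext l m k
        rw [mulSub₂₃_pow_apply]
        exact congrFun₂ (mulSub_pow_map_eq_zero (a l ∘ₗ ev v) h₃) m k
      have e2 : (mulSub₁₃ ^ r) (fun l m k => (a l * c k - c k * a l) (b m v)) = 0 := by
        ext l m k
        rw [mulSub₁₃_pow_apply]
        exact congrFun₂ (mulSub_pow_map_eq_zero (ev (b m v)) h₂) l k
      rw [e, map_add, map_add, e1, map_zero, zero_add]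
      refine (comm _).trans ?_
      rw [Module.End.mul_apply, e2, map_zero])
    (by
      have e : G = (fun l m k => b m ((a l * c k - c k * a l) v))
          + fun l m k => (b m * c k - c k * b m) (a l v) := by
        ext l m k
        simp [G]
      have e1 : (mulSub₂₃ ^ r) (fun l m k => (b m * c k - c k * b m) (a l v)) = 0 := by
        ext l m k
        rw [mulSub₂₃_pow_apply]
        exact congrFun₂ (mulSub_pow_map_eq_zero (ev (a l v)) h₃) m k
      have e2 : (mulSub₁₃ ^ r) (fun l m k => b m ((a l * c k - c k * a l) v)) = 0 := by
        ext l m k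
        rw [mulSub₁₃_pow_apply]
        exact congrFun₂ (mulSub_pow_map_eq_zero (b m ∘ₗ ev v) h₂) l k
      rw [e, map_add, map_add, e1, map_zero, add_zero]
      refine (comm _).trans ?_
      rw [Module.End.mul_apply, e2, map_zero])
  have hres : resDiff n F G = fun m k => ev v (_root_.nthProdField ha n hb m * c k
      - c k * _root_.nthProdField ha n hb m) := by
    ext m k
    have h1 := resL_sub (hb.bddR a (c k v)) (f := fun l m => a l (b m (c k v)))
      (g := fun l m => c k (a l (b m v))) ?_ n m
    have h2 := resR_sub (ha.bddL b (c k v)) (f := fun l m => b m (a l (c k v)))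
      (g := fun l m => c k (b m (a l v))) ?_ n m
    · have h3 := resL_map (c k) (hb.bddR a v) n m
      have h4 := resR_map (c k) (ha.bddL b v) n m
      change resL n ((fun l m => a l (b m (c k v))) - fun l m => c k (a l (b m v))) m
        - resR n ((fun l m => b m (a l (c k v))) - fun l m => c k (b m (a l v))) m = _
      rw [h1, h2, h3, h4]
      change _ = nthProd a n b m (c k v) - c k (nthProd a n b m v)
      simp only [nthProd, map_sub]
      abel
    · obtain ⟨M, hM⟩ := ha v
      exact ⟨M, fun m hm l => by simp [hM m hm]⟩
    · obtain ⟨M, hM⟩ := hb v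
      exact ⟨M, fun m hm l => by simp [hM m hm]⟩
  rw [hres] at key
  have := congrFun₂ key m k
  rw [mulSub_pow_map] at this
  exact this

/-- The operator ∂_z + ∂_w annihilates (z - w)^n, and a residue of a z-derivative is zero. Hence
applying ∂_z + ∂_w to f differentiates the residue in w. -/
theorem resL_deriv {f : ℤ → ℤ → V} (hf : BddR f) (n m : ℤ) :
    resL n (fun l k => (-l : ℂ) • f (l - 1) k + (-k : ℂ) • f l (k - 1)) m =
      (-m : ℂ) • resL n f (m - 1) := by
  obtain ⟨K, hK⟩ := hf.exists_nat (m - 1)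
  rw [resL_eq_sum hK, resL_eq_sum (K := K) fun m' hm' l => by
    rw [hK m' (by lia), hK (m' - 1) (by lia)]; simp]
  -- Integration by parts in z: the summation index is shifted by one, using the recursion of the
  -- binomial coefficients. The new boundary term at i = K vanishes by the bound on f.
  have e : ∑ i ∈ Finset.range K, signedChoose n i • (-((n - i : ℤ) : ℂ)) • f (n - i - 1) (m + i) =
      ∑ i ∈ Finset.range K, (i * signedChoose n i) • f (n - i) (m - 1 + i) := by
    have h1 : ∑ i ∈ Finset.range K, (i * signedChoose n i) • f (n - i) (m - 1 + i) =
        ∑ i ∈ Finset.range (K + 1), (i * signedChoose n i) • f (n - i) (m - 1 + i) := by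
      rw [Finset.sum_range_succ, hK _ le_rfl, smul_zero, add_zero]
    rw [h1, Finset.sum_range_succ']
    simp only [Nat.cast_zero, zero_mul, zero_smul, add_zero]
    refine Finset.sum_congr rfl fun i _ => ?_
    have := signedChoose_succ_mul n i
    push_cast
    rw [this, smul_smul]
    congr 1
    · ring
    · congr 1 <;> ring
  simp only [smul_add, Finset.sum_add_distrib, e]
  rw [Finset.smul_sum, ← Finset.sum_add_distrib]
  refine Finset.sum_congr rfl fun i _ => ?_
  rw [show m + (i : ℤ) - 1 = m - 1 + i by ring, smul_smul, smul_smul, ← add_smul]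
  congr 1
  push_cast; ring

theorem resR_deriv {f : ℤ → ℤ → V} (hf : BddL f) (n m : ℤ) :
    resR n (fun l k => (-l : ℂ) • f (l - 1) k + (-k : ℂ) • f l (k - 1)) m =
      (-m : ℂ) • resR n f (m - 1) := by
  obtain ⟨K, hK⟩ := hf.exists_nat
  rw [resR_eq_sum hK, resR_eq_sum (K := K + 1) fun l hl k => by
    rw [hK l (by push_cast at hl; lia), hK (l - 1) (by push_cast at hl; lia)]; simp]
  simp only [smul_add, Finset.sum_add_distrib]
  rw [Finset.sum_range_succ', Finset.sum_range_succ, hK K le_rfl]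
  simp only [Nat.cast_zero, Int.cast_zero, neg_zero, zero_smul, smul_zero, add_zero]
  rw [Finset.smul_sum, ← Finset.sum_add_distrib]
  refine Finset.sum_congr rfl fun i _ => ?_
  have := signedChoose_succ_mul n i
  rw [show ((i + 1 : ℕ) : ℤ) - 1 = i by push_cast; ring,
    show m + n - ((i + 1 : ℕ) : ℤ) = m - 1 + n - i by push_cast; ring,
    show m + n - (i : ℤ) - 1 = m - 1 + n - i by ring, smul_smul, smul_smul, smul_smul, ← add_smul]
  congr 1
  push_cast
  linear_combination (-(-1 : ℂ) ^ n) * this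

/-- Commutation with D acts on a(z) b(w) and on b(w) a(z) as ∂_z + ∂_w, which turns into ∂_w under
both residues. -/
theorem IsCovariant.nthProdField (ha : IsVertexField a) (n : ℤ) (hb : IsVertexField b)
    (ha' : IsCovariant D a) (hb' : IsCovariant D b) : IsCovariant D (nthProdField ha n hb) := by
  intro m
  refine LinearMap.ext fun v => ?_
  have hA : ∀ l w, D (a l w) = a l (D w) + (-l : ℂ) • a (l - 1) w := fun l w => by
    have := LinearMap.congr_fun (ha' l) w
    simp only [LinearMap.sub_apply, Module.End.mul_apply, _root_.fieldDeriv,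
      LinearMap.smul_apply] at this
    rw [← this]; abel
  have hB : ∀ l w, D (b l w) = b l (D w) + (-l : ℂ) • b (l - 1) w := fun l w => by
    have := LinearMap.congr_fun (hb' l) w
    simp only [LinearMap.sub_apply, Module.End.mul_apply, _root_.fieldDeriv,
      LinearMap.smul_apply] at this
    rw [← this]; abel
  have h1 : (fun l k => D (a l (b k v))) - (fun l k => a l (b k (D v))) =
      fun (l k : ℤ) => (-l : ℂ) • a (l - 1) (b k v) + (-k : ℂ) • a l (b (k - 1) v) := by
    ext l k
    simp only [Pi.sub_apply, hA, hB, map_add, map_smul]; abel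
  have h2 : (fun l k => D (b k (a l v))) - (fun l k => b k (a l (D v))) =
      fun (l k : ℤ) => (-l : ℂ) • b k (a (l - 1) v) + (-k : ℂ) • b (k - 1) (a l v) := by
    ext l k
    simp only [Pi.sub_apply, hA, hB, map_add, map_smul]; abel
  have bR : BddR fun l k => D (a l (b k v)) := by
    obtain ⟨M, hM⟩ := hb v
    exact ⟨M, fun m hm l => by simp [hM m hm]⟩
  have bL : BddL fun l k => D (b k (a l v)) := by
    obtain ⟨M, hM⟩ := ha v
    exact ⟨M, fun m hm l => by simp [hM m hm]⟩
  have h3 := resL_sub bR (hb.bddR a (D v)) n m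
  have h4 := resR_sub bL (ha.bddL b (D v)) n m
  rw [h1, resL_deriv (f := fun l k => a l (b k v)) (hb.bddR a v), resL_map D (hb.bddR a v)] at h3
  rw [h2, resR_deriv (f := fun l k => b k (a l v)) (ha.bddL b v), resR_map D (ha.bddL b v)] at h4
  change D (nthProd a n b m v) - nthProd a n b m (D v) = (-m : ℂ) • nthProd a n b (m - 1) v
  simp only [nthProd, map_sub, smul_sub, h3, h4]
  abel

theorem nthProd_creation {v : V} (ha : ∀ n ≥ 0, a n v = 0) (hb : ∀ n ≥ 0, b n v = 0) (n : ℤ)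
    {m : ℤ} (hm : 0 ≤ m) : nthProd a n b m v = 0 := by
  rw [nthProd, resL_eq_sum (K := 0) fun m' hm' l => by simp [hb m' (by lia)],
    resR_eq_sum (K := 0) fun l hl k => by simp [ha l (by lia)]]
  simp

/-- On a vector killed by all non-negative modes, the second residue is zero and only i = 0 survives
in the first. Thus the field a(z)_(n) b(z) belongs to the state a_n b_(-1) v. -/
theorem nthProd_state {v : V} (ha : ∀ n ≥ 0, a n v = 0) (hb : ∀ n ≥ 0, b n v = 0) (n : ℤ) :
    nthProd a n b (-1) v = a n (b (-1) v) := by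
  rw [nthProd, resL_eq_sum (K := 1) fun m' hm' l => by simp [hb m' (by lia)],
    resR_eq_sum (K := 0) fun l hl k => by simp [ha l (by lia)]]
  simp [signedChoose]

theorem fieldDeriv_iterate (a : ℤ → Module.End ℂ V) (n : ℕ) (m : ℤ) :
    ((n.factorial : ℂ)⁻¹ • fieldDeriv^[n] a) m = signedChoose m n • a (m - n) := by
  induction n generalizing m with
  | zero => simp [signedChoose]
  | succ n ih =>
    have h1 : (n : ℂ) + 1 ≠ 0 := by exact_mod_cast Nat.succ_ne_zero n
    have h2 : (n.factorial : ℂ) ≠ 0 := by exact_mod_cast n.factorial_ne_zero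
    have ih' : ∀ m, (fieldDeriv^[n] a) m = ((n.factorial : ℂ) * signedChoose m n) • a (m - n) := by
      intro m
      rw [mul_smul, ← ih, Pi.smul_apply, smul_smul, mul_inv_cancel₀ h2, one_smul]
    have h3 : ((n : ℂ) + 1) * signedChoose m (n + 1) = -m * signedChoose (m - 1) n := by
      have e1 := signedChoose_succ_mul m n
      -- The absorption identity (m - n) C(m, n) = m C(m - 1, n), up to the common sign.
      have : ∀ n : ℕ, ((m : ℂ) - n) * signedChoose m n = m * signedChoose (m - 1) n := by
        intro n
        induction n with
        | zero => simp [signedChoose]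
        | succ n ih =>
          have h1 : (n : ℂ) + 1 ≠ 0 := by exact_mod_cast Nat.succ_ne_zero n
          refine mul_left_cancel₀ h1 ?_
          have e1 := signedChoose_succ_mul m n
          have e2 := signedChoose_succ_mul (m - 1) n
          push_cast at e2 ⊢
          linear_combination (m - (n + 1) : ℂ) * e1 - (m : ℂ) * e2 - ((m : ℂ) - (n + 1)) * ih
      rw [e1, this]; ring
    rw [Function.iterate_succ_apply', Pi.smul_apply, fieldDeriv, ih', Nat.factorial_succ,
      smul_smul, smul_smul]
    push_cast
    rw [show m - 1 - (n : ℤ) = m - (n + 1) by ring]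
    congr 1
    field_simp
    linear_combination -h3

theorem signedChoose_natCast (m i : ℕ) : signedChoose m i = (-1) ^ i * m.choose i := by
  induction i with
  | zero => simp [signedChoose]
  | succ i ih =>
    have h : (i : ℂ) + 1 ≠ 0 := by exact_mod_cast Nat.succ_ne_zero i
    refine mul_left_cancel₀ h ?_
    rw [signedChoose_succ_mul, ih]
    rcases le_or_gt i m with hi | hi
    · have h1 := congrArg (Nat.cast : ℕ → ℂ) (Nat.choose_succ_right_eq m i)
      push_cast [Nat.cast_sub hi] at h1 ⊢
      rw [pow_succ]
      linear_combination (-1 : ℂ) ^ i * h1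
    · rw [Nat.choose_eq_zero_of_lt hi, Nat.choose_eq_zero_of_lt (by lia)]
      simp

/-- Expanding (z - w)^(-1-n) in either region and taking the residue in z yields the coefficients of
the divided derivative of a: the region |z| > |w| gives its negative modes, the region |w| > |z| the
non-negative ones. -/
theorem normalOrder_eq_nthProd (ha : IsVertexField a) (b : ℤ → Module.End ℂ V) (n : ℕ) (m : ℤ)
    (v : V) : normalOrder ((n.factorial : ℂ)⁻¹ • fieldDeriv^[n] a) b m v =
      nthProd a (-1 - n) b m v := by
  rw [normalOrder, nthProd, sub_eq_add_neg (resL _ _ _)]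
  simp only [fieldDeriv_iterate]
  refine congrArg₂ (· + ·) ?_ ?_
  · refine finsum_congr fun i => ?_
    rw [signedChoose_neg, signedChoose_neg, add_comm i n, Nat.choose_symm_add, LinearMap.smul_apply,
      show (-1 - i - n : ℤ) = -1 - n - i by ring]
  · obtain ⟨M, hM⟩ := ha v
    have hK' : ∀ i : ℕ, M.toNat ≤ i → a i v = 0 := fun i hi => hM i (by lia)
    set K := M.toNat with hK
    -- The i-th mode of the divided derivative carries C(i, n), which is zero for i < n. Splitting
    -- off these n terms leaves i = n + j, matched with the j-th term of the residue.
    rw [resR_eq_sum (K := K) fun l hl k => by simp [hM l (by lia)], finsum_eq_sum_of_support_subset (s := Finset.range (n + K)),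
      Finset.sum_range_add, Finset.sum_eq_zero, zero_add, ← Finset.sum_neg_distrib]
    · refine Finset.sum_congr rfl fun j _ => ?_
      rw [signedChoose_natCast, signedChoose_neg, LinearMap.smul_apply, map_smul, ← neg_smul,
        Nat.choose_symm_add]
      congr 1
      · rw [show (-1 - n : ℤ) = -(n + 1 : ℕ) by push_cast; ring, zpow_neg, zpow_natCast, pow_succ]
        rcases neg_one_pow_eq_or ℂ n with h | h <;> rw [h] <;> norm_num
      · congr 2 <;> push_cast <;> ring_nf
    · intro i hi
      rw [Finset.mem_range] at hi
      rw [signedChoose_natCast, Nat.choose_eq_zero_of_lt hi]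
      simp
    · intro i hi
      by_contra h
      refine hi ?_
      simp only [Finset.coe_range, Set.mem_Iio, not_lt] at h
      have := hK' (i - n) (by lia)
      rw [Nat.cast_sub (by lia)] at this
      change b _ _ = 0
      rw [LinearMap.smul_apply, this]
      simp

end Fields

/-! ### The reconstruction theorem -/

section Reconstruction
variable {V : Type*} [AddCommGroup V] [Module ℂ V] {ι : Type*}

/-- The hypotheses of the reconstruction theorem for vertex algebras. -/
structure IsGenerating (u : ι → ℤ → Module.End ℂ V) (one : V) (D : Module.End ℂ V) : Prop where
  isVertexField : ∀ i, IsVertexField (u i)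
  local' : ∀ i j, MutuallyLocal (u i) (u j)
  covariant : ∀ i, IsCovariant D (u i)
  D_one : D one = 0
  creation : ∀ i, ∀ n ≥ 0, u i n one = 0
  generate : ∀ S : Submodule ℂ V, one ∈ S → (∀ i n, ∀ v ∈ S, u i n v ∈ S) → S = ⊤

/-- `A(z)` is a field for the state `a`. -/
structure IsStateField (u : ι → ℤ → Module.End ℂ V) (one : V) (D : Module.End ℂ V) (a : V)
    (A : ℤ → Module.End ℂ V) : Prop where
  isVertexField : IsVertexField A
  local' : ∀ i, MutuallyLocal (u i) A
  covariant : IsCovariant D A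
  creation : ∀ n ≥ 0, A n one = 0
  state : A (-1) one = a

variable {u : ι → ℤ → Module.End ℂ V} {one : V} {D : Module.End ℂ V} {a b : V}
  {A B : ℤ → Module.End ℂ V}

theorem IsStateField.add (hA : IsStateField u one D a A) (hB : IsStateField u one D b B) :
    IsStateField u one D (a + b) (A + B) where
  isVertexField := hA.isVertexField.add hB.isVertexField
  local' i := (hA.local' i).add_right (hB.local' i)
  covariant := hA.covariant.add hB.covariant
  creation n hn := by simp [hA.creation n hn, hB.creation n hn]
  state := by simp [hA.state, hB.state]

theorem IsStateField.smul (s : ℂ) (hA : IsStateField u one D a A) :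
    IsStateField u one D (s • a) (s • A) where
  isVertexField := hA.isVertexField.smul s
  local' i := (hA.local' i).smul_right s
  covariant := hA.covariant.smul s
  creation n hn := by simp [hA.creation n hn]
  state := by simp [hA.state]

theorem isStateField_one : IsStateField u one D one idField where
  isVertexField := isVertexField_idField
  local' _ := mutuallyLocal_idField
  covariant := isCovariant_idField
  creation n hn := by rw [idField, if_neg (by lia)]; rfl
  state := by simp [idField]

theorem IsCovariant.apply (hA : IsCovariant D A) (n : ℤ) (v : V) :
    D (A n v) = A n (D v) + (-n : ℂ) • A (n - 1) v := by
  have := LinearMap.congr_fun (hA n) v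
  simp only [LinearMap.sub_apply, Module.End.mul_apply, _root_.fieldDeriv,
    LinearMap.smul_apply] at this
  rw [← this]; abel

theorem IsStateField.deriv (hu : IsGenerating u one D) (hA : IsStateField u one D a A) :
    IsStateField u one D (D a) (fieldDeriv A) where
  isVertexField := hA.isVertexField.fieldDeriv
  local' i := (hA.local' i).fieldDeriv_right
  covariant := hA.covariant.fieldDeriv
  creation n hn := by
    rcases hn.lt_or_eq with h | rfl
    · simp [fieldDeriv, hA.creation (n - 1) (by lia)]
    · simp [fieldDeriv]
  state := by
    rw [← hA.state, hA.covariant.apply, hu.D_one, map_zero, zero_add]; rfl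

/-- Closure of state fields under all products with generators: Dong's lemma gives locality, and
`nthProd_state` identifies the state. -/
theorem IsStateField.product (hu : IsGenerating u one D) (hA : IsStateField u one D a A) (i : ι)
    (n : ℤ) : IsStateField u one D (u i n a)
      (nthProdField (hu.isVertexField i) n hA.isVertexField) where
  isVertexField := isVertexField_nthProdField _ _ _
  local' j := (MutuallyLocal.nthProdField _ _ (hA.local' i) (hu.local' i j) (hA.local' j).symm n).symm
  covariant := IsCovariant.nthProdField _ _ _ (hu.covariant i) hA.covariant
  creation _ hm := nthProd_creation (hu.creation i) hA.creation n hm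
  state := by
    rw [nthProdField_apply, nthProd_state (hu.creation i) hA.creation, hA.state]

/-- A state determines its field. -/
theorem IsStateField.unique (hu : IsGenerating u one D) (hA : IsStateField u one D a A)
    (hB : IsStateField u one D a B) : A = B := by
  have hC := hA.add (hB.smul (-1))
  set C := A + (-1 : ℂ) • B with hCdef
  have h0 : C (-1) one = 0 := by rw [hC.state, neg_one_smul, add_neg_cancel]
  -- Since D kills the vacuum, covariance reads 0 = (n + 1) C_(-2-n) 1 once C_(-1-n) 1 = 0, so all
  -- negative modes vanish on the vacuum.
  have h1 : ∀ n : ℕ, C (-1 - n) one = 0 := by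
    intro n
    induction n with
    | zero => simpa using h0
    | succ n ih =>
      have := hC.covariant.apply (-1 - n) one
      rw [ih, hu.D_one, map_zero, map_zero, zero_add] at this
      have hn : (-((-1 - n : ℤ) : ℂ)) ≠ 0 := by
        have : ((n + 1 : ℕ) : ℂ) ≠ 0 := by exact_mod_cast Nat.succ_ne_zero n
        intro h
        apply this
        rw [← h]; push_cast; ring
      have := (smul_eq_zero.1 this.symm).resolve_left hn
      rw [← this]
      congr 2
      push_cast; ring
  have h2 : ∀ n, C n one = 0 := by
    intro n
    rcases le_or_gt 0 n with h | h
    · exact hC.creation n h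
    · have := h1 (-1 - n).toNat
      rwa [show (-1 - ((-1 - n).toNat : ℤ)) = n by lia] at this
  -- If every C_n kills v, locality reduces to (z - w)^r C(w) u_i(z) v = 0. As u_i(z)v is bounded in
  -- z, C(w) u_i(z) v = 0; so the common kernel is stable under the generators.
  have h3 := hu.generate (⨅ n, LinearMap.ker (C n)) (by simpa using h2) (by
    intro i m v hv
    simp only [Submodule.mem_iInf, LinearMap.mem_ker] at hv ⊢
    obtain ⟨r, hr⟩ := hC.local' i
    have := mulSub_pow_map_eq_zero (-LinearMap.applyₗ v : Module.End ℂ V →ₗ[ℂ] V) hr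
    have e : (fun m n => (-LinearMap.applyₗ v : Module.End ℂ V →ₗ[ℂ] V) (u i m * C n - C n * u i m))
        = fun m n => C n (u i m v) := by
      ext m n
      simp [hv]
    rw [e] at this
    exact fun n => congrFun₂ (((hu.isVertexField i).bddL C v).eq_zero_of_mulSub_pow this) m n)
  ext n v
  have h4 : v ∈ ⨅ n, LinearMap.ker (C n) := by rw [h3]; trivial
  simp only [Submodule.mem_iInf, LinearMap.mem_ker] at h4
  have := h4 n
  rw [hCdef] at this
  simpa [add_neg_eq_zero] using this

/-- The states having a field form a subspace that contains the vacuum and is stable under the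
generators. Together with uniqueness this makes the choice of a field linear in the state. -/
theorem IsGenerating.exists_stateField (hu : IsGenerating u one D) (a : V) :
    ∃ A, IsStateField u one D a A := by
  let S : Submodule ℂ V :=
    { carrier := {a | ∃ A, IsStateField u one D a A}
      add_mem' := fun ⟨_, hA⟩ ⟨_, hB⟩ => ⟨_, hA.add hB⟩
      zero_mem' := by
        have h : IsStateField u one D _ _ := isStateField_one.smul 0
        rw [zero_smul, zero_smul] at h
        exact ⟨_, h⟩
      smul_mem' := fun s _ ⟨_, hA⟩ => ⟨_, hA.smul s⟩ }
  have := hu.generate S ⟨_, isStateField_one⟩ fun i n v ⟨_, hA⟩ => ⟨_, hA.product hu i n⟩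
  exact (this ▸ Submodule.mem_top : a ∈ S)

/-- The state-field correspondence. -/
def IsGenerating.stateField (hu : IsGenerating u one D) : V →ₗ[ℂ] (ℤ → Module.End ℂ V) where
  toFun a := (hu.exists_stateField a).choose
  map_add' a b := (hu.exists_stateField (a + b)).choose_spec.unique hu
    ((hu.exists_stateField a).choose_spec.add (hu.exists_stateField b).choose_spec)
  map_smul' s a := (hu.exists_stateField (s • a)).choose_spec.unique hu
    ((hu.exists_stateField a).choose_spec.smul s)

theorem IsGenerating.isStateField (hu : IsGenerating u one D) (a : V) :
    IsStateField u one D a (hu.stateField a) := (hu.exists_stateField a).choose_spec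

/-- Being a state field only includes locality with the generators. For fixed b, the states whose
field is local to that of b again form a stable subspace, by Dong's lemma. -/
theorem IsGenerating.mutuallyLocal (hu : IsGenerating u one D) (a b : V) :
    MutuallyLocal (hu.stateField a) (hu.stateField b) := by
  let S : Submodule ℂ V :=
    { carrier := {a | MutuallyLocal (hu.stateField b) (hu.stateField a)}
      add_mem' := fun h h' => by
        simp only [Set.mem_ofPred_eq, map_add] at *
        exact h.add_right h'
      zero_mem' := by
        have := (mutuallyLocal_idField (a := hu.stateField b)).smul_right 0
        simpa using this
      smul_mem' := fun s _ h => by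
        simp only [Set.mem_ofPred_eq, map_smul] at *
        exact h.smul_right s }
  have hS := hu.generate S
    (by
      change MutuallyLocal _ _
      rw [(hu.isStateField one).unique hu isStateField_one]
      exact mutuallyLocal_idField)
    (fun i n v hv => by
      change MutuallyLocal _ _
      rw [(hu.isStateField (u i n v)).unique hu ((hu.isStateField v).product hu i n)]
      exact (MutuallyLocal.nthProdField _ _ ((hu.isStateField v).local' i)
        ((hu.isStateField b).local' i) (MutuallyLocal.symm hv) n).symm)
  have : a ∈ S := by rw [hS]; trivial
  exact MutuallyLocal.symm this

/-- The reconstruction theorem. -/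
def IsGenerating.vertexAlgebra (hu : IsGenerating u one D) : VertexAlgebra V where
  vacuum := one
  D := D
  Y := hu.stateField
  truncation a b := (hu.isStateField a).isVertexField b
  commutator_D a n := by
    rw [(hu.isStateField (D a)).unique hu ((hu.isStateField a).deriv hu)]
    exact (hu.isStateField a).covariant n
  Y_D a := (hu.isStateField (D a)).unique hu ((hu.isStateField a).deriv hu)
  Y_vacuum n := by rw [(hu.isStateField one).unique hu isStateField_one]; rfl
  creation a n hn := (hu.isStateField a).creation n hn
  creation_zero a := (hu.isStateField a).state
  locality a b := (hu.mutuallyLocal a b).eventually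

/-- Uniqueness identifies the field of u_i(n) a for every integer n, negative or not. Negative n
gives the normally ordered products of the enveloping vertex algebra. -/
theorem IsGenerating.Y_mode (hu : IsGenerating u one D) (i : ι) (n : ℤ) (a : V) (m : ℤ) (b : V) :
    hu.vertexAlgebra.Y (u i n a) m b = nthProd (u i) n (hu.vertexAlgebra.Y a) m b := by
  have := (hu.isStateField (u i n a)).unique hu ((hu.isStateField a).product hu i n)
  exact LinearMap.congr_fun (congrFun this m) b

theorem IsGenerating.Y_generator (hu : IsGenerating u one D) (i : ι) :
    hu.vertexAlgebra.Y (u i (-1) one) = u i :=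
  (hu.isStateField _).unique hu
    { isVertexField := hu.isVertexField i
      local' := fun j => hu.local' j i
      covariant := hu.covariant i
      creation := hu.creation i
      state := rfl }

/-- A linear map that intertwines generating fields is a homomorphism of vertex algebras. -/
theorem IsGenerating.isHom {W : Type*} [AddCommGroup W] [Module ℂ W] {u' : ι → ℤ → Module.End ℂ W}
    {one' : W} {D' : Module.End ℂ W} (hu : IsGenerating u one D) (hu' : IsGenerating u' one' D')
    (f : V →ₗ[ℂ] W) (hone : f one = one') (hD : ∀ v, f (D v) = D' (f v))
    (hf : ∀ i n v, f (u i n v) = u' i n (f v)) :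
    hu.vertexAlgebra.IsHom hu'.vertexAlgebra f where
  map_vacuum := hone
  map_D := hD
  map_Y a := by
    -- The states a for which f intertwines Y(a, z) form a subspace stable under the generators,
    -- since the residues defining the products are finite sums and commute with f.
    let S : Submodule ℂ V :=
      { carrier := {a | ∀ n b, f (hu.vertexAlgebra.Y a n b) = hu'.vertexAlgebra.Y (f a) n (f b)}
        add_mem' := fun h h' n b => by simp [h n b, h' n b]
        zero_mem' := fun n b => by simp
        smul_mem' := fun s _ h n b => by simp [h n b] }
    have hS := hu.generate S
      (fun n b => by
        have h1 : hu'.vertexAlgebra.Y one' n = _ := hu'.vertexAlgebra.Y_vacuum n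
        have h2 : hu.vertexAlgebra.Y one n = _ := hu.vertexAlgebra.Y_vacuum n
        rw [hone, h1, h2]
        split_ifs <;> simp)
      (fun i n a ha m b => by
        rw [hu.Y_mode, hf, hu'.Y_mode, nthProd, nthProd, map_sub,
          ← resL_map f (IsVertexField.bddR (b := hu.vertexAlgebra.Y a) (hu.isStateField a).isVertexField _ _),
          ← resR_map f ((hu.isVertexField i).bddL (hu.vertexAlgebra.Y a) b)]
        have ha' : ∀ n b, f (hu.vertexAlgebra.Y a n b) = hu'.vertexAlgebra.Y (f a) n (f b) := ha
        simp only [hf, ha'])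
    have : a ∈ S := by rw [hS]; trivial
    exact this

end Reconstruction

/-! ### Families of vector-valued polynomials -/

section PolyFamily
variable {S : Type*} {E F G : Type*} [AddCommGroup E] [Module ℂ E] [AddCommGroup F] [Module ℂ F]
  [AddCommGroup G] [Module ℂ G]

/-- The r-th finite difference annihilates polynomials of degree less than r. -/
theorem alternating_sum_pow_eq_zero {j r : ℕ} (h : j < r) :
    ∑ i ∈ Finset.range (r + 1), ((-1 : ℂ) ^ i * (r.choose i : ℂ)) * (i : ℂ) ^ j = 0 := by
  have h1 := congrFun (fwdDiff_iter_pow_eq_zero_of_lt (R := ℂ) h) 0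
  rw [fwdDiff_iter_eq_sum_shift] at h1
  have h2 := congrArg (fun x => (-1 : ℂ) ^ r * x) h1
  simp only [Pi.zero_apply, mul_zero, Finset.mul_sum] at h2
  rw [← h2]
  refine Finset.sum_congr rfl fun i hi => ?_
  have hi' : i ≤ r := by simpa [Nat.lt_succ_iff] using hi
  have h3 : (-1 : ℂ) ^ r = (-1) ^ i * (-1) ^ (r - i) := by rw [← pow_add]; congr 1; lia
  have h4 : (-1 : ℂ) ^ (r - i) * (-1) ^ (r - i) = 1 := by
    rw [← mul_pow]; norm_num
  rw [h3, zsmul_eq_mul]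
  push_cast
  simp only [nsmul_eq_mul, mul_one, zero_add]
  linear_combination (-(-1) ^ i * (r.choose i : ℂ) * (i : ℂ) ^ j) * h4

/-- The `E`-valued polynomial functions on `ℤ` of degree at most `d`. -/
def polyFun (E : Type*) [AddCommGroup E] [Module ℂ E] (d : ℕ) : Submodule ℂ (ℤ → E) :=
  Submodule.span ℂ {f | ∃ (j : ℕ) (w : E), j ≤ d ∧ f = fun i : ℤ => (i : ℂ) ^ j • w}

theorem polyFun_mono {d d' : ℕ} (h : d ≤ d') : polyFun E d ≤ polyFun E d' :=
  Submodule.span_mono fun _ ⟨j, w, hj, hf⟩ => ⟨j, w, hj.trans h, hf⟩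

theorem polyFun_map₂ (β : E →ₗ[ℂ] F →ₗ[ℂ] G) {d d' : ℕ} {f : ℤ → E} {g : ℤ → F}
    (hf : f ∈ polyFun E d) (hg : g ∈ polyFun F d') :
    (fun i => β (f i) (g i)) ∈ polyFun G (d + d') := by
  induction hf, hg using Submodule.span_induction₂ with
  | mem_mem x y hx hy =>
    obtain ⟨j, w, hj, rfl⟩ := hx
    obtain ⟨j', w', hj', rfl⟩ := hy
    refine Submodule.subset_span ⟨j + j', β w w', by lia, ?_⟩
    ext i
    simp [pow_add, smul_smul, mul_comm]
  | zero_left y hy => simp only [Pi.zero_apply, map_zero, LinearMap.zero_apply]; exact Submodule.zero_mem _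
  | zero_right x hx => simp only [Pi.zero_apply, map_zero]; exact Submodule.zero_mem _
  | add_left x y z _ _ _ h h' =>
    simp only [Pi.add_apply, map_add, LinearMap.add_apply]; exact add_mem h h'
  | add_right x y z _ _ _ h h' =>
    simp only [Pi.add_apply, map_add]; exact add_mem h h'
  | smul_left s x y _ _ h =>
    simp only [Pi.smul_apply, map_smul, LinearMap.smul_apply]; exact Submodule.smul_mem _ s h
  | smul_right s x y _ _ h =>
    simp only [Pi.smul_apply, map_smul]; exact Submodule.smul_mem _ s h

theorem polyFun_map (φ : E →ₗ[ℂ] F) {d : ℕ} {f : ℤ → E} (hf : f ∈ polyFun E d) :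
    (fun i => φ (f i)) ∈ polyFun F d := by
  induction hf using Submodule.span_induction with
  | mem x hx =>
    obtain ⟨j, w, hj, rfl⟩ := hx
    exact Submodule.subset_span ⟨j, φ w, hj, by ext i; simp⟩
  | zero => simp only [Pi.zero_apply, map_zero]; exact Submodule.zero_mem _
  | add x y _ _ h h' => simp only [Pi.add_apply, map_add]; exact add_mem h h'
  | smul s x _ h => simp only [Pi.smul_apply, map_smul]; exact Submodule.smul_mem _ s h

theorem polyFun_alternating_sum {d r : ℕ} (h : d < r) {f : ℤ → E} (hf : f ∈ polyFun E d) :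
    ∑ i ∈ Finset.range (r + 1), ((-1 : ℂ) ^ i * (r.choose i : ℂ)) • f i = 0 := by
  induction hf using Submodule.span_induction with
  | mem x hx =>
    obtain ⟨j, w, hj, rfl⟩ := hx
    have := alternating_sum_pow_eq_zero (j := j) (r := r) (by lia)
    simp only [smul_smul, Int.cast_natCast]
    rw [← Finset.sum_smul, this, zero_smul]
  | zero => simp
  | add x y _ _ h h' => simp [smul_add, Finset.sum_add_distrib, h, h']
  | smul s x _ h =>
    simp only [Pi.smul_apply, smul_comm _ s]
    rw [← Finset.smul_sum, h, smul_zero]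

/-- A family of `E`-valued polynomial functions of bounded degree. -/
def IsPolyFamily (f : S → ℤ → E) : Prop := ∃ d, ∀ s, f s ∈ polyFun E d

namespace IsPolyFamily
variable {f g : S → ℤ → E}

theorem const (w : S → E) : IsPolyFamily fun s (_ : ℤ) => w s :=
  ⟨0, fun s => Submodule.subset_span ⟨0, w s, le_rfl, by ext; simp⟩⟩

theorem linear (w : S → E) : IsPolyFamily fun s (i : ℤ) => (i : ℂ) • w s :=
  ⟨1, fun s => Submodule.subset_span ⟨1, w s, le_rfl, by ext; simp⟩⟩

theorem add (hf : IsPolyFamily f) (hg : IsPolyFamily g) :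
    IsPolyFamily fun s i => f s i + g s i := by
  obtain ⟨d, hd⟩ := hf
  obtain ⟨d', hd'⟩ := hg
  exact ⟨max d d', fun s => add_mem (polyFun_mono (le_max_left _ _) (hd s))
    (polyFun_mono (le_max_right _ _) (hd' s))⟩

theorem map₂ (β : E →ₗ[ℂ] F →ₗ[ℂ] G) {h : S → ℤ → F} (hf : IsPolyFamily f)
    (hh : IsPolyFamily h) : IsPolyFamily fun s i => β (f s i) (h s i) := by
  obtain ⟨d, hd⟩ := hf
  obtain ⟨d', hd'⟩ := hh
  exact ⟨d + d', fun s => polyFun_map₂ β (hd s) (hd' s)⟩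

/-- The map may depend on the parameter s though not on the variable i. For brackets of moments this
is the embedding at the total exponent, which varies with s alone. -/
theorem map (φ : S → E →ₗ[ℂ] F) (hf : IsPolyFamily f) : IsPolyFamily fun s i => φ s (f s i) := by
  obtain ⟨d, hd⟩ := hf
  exact ⟨d, fun s => polyFun_map (φ s) (hd s)⟩

theorem neg (hf : IsPolyFamily f) : IsPolyFamily fun s i => -f s i :=
  hf.map fun _ => -LinearMap.id

theorem sub (hf : IsPolyFamily f) (hg : IsPolyFamily g) :
    IsPolyFamily fun s i => f s i - g s i := by
  simpa only [sub_eq_add_neg] using hf.add hg.neg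

theorem smul {a : S → ℤ → ℂ} (ha : IsPolyFamily a) (hf : IsPolyFamily f) :
    IsPolyFamily fun s i => a s i • f s i := ha.map₂ (LinearMap.lsmul ℂ E) hf

theorem mul {a b : S → ℤ → ℂ} (ha : IsPolyFamily a) (hb : IsPolyFamily b) :
    IsPolyFamily fun s i => a s i * b s i := ha.map₂ (LinearMap.lsmul ℂ ℂ) hb

theorem dotProduct {n : ℕ} {a b : S → ℤ → Fin n → ℂ} (ha : IsPolyFamily a) (hb : IsPolyFamily b) :
    IsPolyFamily fun s i => a s i ⬝ᵥ b s i := ha.map₂ (dotProductBilin ℂ ℂ) hb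

theorem prodMk {h : S → ℤ → F} (hf : IsPolyFamily f) (hh : IsPolyFamily h) :
    IsPolyFamily fun s i => (f s i, h s i) := by
  have := (hf.map fun _ => LinearMap.inl ℂ E F).add (hh.map fun _ => LinearMap.inr ℂ E F)
  simpa using this

end IsPolyFamily

end PolyFamily

namespace Toroidal
variable {N : ℕ} {L : Type*} [LieRing L] [LieAlgebra ℂ L] {B : InvForm L} {μ ν : ℂ}

/-! ### Moments -/

/-- The exponents of the moments. -/
def momentExp : GenField N L → ℤ × (Fin N → ℤ)
  | .k0 r => (1, r)
  | .k r _ => (0, r)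
  | .g r _ => (0, r)
  | .d r _ => (0, r)
  | .d0 r => (-1, r)

variable (μ ν) in
/-- The constant coefficients of the moments. -/
def momentConst : GenField N L → TorCoeff N L
  | .k0 _ => (0, Pi.single 0 1, 0)
  | .k _ p => (0, Pi.single p.succ 1, 0)
  | .g _ x => (x, 0, 0)
  | .d r p => (0, 0, Pi.single p.succ 1) - (ν * r p) • (0, Pi.single 0 1, 0)
  | .d0 _ => -(0, 0, Pi.single 0 1) - ((μ + ν) / 2) • (0, Pi.single 0 1, 0)

variable (μ ν) in
/-- The linear coefficients of the moments. -/
def momentLin : GenField N L → TorCoeff N L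
  | .d0 _ => (μ + ν) • (0, Pi.single 0 1, 0)
  | _ => 0

theorem moment_eq_mono' (u : GenField N L) (n : ℤ) : (moment u n : Toroidal N B μ ν) =
    mono (Fin.cons (n + (momentExp u).1) (momentExp u).2)
      (momentConst μ ν u + (n : ℂ) • momentLin μ ν u) := by
  cases u with
  | k0 r => simp [moment, momentExp, momentConst, momentLin, tk]
  | k r p => simp [moment, momentExp, momentConst, momentLin, tk]
  | g r x => simp [moment, momentExp, momentConst, momentLin, tg]
  | d r p =>
    simp only [moment, momentExp, momentConst, momentLin, td, tk, smul_zero, add_zero, map_sub,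
      map_smul]
  | d0 r =>
    simp only [moment, momentExp, momentConst, momentLin, td, tk, map_sub, map_add,
      map_smul, map_neg, ← sub_eq_add_neg]
    push_cast
    module

theorem isPolyFamily_torBracketCoeff {S : Type*} {r m : S → ℤ → Fin (N + 1) → ℤ}
    {x y : S → ℤ → TorCoeff N L} (hr : IsPolyFamily fun s i => cvec (r s i))
    (hm : IsPolyFamily fun s i => cvec (m s i)) (hx : IsPolyFamily x) (hy : IsPolyFamily y) :
    IsPolyFamily fun s i => torBracketCoeff B μ ν (r s i) (m s i) (x s i) (y s i) := by
  have x1 : IsPolyFamily fun s i => (x s i).1 := hx.map fun _ => LinearMap.fst ℂ _ _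
  have x23 : IsPolyFamily fun s i => (x s i).2 := hx.map fun _ => LinearMap.snd ℂ L _
  have x2 : IsPolyFamily fun s i => (x s i).2.1 :=
    x23.map fun _ => LinearMap.fst ℂ (Fin (N + 1) → ℂ) (Fin (N + 1) → ℂ)
  have x3 : IsPolyFamily fun s i => (x s i).2.2 :=
    x23.map fun _ => LinearMap.snd ℂ (Fin (N + 1) → ℂ) (Fin (N + 1) → ℂ)
  have y1 : IsPolyFamily fun s i => (y s i).1 := hy.map fun _ => LinearMap.fst ℂ _ _
  have y23 : IsPolyFamily fun s i => (y s i).2 := hy.map fun _ => LinearMap.snd ℂ L _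
  have y2 : IsPolyFamily fun s i => (y s i).2.1 :=
    y23.map fun _ => LinearMap.fst ℂ (Fin (N + 1) → ℂ) (Fin (N + 1) → ℂ)
  have y3 : IsPolyFamily fun s i => (y s i).2.2 :=
    y23.map fun _ => LinearMap.snd ℂ (Fin (N + 1) → ℂ) (Fin (N + 1) → ℂ)
  have hl : IsPolyFamily fun s i => ⁅(x s i).1, (y s i).1⁆ :=
    x1.map₂ (LieModule.toEnd ℂ L L : L →ₗ[ℂ] Module.End ℂ L) y1
  have hB : IsPolyFamily fun s i => B.form (x s i).1 (y s i).1 := x1.map₂ B.form y1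
  have cst (z : ℂ) : IsPolyFamily fun (_ : S) (_ : ℤ) => z := IsPolyFamily.const fun _ => z
  have d1 := x3.dotProduct hm
  have d2 := y3.dotProduct hr
  have d3 := x3.dotProduct hr
  have d4 := y3.dotProduct hm
  exact ((hl.add (d1.smul y1)).sub (d2.smul x1)).prodMk
    (((((hB.smul hr).add ((d1.smul y2).add ((x3.dotProduct y2).smul hr))).sub
      ((d2.smul x2).add ((y3.dotProduct x2).smul hm))).add
      ((((cst μ).mul (d1.mul d2)).add ((cst ν).mul (d3.mul d4))).smul hm)).prodMk
      ((d1.smul y3).sub (d2.smul x3)))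

/-- The generating fields of `𝔤` are mutually local. -/
theorem exists_mulSub_pow_lie_moment (u v : GenField N L) : ∃ r : ℕ, (mulSub ^ r)
    (fun m n => ⁅(moment u m : Toroidal N B μ ν), (moment v n : Toroidal N B μ ν)⁆) = 0 := by
  have hcons : ∀ (a b : ℤ) (q : Fin N → ℤ), cvec (Fin.cons (a + b) q : Fin (N + 1) → ℤ) =
      cvec (Fin.cons a q : Fin (N + 1) → ℤ) + (b : ℂ) • (Pi.single 0 1 : Fin (N + 1) → ℂ) := by
    intro a b q
    ext i
    refine Fin.cases ?_ (fun j => ?_) i <;> simp [cvec]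
  -- Along an antidiagonal the total exponent is fixed, and the bracket coefficient is built from
  -- the exponents and coefficients by multilinear operations, hence is polynomial in i. Its degree
  -- is bounded independently of s, so one power of z - w works for all coefficients.
  have key : IsPolyFamily fun (s : ℤ × ℤ) (i : ℤ) =>
      ⁅(moment u (s.1 - i) : Toroidal N B μ ν), (moment v (s.2 + i) : Toroidal N B μ ν)⁆ := by
    simp only [moment_eq_mono', lie_mono]
    have hsum : ∀ (s : ℤ × ℤ) (i : ℤ), (Fin.cons (s.1 - i + (momentExp u).1) (momentExp u).2 +
        Fin.cons (s.2 + i + (momentExp v).1) (momentExp v).2 : Fin (N + 1) → ℤ) =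
        Fin.cons (s.1 + s.2 + (momentExp u).1 + (momentExp v).1)
          ((momentExp u).2 + (momentExp v).2) := by
      intro s i
      ext j
      refine Fin.cases ?_ (fun j => ?_) j
      · simp only [Pi.add_apply, Fin.cons_zero]; ring
      · simp
    simp only [hsum]
    refine IsPolyFamily.map (fun s : ℤ × ℤ => (mono (Fin.cons (s.1 + s.2 + (momentExp u).1 +
      (momentExp v).1) ((momentExp u).2 + (momentExp v).2)) :
        TorCoeff N L →ₗ[ℂ] Toroidal N B μ ν)) (isPolyFamily_torBracketCoeff ?_ ?_ ?_ ?_)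
    · have := (IsPolyFamily.const (S := ℤ × ℤ) fun s => cvec (Fin.cons (s.1 + (momentExp u).1)
        (momentExp u).2 : Fin (N + 1) → ℤ)).add (IsPolyFamily.linear (S := ℤ × ℤ) fun _ =>
          -(Pi.single 0 1 : Fin (N + 1) → ℂ))
      convert this using 3 with s i
      rw [show s.1 - i + (momentExp u).1 = s.1 + (momentExp u).1 + -i by ring, hcons]
      simp
    · have := (IsPolyFamily.const (S := ℤ × ℤ) fun s => cvec (Fin.cons (s.2 + (momentExp v).1)
        (momentExp v).2 : Fin (N + 1) → ℤ)).add (IsPolyFamily.linear (S := ℤ × ℤ) fun _ =>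
          (Pi.single 0 1 : Fin (N + 1) → ℂ))
      convert this using 3 with s i
      rw [show s.2 + i + (momentExp v).1 = s.2 + (momentExp v).1 + i by ring, hcons]
    · have := (IsPolyFamily.const (S := ℤ × ℤ) fun s =>
        momentConst μ ν u + (s.1 : ℂ) • momentLin μ ν u).sub (IsPolyFamily.linear (S := ℤ × ℤ) fun _ =>
          momentLin μ ν u)
      convert this using 3 with s i
      push_cast
      module
    · have := (IsPolyFamily.const (S := ℤ × ℤ) fun s =>
        momentConst μ ν v + (s.2 : ℂ) • momentLin μ ν v).add (IsPolyFamily.linear (S := ℤ × ℤ) fun _ =>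
          momentLin μ ν v)
      convert this using 3 with s i
      push_cast
      module
  obtain ⟨d, hd⟩ := key
  refine ⟨d + 1, ?_⟩
  ext1 m; ext1 n
  rw [mulSub_pow_apply]
  exact polyFun_alternating_sum (Nat.lt_succ_self d) (hd (m + (d + 1 : ℕ), n))

/-- The moments span `𝔤`. -/
theorem span_moment : Submodule.span ℂ
    (Set.range fun x : GenField N L × ℤ => (moment x.1 x.2 : Toroidal N B μ ν)) = ⊤ := by
  set S := Submodule.span ℂ
    (Set.range fun x : GenField N L × ℤ => (moment x.1 x.2 : Toroidal N B μ ν))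
  have hmem : ∀ (u : GenField N L) (n : ℤ), (moment u n : Toroidal N B μ ν) ∈ S :=
    fun u n => Submodule.subset_span ⟨(u, n), rfl⟩
  have hk : ∀ j q a, (tk (Fin.cons j q) a : Toroidal N B μ ν) ∈ S := by
    intro j q a
    refine Fin.cases ?_ (fun p => ?_) a
    · simpa [moment] using hmem (.k0 q) (j - 1)
    · simpa [moment] using hmem (.k q p) j
  rw [eq_top_iff]
  rintro x -
  obtain ⟨x, rfl⟩ := proj_surjective x
  induction x using Finsupp.induction_linear with
  | zero => rw [map_zero]; exact Submodule.zero_mem _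
  | add x y hx hy => rw [map_add]; exact add_mem hx hy
  | single r x =>
    change mono r x ∈ S
    obtain ⟨j, q, rfl⟩ : ∃ j q, r = Fin.cons j q := ⟨r 0, Fin.tail r, (Fin.cons_self_tail r).symm⟩
    rw [mono_eq_sum]
    refine add_mem (add_mem (hmem (.g q x.1) j)
      (Submodule.sum_mem _ fun a _ => Submodule.smul_mem _ _ (hk j q a)))
      (Submodule.sum_mem _ fun a _ => Submodule.smul_mem _ _ ?_)
    refine Fin.cases ?_ (fun p => ?_) a
    · have h1 := hmem (.d0 q) (j + 1)
      simp only [moment, add_sub_cancel_right] at h1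
      have := sub_mem (Submodule.smul_mem _ ((μ + ν) * ((j : ℂ) + 1 / 2)) (hk j q 0)) h1
      convert this using 1
      abel
    · have h1 := hmem (.d q p) j
      simp only [moment] at h1
      have := add_mem h1 (Submodule.smul_mem _ (ν * q p) (hk j q 0))
      convert this using 1
      abel

/-! ### Translation as an inner derivation of 𝔤 -/

/-- The element of `𝔤` that acts as the translation operator, `-t_0^(-1) d_0`. -/
def translation : Toroidal N B μ ν := -td (Fin.cons (-1) 0) 0

/-- Modulo the exact form d(t_0^(n-1) t^r), the exponent (n, r) can be replaced by (n, r) - (n - 1,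
r), the unit vector in direction 0. -/
theorem sum_shifted_tk (n : ℤ) (r : Fin N → ℤ) :
    ∑ p, (((Fin.cons n r : Fin (N + 1) → ℤ) p : ℤ) : ℂ) •
      (tk (Fin.cons (-1) 0 + Fin.cons n r) p : Toroidal N B μ ν) =
      tk (Fin.cons (-1) 0 + Fin.cons n r) 0 := by
  have h := sum_tk_eq_zero (B := B) (μ := μ) (ν := ν) (Fin.cons (-1) 0 + Fin.cons n r : Fin (N + 1) → ℤ)
  rw [Fin.sum_univ_succ] at h ⊢
  simp only [Pi.add_apply, Fin.cons_zero, Fin.cons_succ, Pi.zero_apply, zero_add] at h ⊢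
  have h' := eq_neg_of_add_eq_zero_right h
  rw [h']
  push_cast
  module

theorem shift_cons (n : ℤ) (r : Fin N → ℤ) :
    (Fin.cons (-1) 0 + Fin.cons n r : Fin (N + 1) → ℤ) = Fin.cons (n - 1) r := by
  ext j
  refine Fin.cases ?_ (fun j => ?_) j
  · simp; ring
  · simp

theorem lie_translation_tk_zero (n : ℤ) (r : Fin N → ℤ) :
    ⁅(translation : Toroidal N B μ ν), (tk (Fin.cons n r) 0 : Toroidal N B μ ν)⁆ =
      (-((n : ℂ) - 1)) • tk (Fin.cons (n - 1) r) 0 := by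
  rw [translation, neg_lie, lie_td_tk, if_pos rfl, shift_cons, Fin.sum_univ_succ]
  simp
  module

theorem lie_translation_tk_succ (n : ℤ) (r : Fin N → ℤ) (p : Fin N) :
    ⁅(translation : Toroidal N B μ ν), (tk (Fin.cons n r) p.succ : Toroidal N B μ ν)⁆ =
      (-(n : ℂ)) • tk (Fin.cons (n - 1) r) p.succ := by
  rw [translation, neg_lie, lie_td_tk, if_neg (Fin.succ_ne_zero p).symm, shift_cons]
  simp

theorem lie_translation_tg (n : ℤ) (r : Fin N → ℤ) (x : L) :
    ⁅(translation : Toroidal N B μ ν), (tg (Fin.cons n r) x : Toroidal N B μ ν)⁆ =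
      (-(n : ℂ)) • tg (Fin.cons (n - 1) r) x := by
  rw [translation, neg_lie, lie_td_tg, shift_cons]
  simp

theorem lie_translation_td (n : ℤ) (r : Fin N → ℤ) (a : Fin (N + 1)) :
    ⁅(translation : Toroidal N B μ ν), (td (Fin.cons n r) a : Toroidal N B μ ν)⁆ =
      -((n : ℂ) • td (Fin.cons (n - 1) r) a
        - (((Fin.cons (-1) 0 : Fin (N + 1) → ℤ) a : ℤ) : ℂ) • td (Fin.cons (n - 1) r) 0
        + (μ * (n * ((Fin.cons (-1) 0 : Fin (N + 1) → ℤ) a : ℤ)) -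
          ν * ((Fin.cons n r : Fin (N + 1) → ℤ) a : ℤ)) • tk (Fin.cons (n - 1) r) 0) := by
  rw [translation, neg_lie, lie_td_td, sum_shifted_tk, shift_cons]
  simp
  module

/-- The corrections by k_0 in d̃_p and d̃_0 are what makes this true: they absorb the cocycle terms
that appear in the bracket of t_0^(-1) d_0 with the uncorrected d_p and d_0. -/
theorem lie_translation_moment (u : GenField N L) (n : ℤ) :
    ⁅(translation : Toroidal N B μ ν), (moment u n : Toroidal N B μ ν)⁆ =
      (-n : ℂ) • moment u (n - 1) := by
  cases u with
  | k0 r =>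
    simp only [moment, lie_translation_tk_zero]
    rw [show n + 1 - 1 = n - 1 + 1 by ring]; push_cast; congr 1; ring
  | k r p => simp only [moment, lie_translation_tk_succ]
  | g r x => simp only [moment, lie_translation_tg]
  | d r p =>
    simp only [moment, lie_sub, lie_smul, lie_translation_tk_zero, lie_translation_td,
      Fin.cons_succ, Pi.zero_apply]
    push_cast
    module
  | d0 r =>
    simp only [moment, lie_add, lie_neg, lie_smul, lie_translation_tk_zero, lie_translation_td,
      Fin.cons_zero]
    push_cast
    module

/-- The k_0-term of this moment is t_0^(-1) k_0, which is exact. So translation belongs to 𝔤^(+) and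
kills every vacuum vector. -/
theorem moment_d0_zero : (moment (.d0 0) 0 : Toroidal N B μ ν) = translation := by
  have h := sum_shifted_tk (B := B) (μ := μ) (ν := ν) (N := N) 0 0
  have h0 : ∀ p, (Fin.cons 0 0 : Fin (N + 1) → ℤ) p = 0 := fun p => by
    refine Fin.cases ?_ (fun j => ?_) p <;> simp
  simp only [h0, Int.cast_zero, zero_smul, Finset.sum_const_zero, shift_cons] at h
  rw [moment, ← h, smul_zero, add_zero, translation, zero_sub]

end Toroidal

/-! ### Induced modules: generation and the universal property -/

namespace IndModule
section
attribute [local instance 100] LieRing.ofAssociativeRing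
variable {𝔤 : Type*} [LieRing 𝔤] [LieAlgebra ℂ 𝔤] (p : LieSubalgebra ℂ 𝔤)
  {T : Type*} [AddCommGroup T] [Module ℂ T] [LieRingModule p T]

/-- By the universal property, a subalgebra K containing the image of 𝔤 receives a map from the
enveloping algebra whose composite with the inclusion is the identity. -/
theorem _root_.UniversalEnvelopingAlgebra.mem_of_ι_mem
    (K : Subalgebra ℂ (UniversalEnvelopingAlgebra ℂ 𝔤))
    (hK : ∀ x, UniversalEnvelopingAlgebra.ι ℂ x ∈ K) (u : UniversalEnvelopingAlgebra ℂ 𝔤) :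
    u ∈ K := by
  let f : 𝔤 →ₗ⁅ℂ⁆ K :=
    { toFun := fun x => ⟨UniversalEnvelopingAlgebra.ι ℂ x, hK x⟩
      map_add' := fun x y => Subtype.ext ((UniversalEnvelopingAlgebra.ι ℂ).map_add x y)
      map_smul' := fun s x => Subtype.ext ((UniversalEnvelopingAlgebra.ι ℂ).map_smul s x)
      map_lie' := fun {x y} => Subtype.ext ((UniversalEnvelopingAlgebra.ι ℂ).map_lie x y) }
  have h : K.val.comp (UniversalEnvelopingAlgebra.lift ℂ f) = AlgHom.id ℂ _ := by
    refine UniversalEnvelopingAlgebra.hom_ext (R := ℂ) (L := 𝔤)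
      (A := UniversalEnvelopingAlgebra ℂ 𝔤) ?_
    ext x
    simp [f]
  have := AlgHom.congr_fun h u
  simp only [AlgHom.comp_apply, AlgHom.id_apply] at this
  rw [← this]
  exact Subtype.property _

variable (T) in
/-- The map `t ↦ 1 ⊗ t`. -/
def ofₗ : T →ₗ[ℂ] IndModule p T where
  toFun := of p
  map_add' s t := by
    rw [of, TensorProduct.tmul_add, map_add]; rfl
  map_smul' s t := by
    rw [of, TensorProduct.tmul_smul]; rfl

theorem ofₗ_apply (t : T) : ofₗ p T t = of p t := rfl

/-- The induced module is generated by the inducing module. -/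
theorem eq_top_of_stable (S : Submodule ℂ (IndModule p T)) (h : ∀ t, of p t ∈ S)
    (hS : ∀ x : 𝔤, ∀ v ∈ S, ⁅x, v⁆ ∈ S) : S = ⊤ := by
  let K : Subalgebra ℂ (UniversalEnvelopingAlgebra ℂ 𝔤) :=
    { carrier := {u | ∀ s ∈ S, u • s ∈ S}
      mul_mem' := fun {a b} ha hb s hs => by rw [mul_smul]; exact ha _ (hb _ hs)
      one_mem' := fun s hs => by rwa [one_smul]
      add_mem' := fun {a b} ha hb s hs => by rw [add_smul]; exact add_mem (ha _ hs) (hb _ hs)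
      zero_mem' := fun s _ => by rw [zero_smul]; exact Submodule.zero_mem _
      algebraMap_mem' := fun c s hs => by rw [algebraMap_smul]; exact Submodule.smul_mem _ _ hs }
  have hK : ∀ u, u ∈ K := UniversalEnvelopingAlgebra.mem_of_ι_mem K fun x s hs => hS x s hs
  rw [eq_top_iff]
  rintro v -
  obtain ⟨w, rfl⟩ := (indRelations p T).mkQ_surjective v
  induction w using TensorProduct.induction_on with
  | zero => rw [map_zero]; exact Submodule.zero_mem S
  | add x y hx hy => rw [map_add]; exact S.add_mem hx hy
  | tmul u t =>
    have : (indRelations p T).mkQ (u ⊗ₜ[ℂ] t) = u • of p t := by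
      rw [of]
      change _ = (indRelations p T).mkQ (u • (1 ⊗ₜ[ℂ] t))
      rw [TensorProduct.smul_tmul', smul_eq_mul, mul_one]
    rw [this]
    exact hK u _ (h t)

variable {p}
variable {M : Type*} [AddCommGroup M] [Module ℂ M] [LieRingModule 𝔤 M] [LieModule ℂ 𝔤 M]

variable (M) in
/-- The action of `U(𝔤)` on a `𝔤`-module. -/
def envAction : UniversalEnvelopingAlgebra ℂ 𝔤 →ₐ[ℂ] Module.End ℂ M :=
  UniversalEnvelopingAlgebra.lift ℂ (LieModule.toEnd ℂ 𝔤 M)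

theorem envAction_ι (x : 𝔤) (v : M) :
    envAction M (UniversalEnvelopingAlgebra.ι ℂ x) v = ⁅x, v⁆ := by
  rw [envAction, UniversalEnvelopingAlgebra.lift_ι_apply]; rfl

/-- The map `u ⊗ t ↦ u f(t)`. -/
def liftTensor (f : T →ₗ[ℂ] M) : UniversalEnvelopingAlgebra ℂ 𝔤 ⊗[ℂ] T →ₗ[ℂ] M :=
  TensorProduct.lift (((LinearMap.lcomp ℂ M f) ∘ₗ (envAction M).toLinearMap))

theorem liftTensor_tmul (f : T →ₗ[ℂ] M) (u : UniversalEnvelopingAlgebra ℂ 𝔤) (t : T) :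
    liftTensor f (u ⊗ₜ t) = envAction M u (f t) := rfl

theorem liftTensor_smul (f : T →ₗ[ℂ] M) (u : UniversalEnvelopingAlgebra ℂ 𝔤)
    (w : UniversalEnvelopingAlgebra ℂ 𝔤 ⊗[ℂ] T) :
    liftTensor f (u • w) = envAction M u (liftTensor f w) := by
  induction w using TensorProduct.induction_on with
  | zero => simp
  | add x y hx hy => rw [smul_add, map_add, hx, hy, map_add, map_add]
  | tmul v t =>
    rw [TensorProduct.smul_tmul', liftTensor_tmul, liftTensor_tmul, smul_eq_mul, map_mul]; rfl

theorem liftTensor_relations (f : T →ₗ[ℂ] M) (hf : ∀ (x : p) t, f ⁅x, t⁆ = ⁅(x : 𝔤), f t⁆)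
    {w : UniversalEnvelopingAlgebra ℂ 𝔤 ⊗[ℂ] T} (hw : w ∈ indRelations p T) :
    liftTensor f w = 0 := by
  induction hw using Submodule.span_induction with
  | zero => simp
  | add x y _ _ hx hy => rw [map_add, hx, hy, add_zero]
  | smul u x _ hx => rw [liftTensor_smul, hx, map_zero]
  | mem w hw =>
    obtain ⟨x, t, rfl⟩ := hw
    rw [map_sub, liftTensor_tmul, liftTensor_tmul, envAction_ι, map_one, hf]
    exact sub_self _

/-- The universal property of the induced module. -/
def lift (f : T →ₗ[ℂ] M) (hf : ∀ (x : p) t, f ⁅x, t⁆ = ⁅(x : 𝔤), f t⁆) :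
    IndModule p T →ₗ⁅ℂ, 𝔤⁆ M :=
  let F : IndModule p T →ₗ[ℂ] M :=
    (((indRelations p T).restrictScalars ℂ).liftQ (liftTensor f)
      (fun _ hw => liftTensor_relations f hf hw)) ∘ₗ
      (Submodule.Quotient.restrictScalarsEquiv ℂ (indRelations p T)).symm.toLinearMap
  { F with
    map_lie' := fun {x v} => by
      obtain ⟨w, rfl⟩ := (indRelations p T).mkQ_surjective v
      change liftTensor f (UniversalEnvelopingAlgebra.ι ℂ x • w) = ⁅x, liftTensor f w⁆
      rw [liftTensor_smul, envAction_ι] }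

theorem lift_of (f : T →ₗ[ℂ] M) (hf : ∀ (x : p) t, f ⁅x, t⁆ = ⁅(x : 𝔤), f t⁆) (t : T) :
    lift f hf (of p t) = f t := by
  change liftTensor f (1 ⊗ₜ t) = f t
  rw [liftTensor_tmul, map_one]; rfl

/-- Homomorphisms out of an induced module are determined by their values on the inducing
module. -/
theorem hom_ext {F G : IndModule p T →ₗ⁅ℂ, 𝔤⁆ M} (h : ∀ t, F (of p t) = G (of p t)) : F = G := by
  have := eq_top_of_stable p (LinearMap.eqLocus (F : IndModule p T →ₗ[ℂ] M) G) h
    (fun x v hv => by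
      change F _ = G _
      rw [LieModuleHom.map_lie, LieModuleHom.map_lie]
      exact congrArg _ hv)
  ext v
  have hv : v ∈ LinearMap.eqLocus (F : IndModule p T →ₗ[ℂ] M) G := by rw [this]; trivial
  exact hv

end
end IndModule

/-! ### Vertex algebras from cyclic modules -/

section Vacuum
variable {N : ℕ} {L : Type*} [LieRing L] [LieAlgebra ℂ L] {B : InvForm L} {μ ν : ℂ}
variable {Q : Type*} [AddCommGroup Q] [Module ℂ Q] [LieRingModule (Toroidal N B μ ν) Q]
  [LieModule ℂ (Toroidal N B μ ν) Q]

open Toroidal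

variable (N B μ ν) in
/-- A cyclic vector of a `𝔤`-module that is killed by `𝔤^(+)`. -/
structure IsVacuumVector (v : Q) : Prop where
  lie_eq_zero : ∀ x ∈ plus B μ ν (N := N), ⁅x, v⁆ = 0
  generate : ∀ S : Submodule ℂ Q, v ∈ S →
    (∀ x : Toroidal N B μ ν, ∀ w ∈ S, ⁅x, w⁆ ∈ S) → S = ⊤

namespace Toroidal

theorem mono_induction {P : Toroidal N B μ ν → Prop} (h0 : P 0)
    (hadd : ∀ x y, P x → P y → P (x + y)) (hmono : ∀ r x, P (mono r x)) (x : Toroidal N B μ ν) :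
    P x := by
  obtain ⟨x, rfl⟩ := proj_surjective x
  induction x using Finsupp.induction_linear with
  | zero => rwa [map_zero]
  | add x y hx hy => rw [map_add]; exact hadd _ _ hx hy
  | single r x => exact hmono r x

theorem moment_mem_plus (u : GenField N L) {n : ℤ} (hn : 0 ≤ n) :
    (moment u n : Toroidal N B μ ν) ∈ plus B μ ν (N := N) :=
  Submodule.subset_span ⟨u, n, hn, rfl⟩

theorem mono_mem_plus_of_pos {r : Fin (N + 1) → ℤ} (hr : 1 ≤ r 0) (x : TorCoeff N L) :
    (mono r x : Toroidal N B μ ν) ∈ plus B μ ν (N := N) :=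
  mono_mem_plus (Or.inl hr)

end Toroidal

theorem genField_apply (u : GenField N L) (n : ℤ) (v : Q) :
    genField N B μ ν Q u n v = ⁅(moment u n : Toroidal N B μ ν), v⁆ := rfl

/-- Elements of high degree kill a given vector. -/
theorem IsVacuumVector.exists_degree_bound {v : Q} (hv : IsVacuumVector N B μ ν v) (w : Q) :
    ∃ J : ℤ, ∀ r : Fin (N + 1) → ℤ, J ≤ r 0 → ∀ x, ⁅(mono r x : Toroidal N B μ ν), w⁆ = 0 := by
  let S : Submodule ℂ Q :=
    { carrier := {w | ∃ J : ℤ, ∀ r : Fin (N + 1) → ℤ, J ≤ r 0 → ∀ x,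
        ⁅(mono r x : Toroidal N B μ ν), w⁆ = 0}
      add_mem' := by
        rintro a b ⟨J, hJ⟩ ⟨J', hJ'⟩
        exact ⟨max J J', fun r hr x => by
          rw [lie_add, hJ r (by lia), hJ' r (by lia), add_zero]⟩
      zero_mem' := ⟨0, fun r _ x => lie_zero _⟩
      smul_mem' := by
        rintro s a ⟨J, hJ⟩
        exact ⟨J, fun r hr x => by rw [lie_smul, hJ r hr, smul_zero]⟩ }
  have hS := hv.generate S ⟨1, fun r hr x => hv.lie_eq_zero _ (mono_mem_plus_of_pos hr x)⟩
    (fun y w hw => by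
      induction y using mono_induction with
      | h0 => rw [zero_lie]; exact Submodule.zero_mem _
      | hadd y y' h h' => rw [add_lie]; exact add_mem h h'
      | hmono m y =>
        obtain ⟨J, hJ⟩ := hw
        -- Brackets with t^m y shift the degree by m_0, so the bound has to be at least J both
        -- before and after this shift.
        refine ⟨max J (J - m 0), fun r hr x => ?_⟩
        rw [leibniz_lie, lie_mono, hJ r (by lia), lie_zero, add_zero]
        exact hJ _ (by rw [Pi.add_apply]; lia) _)
  have : w ∈ S := by rw [hS]; trivial
  exact this

/-- The input of the reconstruction theorem, with translation acting through an element of 𝔤;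
homomorphisms of 𝔤-modules therefore commute with D automatically. -/
theorem IsVacuumVector.isGenerating {v : Q} (hv : IsVacuumVector N B μ ν v) :
    IsGenerating (genField N B μ ν Q) v
      (LieModule.toEnd ℂ (Toroidal N B μ ν) Q Toroidal.translation) where
  isVertexField u w := by
    obtain ⟨J, hJ⟩ := hv.exists_degree_bound w
    refine ⟨J - (momentExp u).1, fun n hn => ?_⟩
    rw [genField_apply, moment_eq_mono']
    exact hJ _ (by rw [Fin.cons_zero]; lia) _
  local' u u' := by
    obtain ⟨r, hr⟩ := exists_mulSub_pow_lie_moment (B := B) (μ := μ) (ν := ν) u u'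
    refine ⟨r, ?_⟩
    have := mulSub_pow_map_eq_zero
      (LieModule.toEnd ℂ (Toroidal N B μ ν) Q : Toroidal N B μ ν →ₗ[ℂ] Module.End ℂ Q) hr
    convert this using 2
    ext m n w
    simp [genField_apply]
  covariant u n := by
    ext w
    have := lie_translation_moment (B := B) (μ := μ) (ν := ν) u n
    simp only [LinearMap.sub_apply, Module.End.mul_apply, LieModule.toEnd_apply_apply,
      genField_apply, fieldDeriv, LinearMap.smul_apply]
    rw [← smul_lie, ← this, lie_lie]
  D_one := by
    rw [LieModule.toEnd_apply_apply, ← moment_d0_zero]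
    exact hv.lie_eq_zero _ (moment_mem_plus _ le_rfl)
  creation u n hn := hv.lie_eq_zero _ (moment_mem_plus _ hn)
  generate S hS h := by
    refine hv.generate S hS fun x w hw => ?_
    have hx : x ∈ Submodule.span ℂ
      (Set.range fun x : GenField N L × ℤ => (moment x.1 x.2 : Toroidal N B μ ν)) := by
        rw [span_moment]; trivial
    induction hx using Submodule.span_induction with
    | mem x hx => obtain ⟨⟨u, n⟩, rfl⟩ := hx; exact h u n w hw
    | zero => rw [zero_lie]; exact Submodule.zero_mem _
    | add x y _ _ hx hy => rw [add_lie]; exact add_mem hx hy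
    | smul s x _ hx => rw [smul_lie]; exact Submodule.smul_mem _ _ hx

theorem IsVacuumVector.map {Q' : Type*} [AddCommGroup Q'] [Module ℂ Q']
    [LieRingModule (Toroidal N B μ ν) Q'] [LieModule ℂ (Toroidal N B μ ν) Q'] {v : Q}
    (hv : IsVacuumVector N B μ ν v) (f : Q →ₗ⁅ℂ, Toroidal N B μ ν⁆ Q')
    (hf : Function.Surjective f) : IsVacuumVector N B μ ν (f v) where
  lie_eq_zero x hx := by rw [← LieModuleHom.map_lie, hv.lie_eq_zero x hx, map_zero]
  generate S hS h := by
    have := hv.generate (S.comap (f : Q →ₗ[ℂ] Q')) hS fun x w hw => by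
      change f _ ∈ S
      rw [LieModuleHom.map_lie]; exact h x _ hw
    rw [eq_top_iff]
    rintro w -
    obtain ⟨w, rfl⟩ := hf w
    have hw : w ∈ S.comap (f : Q →ₗ[ℂ] Q') := by rw [this]; trivial
    exact hw

theorem isVacuumVector_one : IsVacuumVector N B μ ν (Vg.one N B μ ν) where
  lie_eq_zero x hx := by
    have := IndModule.lie_of (plus B μ ν (N := N)) (⟨x, hx⟩ : plus B μ ν (N := N))
      ((TrivialLieModule.equiv ℂ (plus B μ ν (N := N)) ℂ).symm 1)
    rw [LieModule.IsTrivial.trivial (⟨x, hx⟩ : plus B μ ν (N := N))] at this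
    exact this.trans (map_zero (IndModule.ofₗ _ _))
  generate S hS h := by
    refine IndModule.eq_top_of_stable _ S (fun t => ?_) h
    obtain ⟨s, rfl⟩ := (TrivialLieModule.equiv ℂ (plus B μ ν (N := N)) ℂ).symm.surjective t
    have : (TrivialLieModule.equiv ℂ (plus B μ ν (N := N)) ℂ).symm s =
        s • (TrivialLieModule.equiv ℂ (plus B μ ν (N := N)) ℂ).symm 1 := by
      rw [← map_smul, smul_eq_mul, mul_one]
    rw [this, ← IndModule.ofₗ_apply, map_smul]
    exact Submodule.smul_mem _ _ hS

/-- The universal enveloping vertex algebra. -/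
theorem isEnveloping_vertexAlgebra :
    IsEnveloping (isVacuumVector_one (B := B) (μ := μ) (ν := ν) (N := N)).isGenerating.vertexAlgebra where
  vacuum_eq := rfl
  D_one := isVacuumVector_one.isGenerating.D_one
  D_lie u n v := by
    have := (isVacuumVector_one (B := B) (μ := μ) (ν := ν) (N := N)).isGenerating.covariant u
    rw [add_comm]
    exact this.apply n v
  Y_one := isVacuumVector_one.isGenerating.vertexAlgebra.Y_vacuum
  Y_lie u n a m b := by
    rw [normalOrder_eq_nthProd (isVacuumVector_one.isGenerating.isVertexField u)]
    exact isVacuumVector_one.isGenerating.Y_mode u (-1 - n) a m b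

end Vacuum

/-! ### The inducing module embeds into the induced module -/

namespace IndModule
section
attribute [local instance 100] LieRing.ofAssociativeRing
variable {𝔤 : Type*} [LieRing 𝔤] [LieAlgebra ℂ 𝔤]

/-- Sum of `F` over the words obtained from a word by replacing one letter `a` by `[a, b]`. -/
def wordDeriv {X : Type*} [AddCommGroup X] (b : 𝔤) : (List 𝔤 → X) → List 𝔤 → X
  | _, [] => 0
  | F, a :: A => F (⁅a, b⁆ :: A) + wordDeriv b (fun A' => F (a :: A')) A

section
variable {X : Type*} [AddCommGroup X] [Module ℂ X]

theorem wordDeriv_cons (b : 𝔤) (F : List 𝔤 → X) (a : 𝔤) (A : List 𝔤) :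
    wordDeriv b F (a :: A) = F (⁅a, b⁆ :: A) + wordDeriv b (fun A' => F (a :: A')) A := rfl

theorem wordDeriv_congr (b : 𝔤) {F G : List 𝔤 → X} {A : List 𝔤}
    (h : ∀ A' : List 𝔤, A'.length = A.length → F A' = G A') :
    wordDeriv b F A = wordDeriv b G A := by
  induction A generalizing F G with
  | nil => rfl
  | cons a A ih =>
    rw [wordDeriv, wordDeriv, h _ (by simp), ih fun A' hA' => h _ (by simp [hA'])]

theorem wordDeriv_add (b : 𝔤) (F G : List 𝔤 → X) (A : List 𝔤) :
    wordDeriv b (fun A => F A + G A) A = wordDeriv b F A + wordDeriv b G A := by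
  induction A generalizing F G with
  | nil => simp [wordDeriv]
  | cons a A ih => rw [wordDeriv, wordDeriv, wordDeriv, ih]; abel

theorem wordDeriv_map {Y : Type*} [AddCommGroup Y] (φ : X →+ Y) (b : 𝔤)
    (F : List 𝔤 → X) (A : List 𝔤) :
    wordDeriv b (fun A => φ (F A)) A = φ (wordDeriv b F A) := by
  induction A generalizing F with
  | nil => simp [wordDeriv]
  | cons a A ih => rw [wordDeriv, wordDeriv, ih, map_add]

theorem wordDeriv_smul_add (b : 𝔤) (s : ℂ) (F G : List 𝔤 → X) (A : List 𝔤) :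
    wordDeriv b (fun A => s • F A + G A) A = s • wordDeriv b F A + wordDeriv b G A := by
  rw [wordDeriv_add]
  congr 1
  exact wordDeriv_map (DistribSMul.toAddMonoidHom X s) b F A

theorem wordDeriv_append (b : 𝔤) (F : List 𝔤 → X) (A C : List 𝔤) :
    wordDeriv b F (A ++ C) =
      wordDeriv b (fun A' => F (A' ++ C)) A + wordDeriv b (fun C' => F (A ++ C')) C := by
  induction A generalizing F with
  | nil => simp [wordDeriv]
  | cons a A ih => rw [List.cons_append, wordDeriv, wordDeriv, ih, add_assoc]; rfl

/-- Linearity in each letter, on words of length `n`. -/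
def IsMultilinearAt (n : ℕ) (F : List 𝔤 → X) : Prop :=
  ∀ (A C : List 𝔤) (x y : 𝔤) (s : ℂ), A.length + C.length + 1 = n →
    F (A ++ (s • x + y) :: C) = s • F (A ++ x :: C) + F (A ++ y :: C)

theorem IsMultilinearAt.cons {n : ℕ} {F : List 𝔤 → X} (h : IsMultilinearAt (n + 1) F) (a : 𝔤) :
    IsMultilinearAt n fun A => F (a :: A) :=
  fun A C x y s hn => h (a :: A) C x y s (by simp only [List.length_cons]; lia)

theorem wordDeriv_smul_add_left (s : ℂ) (b b' : 𝔤) {F : List 𝔤 → X} {A : List 𝔤}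
    (h : IsMultilinearAt A.length F) :
    wordDeriv (s • b + b') F A = s • wordDeriv b F A + wordDeriv b' F A := by
  induction A generalizing F with
  | nil => simp [wordDeriv]
  | cons a A ih =>
    have h1 := h [] A ⁅a, b⁆ ⁅a, b'⁆ s (by simp)
    simp only [List.nil_append] at h1
    rw [wordDeriv, wordDeriv, wordDeriv, ih (h.cons a), lie_add, lie_smul, h1, smul_add]
    abel

/-- The commutator of two derivations of words. -/
theorem wordDeriv_comm (b c : 𝔤) {F : List 𝔤 → X} (h : ∀ n, IsMultilinearAt n F) (A : List 𝔤) :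
    wordDeriv b (wordDeriv c F) A - wordDeriv c (wordDeriv b F) A = wordDeriv ⁅b, c⁆ F A := by
  induction A generalizing F with
  | nil => simp [wordDeriv]
  | cons a A ih =>
    have h1 := h _ [] A (⁅⁅a, c⁆, b⁆) ⁅a, ⁅b, c⁆⁆ 1 rfl
    simp only [one_smul, List.nil_append] at h1
    have e : ⁅⁅a, c⁆, b⁆ + ⁅a, ⁅b, c⁆⁆ = ⁅⁅a, b⁆, c⁆ := by
      rw [leibniz_lie a b c, ← lie_skew b ⁅a, c⁆]
      abel
    rw [e] at h1
    simp only [wordDeriv]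
    rw [wordDeriv_add, wordDeriv_add, ← ih fun n => (h (n + 1)).cons a, h1]
    abel

end

/-! ### Reduction of words in the enveloping algebra -/

variable {T : Type*} [AddCommGroup T] [Module ℂ T]
  (q : 𝔤 →ₗ[ℂ] 𝔤) (ρ : 𝔤 →ₗ[ℂ] Module.End ℂ T)

/-- Auxiliary recursion for `wordValue`. -/
def wordValueAux : ℕ → List 𝔤 → Module.End ℂ T
  | 0, _ => 1
  | _ + 1, [] => 1
  | k + 1, y :: A => wordValueAux k A * ρ y + wordDeriv (q y) (wordValueAux k) A

/-- The action on the inducing module of the projection of `x_k ⋯ x_1`, for the word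
`x_1, …, x_k`, to the enveloping algebra of the kernel of `q` along the range of `q`. -/
def wordValue (A : List 𝔤) : Module.End ℂ T := wordValueAux q ρ A.length A

/-- The first letter y of a word is the rightmost factor. Its component in the kernel of q acts
through ρ. Its component q y is moved to the left of the product, where the projection kills it, at
the cost of the commutators with all other letters, which form the derivation. -/
theorem wordValue_cons (y : 𝔤) (A : List 𝔤) : wordValue q ρ (y :: A) =
    wordValue q ρ A * ρ y + wordDeriv (q y) (wordValue q ρ) A := by
  rw [wordValue, List.length_cons, wordValueAux]
  congr 1
  exact wordDeriv_congr _ fun A' hA' => by rw [wordValue, hA']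

/-- The recursion only evaluates on words one letter shorter, since the derivation preserves length.
This is why linearity is recorded length by length. -/
theorem isMultilinearAt_wordValue (n : ℕ) : IsMultilinearAt n (wordValue q ρ) := by
  induction n with
  | zero => intro A C x y s h; lia
  | succ n ih =>
    intro A C x y s h
    cases A with
    | nil =>
      have hC : IsMultilinearAt C.length (wordValue q ρ) := by
        simp only [List.length_nil, zero_add, Nat.add_right_cancel_iff] at h
        rwa [h]
      rw [List.nil_append, List.nil_append, List.nil_append, wordValue_cons, wordValue_cons,
        wordValue_cons, map_add, map_smul, map_add, map_smul, wordDeriv_smul_add_left _ _ _ hC,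
        mul_add, mul_smul_comm, smul_add]
      abel
    | cons b A =>
      simp only [List.length_cons] at h
      simp only [List.cons_append, wordValue_cons, wordDeriv_append, wordDeriv]
      rw [ih A C x y s (by lia), add_lie, smul_lie, ih A C ⁅x, q b⁆ ⁅y, q b⁆ s (by lia),
        wordDeriv_congr (G := fun A' => s • wordValue q ρ (A' ++ x :: C)
          + wordValue q ρ (A' ++ y :: C)) _ fun A' hA' => ih A' C x y s (by lia),
        wordDeriv_congr (F := fun C' => wordValue q ρ (A ++ (s • x + y) :: C'))
          (G := fun C' => s • wordValue q ρ (A ++ x :: C') + wordValue q ρ (A ++ y :: C'))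
          _ fun C' hC' => ih A C' x y s (by lia),
        wordDeriv_smul_add, wordDeriv_smul_add, add_mul, smul_mul_assoc]
      simp only [smul_add]
      abel

variable {q ρ}

/-- The value of a word respects xy - yx = [x, y] in every position, so it factors through the
enveloping algebra. This needs 𝔤 to split into two subalgebras, the kernel and the range of q, with
ρ a representation of the first that vanishes on the second. -/
theorem wordValue_comm (hq : ∀ x, q (q x) = q x) (hρ : ∀ x, ρ (q x) = 0)
    (hq₀ : ∀ x y, q x = 0 → q y = 0 → q ⁅x, y⁆ = 0 ∧ ρ ⁅x, y⁆ = ρ x * ρ y - ρ y * ρ x)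
    (hq₁ : ∀ x y, q ⁅q x, q y⁆ = ⁅q x, q y⁆) (A C : List 𝔤) (x y : 𝔤) :
    wordValue q ρ (A ++ y :: x :: C) - wordValue q ρ (A ++ x :: y :: C) =
      wordValue q ρ (A ++ ⁅x, y⁆ :: C) := by
  have hlin := isMultilinearAt_wordValue q ρ
  have hsub : ∀ (A C : List 𝔤) (x y z : 𝔤), x + y = z →
      wordValue q ρ (A ++ x :: C) + wordValue q ρ (A ++ y :: C) = wordValue q ρ (A ++ z :: C) := by
    intro A C x y z h
    have := hlin _ A C x y 1 rfl
    rw [one_smul, one_smul, h] at this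
    exact this.symm
  generalize hn : A.length = n
  induction n generalizing A C x y with
  | zero =>
      rw [List.length_eq_zero_iff] at hn
      subst hn
      simp only [List.nil_append]
      -- The components of x and y in the kernel of q have bracket in that kernel, on which ρ is
      -- multiplicative. Expanding the bracket computes q and ρ on [x, q y] + [q x, y].
      have e1 := hq₀ (x - q x) (y - q y) (by rw [map_sub, hq, sub_self])
        (by rw [map_sub, hq, sub_self])
      simp only [map_sub, hρ, sub_zero, lie_sub, sub_lie, hq₁] at e1
      have e2 := hsub [] C ⁅x, q y⁆ ⁅q x, y⁆ (⁅x, q y⁆ + ⁅q x, y⁆) rfl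
      have e3 := hsub [] C ⁅q x, y⁆ ⁅y, q x⁆ 0 (by rw [← lie_skew, neg_add_cancel])
      have e4 := hsub [] C 0 0 0 (add_zero 0)
      simp only [List.nil_append, add_eq_left] at e2 e3 e4
      rw [e4, ← eq_neg_iff_add_eq_zero] at e3
      have e5 := wordDeriv_comm (q y) (q x) hlin C
      have e6 : q (⁅x, q y⁆ + ⁅q x, y⁆) = q ⁅x, y⁆ + ⁅q x, q y⁆ := by
        rw [map_add]
        linear_combination (norm := abel) -e1.1
      have e7 : ρ (⁅x, q y⁆ + ⁅q x, y⁆) = ρ ⁅x, y⁆ - (ρ x * ρ y - ρ y * ρ x) := by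
        have : ρ ⁅q x, q y⁆ = 0 := by rw [← hq₁, hρ]
        rw [this] at e1
        rw [map_add]
        linear_combination (norm := abel) -e1.2
      have e8 : ∀ b b' : 𝔤, wordDeriv (b + b') (wordValue q ρ) C =
          wordDeriv b (wordValue q ρ) C + wordDeriv b' (wordValue q ρ) C := fun b b' => by
        have := wordDeriv_smul_add_left 1 b b' (hlin C.length)
        rwa [one_smul, one_smul] at this
      have e9 := e8 ⁅q x, q y⁆ ⁅q y, q x⁆
      have e10 := e8 0 0
      rw [add_zero, left_eq_add] at e10
      rw [show ⁅q x, q y⁆ + ⁅q y, q x⁆ = 0 by rw [← lie_skew, neg_add_cancel], e10] at e9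
      have e11 : wordDeriv (q y) (fun A' => wordValue q ρ (x :: A')) C =
          wordDeriv (q y) (wordValue q ρ) C * ρ x
            + wordDeriv (q y) (wordDeriv (q x) (wordValue q ρ)) C := by
        simp only [wordValue_cons]
        rw [wordDeriv_add]
        congr 1
        exact wordDeriv_map (AddMonoidHom.mulRight (ρ x)) _ _ _
      have e12 : wordDeriv (q x) (fun A' => wordValue q ρ (y :: A')) C =
          wordDeriv (q x) (wordValue q ρ) C * ρ y
            + wordDeriv (q x) (wordDeriv (q y) (wordValue q ρ)) C := by
        simp only [wordValue_cons]
        rw [wordDeriv_add]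
        congr 1
        exact wordDeriv_map (AddMonoidHom.mulRight (ρ y)) _ _ _
      rw [wordValue_cons q ρ (⁅x, q y⁆ + ⁅q x, y⁆), e6, e7, e8] at e2
      rw [wordValue_cons q ρ y, wordValue_cons q ρ x (y :: C), wordValue_cons q ρ ⁅x, y⁆,
        wordDeriv_cons, wordDeriv_cons, e11, e12, wordValue_cons q ρ x, wordValue_cons q ρ y]
      -- Additivity in the first letter (e2, e3), the commutator of the derivations along q y and q
      -- x (e5), and skew symmetry (e9) account for all terms.
      linear_combination (norm := noncomm_ring) e2 - e3 + e5 - e9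
  | succ n ih =>
    cases A with
    | nil => simp at hn
    | cons b A =>
      simp only [List.length_cons, Nat.add_right_cancel_iff] at hn
      -- The head b enters through ρ b and through the derivation along q b. The derivation may hit
      -- a letter of A, a letter of C, or x or y; each case is an instance of the induction
      -- hypothesis, and the cases of x and y combine by the Jacobi identity (e4).
      have e1 := ih A C x y hn
      have e2 := ih A C ⁅x, q b⁆ y hn
      have e3 := ih A C x ⁅y, q b⁆ hn
      have e4 := hsub A C ⁅⁅x, q b⁆, y⁆ ⁅x, ⁅y, q b⁆⁆ ⁅⁅x, y⁆, q b⁆ (by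
        rw [leibniz_lie x y (q b), ← lie_skew y ⁅x, q b⁆]
        abel)
      have e5 : wordDeriv (q b) (fun A' => wordValue q ρ (A' ++ y :: x :: C)) A =
          wordDeriv (q b) (fun A' => wordValue q ρ (A' ++ ⁅x, y⁆ :: C)) A
            + wordDeriv (q b) (fun A' => wordValue q ρ (A' ++ x :: y :: C)) A := by
        rw [← wordDeriv_add]
        exact wordDeriv_congr _ fun A' hA' => by rw [← ih A' C x y (hA'.trans hn), sub_add_cancel]
      have e6 : wordDeriv (q b) (fun C' => wordValue q ρ (A ++ y :: x :: C')) C =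
          wordDeriv (q b) (fun C' => wordValue q ρ (A ++ ⁅x, y⁆ :: C')) C
            + wordDeriv (q b) (fun C' => wordValue q ρ (A ++ x :: y :: C')) C := by
        rw [← wordDeriv_add]
        exact wordDeriv_congr _ fun C' hC' => by rw [← ih A C' x y hn, sub_add_cancel]
      simp only [List.cons_append, wordValue_cons, wordDeriv_append, wordDeriv_cons]
      rw [e5, e6, ← e4, ← e2, ← e3, ← e1]
      noncomm_ring

variable (𝔤 T) in
/-- The functions on words that factor through the enveloping algebra. -/
def wordModule : Submodule ℂ (List 𝔤 → T) where
  carrier := {f | (∀ n, IsMultilinearAt n f) ∧ ∀ (A C : List 𝔤) (x y : 𝔤),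
    f (A ++ y :: x :: C) - f (A ++ x :: y :: C) = f (A ++ ⁅x, y⁆ :: C)}
  add_mem' := fun {f g} hf hg => ⟨fun n A C x y s h => by
      simp only [Pi.add_apply, hf.1 n A C x y s h, hg.1 n A C x y s h, smul_add]; abel,
    fun A C x y => by
      simp only [Pi.add_apply, ← hf.2, ← hg.2]; abel⟩
  zero_mem' := ⟨fun n A C x y s _ => by simp, fun A C x y => by simp⟩
  smul_mem' := fun s f hf => ⟨fun n A C x y s' h => by
      simp only [Pi.smul_apply, hf.1 n A C x y s' h, smul_add, smul_comm s],
    fun A C x y => by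
      simp only [Pi.smul_apply, ← hf.2, smul_sub]⟩

/-- Prepending x to a word multiplies the corresponding product by x on the right, so this is the
coinduced action (x f)(u) = f(u x). -/
instance : LieRingModule 𝔤 (wordModule 𝔤 T) where
  bracket x f := ⟨fun A => f.1 (x :: A), fun n => (f.2.1 (n + 1)).cons x,
    fun A C y z => f.2.2 (x :: A) C y z⟩
  add_lie x y f := by
    ext A
    have := f.2.1 _ [] A x y 1 rfl
    simpa using this
  lie_add x f g := rfl
  leibniz_lie x y f := by
    ext A
    have := f.2.2 [] A x y
    exact sub_eq_iff_eq_add.1 this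

instance : LieModule ℂ 𝔤 (wordModule 𝔤 T) where
  smul_lie s x f := by
    ext A
    have h := f.2.1 _ [] A x 0 s rfl
    have h' := f.2.1 _ [] A 0 0 1 rfl
    simp only [smul_zero, one_smul, List.nil_append, add_zero, left_eq_add] at h h'
    rw [h', add_zero] at h
    exact h
  lie_smul s x f := rfl

/-- The map sending t to the values of words on t is p-equivariant, hence extends to the induced
module. Evaluation at the empty word recovers t. This replaces the freeness part of the PBW theorem.
-/
theorem of_injective_of_projection (p : LieSubalgebra ℂ 𝔤) [LieRingModule p T]
    (hq : ∀ x, q (q x) = q x) (hρ : ∀ x, ρ (q x) = 0)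
    (hq₀ : ∀ x y, q x = 0 → q y = 0 → q ⁅x, y⁆ = 0 ∧ ρ ⁅x, y⁆ = ρ x * ρ y - ρ y * ρ x)
    (hq₁ : ∀ x y, q ⁅q x, q y⁆ = ⁅q x, q y⁆)
    (hp : ∀ x : p, q x = 0 ∧ ∀ t, ρ x t = ⁅x, t⁆) : Function.Injective (of p (T := T)) := by
  let f : T →ₗ[ℂ] wordModule 𝔤 T :=
    { toFun := fun t => ⟨fun A => wordValue q ρ A t,
        fun n A C x y s h => LinearMap.congr_fun (isMultilinearAt_wordValue q ρ n A C x y s h) t,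
        fun A C x y => LinearMap.congr_fun (wordValue_comm hq hρ hq₀ hq₁ A C x y) t⟩
      map_add' := fun t t' => by ext A; exact map_add (wordValue q ρ A) t t'
      map_smul' := fun s t => by ext A; exact map_smul (wordValue q ρ A) s t }
  have hf : ∀ (x : p) t, f ⁅x, t⁆ = ⁅(x : 𝔤), f t⁆ := by
    intro x t
    ext A
    change wordValue q ρ A ⁅x, t⁆ = wordValue q ρ ((x : 𝔤) :: A) t
    have h0 := wordDeriv_smul_add_left 1 0 0 (isMultilinearAt_wordValue q ρ A.length)
    rw [smul_zero, add_zero, one_smul, left_eq_add] at h0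
    rw [wordValue_cons, (hp x).1, h0, add_zero, ← (hp x).2]; rfl
  intro t t' h
  have h1 := congrArg (lift f hf) h
  rw [lift_of, lift_of] at h1
  have h2 : wordValue q ρ [] t = wordValue q ρ [] t' := congrArg (fun g => g.1 []) h1
  exact h2

end
end IndModule

/-! ### Tensor modules embed into generalized Verma modules -/

namespace Toroidal
variable {N : ℕ} {L : Type*} [LieRing L] [LieAlgebra ℂ L] {B : InvForm L} {μ ν : ℂ}

variable (B μ ν) in
/-- The projection to the part of negative degree in `t_0`. -/
def negPart : Toroidal N B μ ν →ₗ[ℂ] Toroidal N B μ ν :=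
  Toroidal.lift (Finsupp.lsum ℂ fun r => if r 0 < 0 then mono r else 0) fun x hx => by
    induction hx using Submodule.span_induction with
    | zero => simp
    | add a b _ _ ha hb => rw [map_add, ha, hb, add_zero]
    | smul s a _ ha => rw [map_smul, ha, smul_zero]
    | mem a ha =>
      obtain ⟨r, rfl⟩ := ha
      rw [Finsupp.lsum_single]
      split_ifs
      · rw [← one_smul ℂ (cvec r)]
        exact mono_exact r 1
      · rfl

theorem negPart_mono (r : Fin (N + 1) → ℤ) (x : TorCoeff N L) :
    negPart B μ ν (mono r x) = if r 0 < 0 then mono r x else 0 := by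
  refine (Finsupp.lsum_single ℂ _ r x).trans ?_
  split_ifs <;> rfl

theorem negPart_negPart (x : Toroidal N B μ ν) :
    negPart B μ ν (negPart B μ ν x) = negPart B μ ν x := by
  induction x using mono_induction with
  | h0 => simp
  | hadd x y hx hy => rw [map_add, map_add, hx, hy]
  | hmono r x =>
    rw [negPart_mono]
    split_ifs with h
    · rw [negPart_mono, if_pos h]
    · rw [map_zero]

theorem mono_mem_nonneg {r : Fin (N + 1) → ℤ} (hr : 0 ≤ r 0) (x : TorCoeff N L) :
    (mono r x : Toroidal N B μ ν) ∈ nonneg B μ ν (N := N) :=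
  Submodule.subset_span ⟨r, hr, x, rfl⟩

theorem sub_negPart_mem_nonneg (x : Toroidal N B μ ν) :
    x - negPart B μ ν x ∈ nonneg B μ ν (N := N) := by
  induction x using mono_induction with
  | h0 => simp
  | hadd x y hx hy => rw [map_add, add_sub_add_comm]; exact add_mem hx hy
  | hmono r x =>
    rw [negPart_mono]
    split_ifs with h
    · rw [sub_self]; exact zero_mem _
    · rw [sub_zero]; exact mono_mem_nonneg (not_lt.1 h) x

theorem negPart_of_mem_nonneg {x : Toroidal N B μ ν} (hx : x ∈ nonneg B μ ν (N := N)) :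
    negPart B μ ν x = 0 := by
  induction hx using Submodule.span_induction with
  | zero => simp
  | add x y _ _ hx hy => rw [map_add, hx, hy, add_zero]
  | smul s x _ hx => rw [map_smul, hx, smul_zero]
  | mem x hx =>
    obtain ⟨r, hr, y, rfl⟩ := hx
    rw [negPart_mono, if_neg (not_lt.2 hr)]

theorem negPart_lie_negPart (x y : Toroidal N B μ ν) :
    negPart B μ ν ⁅negPart B μ ν x, negPart B μ ν y⁆ = ⁅negPart B μ ν x, negPart B μ ν y⁆ := by
  induction x using mono_induction with
  | h0 => simp
  | hadd x x' hx hx' => rw [map_add, add_lie, map_add, hx, hx']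
  | hmono r x =>
    induction y using mono_induction with
    | h0 => simp
    | hadd y y' hy hy' => rw [map_add, lie_add, map_add, hy, hy']
    | hmono m y =>
      rw [negPart_mono, negPart_mono]
      split_ifs with h h'
      · rw [lie_mono, negPart_mono, if_pos (by rw [Pi.add_apply]; lia)]
      all_goals simp

end Toroidal

section
attribute [local instance 100] LieRing.ofAssociativeRing
variable {N : ℕ} {L : Type*} [LieRing L] [LieAlgebra ℂ L] {B : InvForm L} {μ ν : ℂ}
  {V W : Type*} [AddCommGroup V] [Module ℂ V] [AddCommGroup W] [Module ℂ W]
  {c d : ℂ} {α : Fin N → ℂ}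
  [LieRingModule L V] [LieModule ℂ L V] [LieRingModule (Matrix (Fin N) (Fin N) ℂ) W]
  [LieModule ℂ (Matrix (Fin N) (Fin N) ℂ) W]

theorem TensorTop.act_negPart (x : Toroidal N B μ ν) :
    act B μ ν V W c d α (Toroidal.negPart B μ ν x) = 0 := by
  induction x using Toroidal.mono_induction with
  | h0 => simp
  | hadd x y hx hy => rw [map_add, map_add, hx, hy, add_zero]
  | hmono r x =>
    rw [Toroidal.negPart_mono]
    split_ifs with h
    · rw [act_mono, if_neg h.ne]
    · rw [map_zero]

/-- The elements of negative degree in t_0 form a subalgebra complementary to 𝔤₀ ⊕ 𝔤₊, and `act` was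
extended to them by zero, as the word construction requires. -/
theorem TensorTop.of_injective : Function.Injective
    (IndModule.of (Toroidal.nonneg B μ ν (N := N)) (T := TensorTop B μ ν V W c d α)) := by
  have hmem : ∀ x : Toroidal N B μ ν, Toroidal.negPart B μ ν x = 0 →
      x ∈ Toroidal.nonneg B μ ν (N := N) := fun x hx => by
    have := Toroidal.sub_negPart_mem_nonneg x
    rwa [hx, sub_zero] at this
  refine IndModule.of_injective_of_projection (q := Toroidal.negPart B μ ν)
    (ρ := act B μ ν V W c d α) _ Toroidal.negPart_negPart act_negPart ?_
    Toroidal.negPart_lie_negPart ?_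
  · intro x y hx hy
    refine ⟨Toroidal.negPart_of_mem_nonneg (LieSubalgebra.lie_mem _ (hmem x hx) (hmem y hy)), ?_⟩
    exact act_lie (hmem x hx) (hmem y hy)
  · exact fun x => ⟨Toroidal.negPart_of_mem_nonneg x.2, fun t => rfl⟩

end

/-! ### The Virasoro element -/

namespace Toroidal
variable {N : ℕ} {L : Type*} [LieRing L] [LieAlgebra ℂ L] {B : InvForm L} {μ ν : ℂ}

theorem cons_add_cons (n m : ℤ) (r s : Fin N → ℤ) :
    (Fin.cons n r + Fin.cons m s : Fin (N + 1) → ℤ) = Fin.cons (n + m) (r + s) := by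
  ext j
  refine Fin.cases ?_ (fun j => ?_) j <;> simp

theorem cons_zero_zero : (Fin.cons 0 0 : Fin (N + 1) → ℤ) = 0 := by
  ext j
  refine Fin.cases ?_ (fun j => ?_) j <;> simp

/-- The bracket of k_0 with t^r x is a multiple of d(t^r), so it is zero in the quotient. -/
theorem tk_zero_lie (x : Toroidal N B μ ν) : ⁅(tk 0 0 : Toroidal N B μ ν), x⁆ = 0 := by
  induction x using mono_induction with
  | h0 => simp
  | hadd x y hx hy => rw [lie_add, hx, hy, add_zero]
  | hmono r x =>
    have h0 : cvec (0 : Fin (N + 1) → ℤ) = 0 := by ext; simp [cvec]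
    rw [tk, lie_mono, ← mono_exact (0 + r) (-(x.2.2 0))]
    congr 1
    refine Prod.ext ?_ (Prod.ext ?_ ?_)
    · simp [torBracketCoeff, h0]
    · simp [torBracketCoeff, h0]
    · simp [torBracketCoeff, h0]

theorem smul_tk_cons_zero (n : ℤ) :
    (n : ℂ) • (tk (Fin.cons n 0) 0 : Toroidal N B μ ν) = 0 := by
  have h := sum_tk_eq_zero (B := B) (μ := μ) (ν := ν) (Fin.cons n 0 : Fin (N + 1) → ℤ)
  rw [Fin.sum_univ_succ] at h
  simpa using h

theorem tk_cons_zero {n : ℤ} (hn : n ≠ 0) : (tk (Fin.cons n 0) 0 : Toroidal N B μ ν) = 0 :=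
  (smul_eq_zero.1 (smul_tk_cons_zero n)).resolve_left (by exact_mod_cast hn)

theorem lie_td_tk_cons_zero (n m : ℤ) : ⁅(td (Fin.cons n 0) 0 : Toroidal N B μ ν),
    (tk (Fin.cons m 0) 0 : Toroidal N B μ ν)⁆ = 0 := by
  rw [lie_td_tk, if_pos rfl, Fin.sum_univ_succ, cons_add_cons, add_zero]
  simp only [Fin.cons_zero, Fin.cons_succ, Pi.zero_apply, Int.cast_zero, zero_smul,
    Finset.sum_const_zero, add_zero]
  rw [← add_smul, add_comm, ← Int.cast_add, smul_tk_cons_zero]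

/-- The Virasoro relations in `𝔤`. -/
theorem lie_moment_d0 (n m : ℤ) : ⁅(moment (.d0 0) (n + 1) : Toroidal N B μ ν),
      (moment (.d0 0) (m + 1) : Toroidal N B μ ν)⁆ =
    ((n : ℂ) - m) • moment (.d0 0) (n + m + 1)
      + if n = -m then ((μ + ν) * ((n : ℂ) ^ 3 - n)) • (tk 0 0 : Toroidal N B μ ν) else 0 := by
  have h1 : ⁅(td (Fin.cons n 0) 0 : Toroidal N B μ ν), (td (Fin.cons m 0) 0 : Toroidal N B μ ν)⁆ =
      ((m : ℂ) - n) • td (Fin.cons (n + m) 0) 0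
        + ((μ + ν) * (n * m ^ 2)) • tk (Fin.cons (n + m) 0) 0 := by
    rw [lie_td_td, Fin.sum_univ_succ, cons_add_cons, add_zero]
    simp only [Fin.cons_zero, Fin.cons_succ, Pi.zero_apply, Int.cast_zero, zero_smul,
      Finset.sum_const_zero, add_zero]
    module
  have h2 : ⁅(tk (Fin.cons n 0) 0 : Toroidal N B μ ν),
      (td (Fin.cons m 0) 0 : Toroidal N B μ ν)⁆ = 0 := by
    rw [← lie_skew, lie_td_tk_cons_zero, neg_zero]
  simp only [moment, add_sub_cancel_right, lie_add, add_lie, lie_neg, neg_lie, lie_smul, smul_lie,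
    lie_td_tk_cons_zero, h1, h2, lie_tk_tk]
  -- For n + m ≠ 0 the form t_0^(n+m) k_0 is exact and the central term disappears. For n + m = 0
  -- the half-integer shift in d̃_0 turns the cubic cocycle into n³ - n.
  split_ifs with h
  · obtain rfl : m = -n := by lia
    rw [add_neg_cancel, cons_zero_zero]
    push_cast
    module
  · rw [tk_cons_zero (n := n + m) (by lia)]
    module

/-- L(0) differs from -d_0 by a central element, so the conformal weight is minus the degree in t_0.
-/
theorem lie_moment_d0_one_mono (r : Fin (N + 1) → ℤ) (x : TorCoeff N L) :
    ⁅(moment (.d0 0) 1 : Toroidal N B μ ν), (mono r x : Toroidal N B μ ν)⁆ =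
      (-(r 0) : ℂ) • mono r x := by
  have h0 : cvec (0 : Fin (N + 1) → ℤ) = 0 := by ext; simp [cvec]
  have e : torBracketCoeff B μ ν 0 r (0, 0, Pi.single 0 1) x = (r 0 : ℂ) • x := by
    refine Prod.ext ?_ (Prod.ext ?_ ?_) <;> simp [torBracketCoeff, h0, cvec]
  simp only [moment, sub_self, cons_zero_zero, add_lie, smul_lie, tk_zero_lie, smul_zero,
    add_zero, neg_lie, td, lie_mono, zero_add, e, map_smul, neg_smul]

end Toroidal

namespace IsVacuumVector
variable {N : ℕ} {L : Type*} [LieRing L] [LieAlgebra ℂ L] {B : InvForm L} {μ ν c : ℂ}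
variable {Q : Type*} [AddCommGroup Q] [Module ℂ Q] [LieRingModule (Toroidal N B μ ν) Q]
  [LieModule ℂ (Toroidal N B μ ν) Q] {v : Q}

open Toroidal

/-- As k_0 is central, the vectors on which it acts by c form a submodule, which contains the
generator v. -/
theorem tk_zero_lie (hv : IsVacuumVector N B μ ν v)
    (hc : ⁅(tk 0 0 : Toroidal N B μ ν), v⁆ = c • v) (w : Q) :
    ⁅(tk 0 0 : Toroidal N B μ ν), w⁆ = c • w := by
  have h := hv.generate (LinearMap.eqLocus (LieModule.toEnd ℂ _ Q (tk 0 0 : Toroidal N B μ ν))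
    (c • LinearMap.id)) (by exact hc) fun x w hw => by
      have hw' : ⁅(tk 0 0 : Toroidal N B μ ν), w⁆ = c • w := hw
      change ⁅(tk 0 0 : Toroidal N B μ ν), ⁅x, w⁆⁆ = c • ⁅x, w⁆
      rw [leibniz_lie, Toroidal.tk_zero_lie, zero_lie, zero_add, hw', lie_smul]
  have hw : w ∈ LinearMap.eqLocus (LieModule.toEnd ℂ _ Q (tk 0 0 : Toroidal N B μ ν))
    (c • LinearMap.id) := by rw [h]; trivial
  exact hw

/-- The vacuum has weight zero and t^r x shifts weights by the integer -r_0. -/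
theorem iSup_eigenspace (hv : IsVacuumVector N B μ ν v) :
    ⨆ n : ℤ, Module.End.eigenspace (genField N B μ ν Q (.d0 0) 1) (n : ℂ) = ⊤ := by
  refine hv.generate _ (Submodule.mem_iSup_of_mem 0 ?_) fun x w hw => ?_
  · rw [Module.End.mem_eigenspace_iff, genField_apply, Int.cast_zero, zero_smul]
    exact hv.lie_eq_zero _ (moment_mem_plus _ zero_le_one)
  · induction x using mono_induction with
    | h0 => rw [zero_lie]; exact zero_mem _
    | hadd x y hx hy => rw [add_lie]; exact add_mem hx hy
    | hmono r x =>
      induction hw using Submodule.iSup_induction' with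
      | zero => rw [lie_zero]; exact zero_mem _
      | add w w' _ _ h h' => rw [lie_add]; exact add_mem h h'
      | mem n w hw =>
        refine Submodule.mem_iSup_of_mem (n - r 0) ?_
        rw [Module.End.mem_eigenspace_iff, genField_apply] at hw ⊢
        rw [leibniz_lie, lie_moment_d0_one_mono, hw, lie_smul, smul_lie]
        push_cast
        module

theorem Y_omega (hv : IsVacuumVector N B μ ν v) :
    hv.isGenerating.vertexAlgebra.Y ⁅(moment (.d0 0) (-1) : Toroidal N B μ ν), v⁆ =
      genField N B μ ν Q (.d0 0) :=
  hv.isGenerating.Y_generator (.d0 0)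

/-- In the Virasoro relations the central term (μ + ν)(n³ - n) k_0 acts as (μ + ν)(n³ - n) c, that
is (n³ - n)/12 times the rank 12(μ + ν)c. -/
theorem isVOA (hv : IsVacuumVector N B μ ν v)
    (hc : ⁅(tk 0 0 : Toroidal N B μ ν), v⁆ = c • v) :
    hv.isGenerating.vertexAlgebra.IsVOA ⁅(moment (.d0 0) (-1) : Toroidal N B μ ν), v⁆
      (12 * (μ + ν) * c) where
  virasoro n m := by
    ext w
    have h := congrArg (fun x : Toroidal N B μ ν => ⁅x, w⁆)
      (lie_moment_d0 (B := B) (μ := μ) (ν := ν) (N := N) n m)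
    simp only [lie_lie, add_lie, smul_lie] at h
    rw [hv.Y_omega]
    simp only [LinearMap.sub_apply, LinearMap.add_apply, LinearMap.smul_apply,
      Module.End.mul_apply, genField_apply, h]
    congr 1
    split_ifs
    · rw [smul_lie, hv.tk_zero_lie hc, LinearMap.smul_apply, Module.End.one_apply]
      module
    · simp
  D_eq := by
    rw [hv.Y_omega]
    exact congrArg (LieModule.toEnd ℂ (Toroidal N B μ ν) Q) moment_d0_zero.symm
  grading := by
    rw [hv.Y_omega]
    exact DirectSum.isInternal_submodule_of_iSupIndep_of_iSup_eq_top
      ((Module.End.eigenspaces_iSupIndep _).comp Int.cast_injective) hv.iSup_eigenspace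

end IsVacuumVector

/-! ### The top of the generalized Verma module -/

namespace TopZero
section
attribute [local instance 100] LieRing.ofAssociativeRing
variable {N : ℕ} {L : Type*} [LieRing L] [LieAlgebra ℂ L] {B : InvForm L} {μ ν c : ℂ}

open Toroidal

variable (N L) in
/-- The isomorphism of the space `V ⊗ W` for the top `T₀` with `ℂ`. -/
def coordinate (h : ℂ) : TrivialLieModule ℂ L ℂ ⊗[ℂ] GLLine N h ≃ₗ[ℂ] ℂ :=
  (TensorProduct.congr (TrivialLieModule.equiv ℂ L ℂ) (LinearEquiv.refl ℂ ℂ)).trans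
    (TensorProduct.lid ℂ ℂ)

theorem coordinate_one (h : ℂ) :
    coordinate N L h (((TrivialLieModule.equiv ℂ L ℂ).symm 1) ⊗ₜ[ℂ] GLLine.one) = 1 := by
  change (1 : ℂ) • (1 : ℂ) = 1
  simp

theorem q_eq (m : Fin N → ℤ) (u : TrivialLieModule ℂ L ℂ ⊗[ℂ] GLLine N (N * ν * c)) :
    (TensorTop.q m u : TopZero N B μ ν c) = coordinate N L _ u • TopZero.q m := by
  rw [TopZero.q, ← map_smul]
  congr 1
  apply (coordinate N L (N * ν * c)).injective
  rw [map_smul, coordinate_one, smul_eq_mul, mul_one]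

theorem span_q : Submodule.span ℂ (Set.range (TopZero.q : _ → TopZero N B μ ν c)) = ⊤ := by
  rw [eq_top_iff]
  rintro t -
  induction t using Finsupp.induction_linear with
  | zero => exact zero_mem _
  | add s t hs ht => exact add_mem hs ht
  | single m u =>
    change TensorTop.q m u ∈ _
    rw [q_eq]
    exact Submodule.smul_mem _ _ (Submodule.subset_span ⟨m, rfl⟩)

/-- The linear map with given values on the basis `q^m`. -/
def lift {M : Type*} [AddCommGroup M] [Module ℂ M] (f : (Fin N → ℤ) → M) :
    TopZero N B μ ν c →ₗ[ℂ] M :=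
  TensorTop.lift fun m => (LinearMap.toSpanSingleton ℂ M (f m)) ∘ₗ
    (coordinate N L (N * ν * c)).toLinearMap

theorem lift_q {M : Type*} [AddCommGroup M] [Module ℂ M] (f : (Fin N → ℤ) → M) (m : Fin N → ℤ) :
    lift f (TopZero.q m : TopZero N B μ ν c) = f m := by
  rw [lift, TopZero.q, TensorTop.lift_q, LinearMap.comp_apply, LinearEquiv.coe_coe,
    coordinate_one, LinearMap.toSpanSingleton_apply, one_smul]

theorem hom_ext {M : Type*} [AddCommGroup M] [Module ℂ M] {f g : TopZero N B μ ν c →ₗ[ℂ] M}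
    (h : ∀ m, f (TopZero.q m) = g (TopZero.q m)) : f = g := by
  refine TensorTop.hom_ext fun m v w => ?_
  rw [q_eq, map_smul, map_smul, h]

theorem q_ne_zero (m : Fin N → ℤ) : (TopZero.q m : TopZero N B μ ν c) ≠ 0 := fun h => by
  have := lift_q (B := B) (μ := μ) (ν := ν) (c := c) (fun _ => (1 : ℂ)) m
  rw [h, map_zero] at this
  exact zero_ne_one this

/-- The scalar through which `t^r x` acts on `q^m`. -/
def coeff (μ ν c : ℂ) (r : Fin (N + 1) → ℤ) (x : TorCoeff N L) (m : Fin N → ℤ) : ℂ :=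
  c * (x.2.1 0 + ν * (x.2.2 ⬝ᵥ cvec r) + (μ + ν) / 2 * x.2.2 0) + Fin.tail x.2.2 ⬝ᵥ cvec m

/-- The choices d = (μ + ν)c/2 and h = Nνc enter here: gl_N acts through h/N = νc times the trace of
a rank one matrix, which is δ·r. The scalar then contains c times the functional that appears in the
degree-zero case of `IsPlus`. -/
theorem act_q (hN : 1 ≤ N) (r : Fin (N + 1) → ℤ) (x : TorCoeff N L) (m : Fin N → ℤ) :
    TensorTop.act B μ ν _ _ c _ _ (mono r x) (TopZero.q m : TopZero N B μ ν c) =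
      if r 0 = 0 then coeff μ ν c r x m • TopZero.q (m + Fin.tail r) else 0 := by
  rw [TensorTop.act_mono]
  split_ifs with hr
  · have hN' : (N : ℂ) ≠ 0 := by exact_mod_cast (by lia : N ≠ 0)
    rw [TopZero.q, TensorTop.lift_q, LinearMap.comp_apply, TensorTop.actCoeff_tmul, add_zero,
      LieModule.IsTrivial.trivial, TensorProduct.zero_tmul, add_zero,
      show ⁅Matrix.vecMulVec (cvec (Fin.tail r)) (Fin.tail x.2.2), (GLLine.one : GLLine N (N * ν * c))⁆
        = (N * ν * c / N * (Matrix.vecMulVec (cvec (Fin.tail r)) (Fin.tail x.2.2)).trace) • GLLine.one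
        from rfl, Matrix.trace_vecMulVec, TensorProduct.tmul_smul, ← add_smul, map_smul]
    rw [TopZero.q, coeff, dot_cvec _ r, hr, dotProduct_comm (cvec _)]
    congr 1
    field_simp
    push_cast
    ring
  · rfl

theorem lie_of_q (hN : 1 ≤ N) {r : Fin (N + 1) → ℤ} (hr : 0 ≤ r 0) (x : TorCoeff N L)
    (m : Fin N → ℤ) : ⁅(mono r x : Toroidal N B μ ν),
      (IndModule.of _ (TopZero.q m) : GenVerma N B μ ν (TopZero N B μ ν c))⁆ =
      if r 0 = 0 then coeff μ ν c r x m • IndModule.of _ (TopZero.q (m + Fin.tail r)) else 0 := by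
  have h := IndModule.lie_of (nonneg B μ ν (N := N)) ⟨mono r x, mono_mem_nonneg hr x⟩
    (TopZero.q m : TopZero N B μ ν c)
  refine h.trans ((congrArg _ (act_q hN r x m)).trans ?_)
  split_ifs
  · exact map_smul (IndModule.ofₗ _ _) _ _
  · exact map_zero (IndModule.ofₗ _ _)

/-- `act` is zero outside degree zero by definition, so only degree zero needs an argument. For the
elements of degree -1 this says nothing about M(T₀), where `act` is not the action. -/
theorem act_q_zero_of_mem_plus (hN : 1 ≤ N) {x : Toroidal N B μ ν} (hx : x ∈ plus B μ ν (N := N)) :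
    TensorTop.act B μ ν _ _ c _ _ x (TopZero.q 0 : TopZero N B μ ν c) = 0 := by
  induction hx using Submodule.span_induction with
  | zero => simp
  | add x y _ _ hx hy => rw [map_add, LinearMap.add_apply, hx, hy, add_zero]
  | smul s x _ hx => rw [map_smul, LinearMap.smul_apply, hx, smul_zero]
  | mem x hx =>
    obtain ⟨u, n, hn, rfl⟩ := hx
    obtain ⟨r, x, hx, e⟩ := moment_eq_mono (B := B) (μ := μ) (ν := ν) u hn
    rw [e, act_q hN]
    split_ifs with hr
    · rcases hx with h | ⟨-, h⟩ | ⟨h, -⟩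
      · lia
      · have h0 : cvec (0 : Fin N → ℤ) = 0 := by ext; simp [cvec]
        rw [coeff, h, mul_zero, zero_add, h0, dotProduct_zero, zero_smul]
      · lia
    · rfl

/-- `T₀` is irreducible. -/
theorem eq_top_of_stable (hN : 1 ≤ N) (hc : c ≠ 0) (S : Submodule ℂ (TopZero N B μ ν c))
    (hS : S ≠ ⊥) (h : ∀ r x, r 0 = 0 → ∀ t ∈ S, TensorTop.act B μ ν _ _ c _ _ (mono r x) t ∈ S) :
    S = ⊤ := by
  have hd : ∀ (p : Fin N) (m : Fin N → ℤ), TensorTop.act B μ ν _ _ c _ _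
      (mono 0 (0, 0, Pi.single p.succ 1)) (TopZero.q m : TopZero N B μ ν c) =
      (m p : ℂ) • TopZero.q m := by
    intro p m
    rw [act_q hN, if_pos (Pi.zero_apply 0), coeff]
    have h0 : cvec (0 : Fin (N + 1) → ℤ) = 0 := by ext; simp [cvec]
    have h1 : Fin.tail (0 : Fin (N + 1) → ℤ) = 0 := rfl
    have h2 : Fin.tail (Pi.single p.succ 1 : Fin (N + 1) → ℂ) = Pi.single p 1 := by
      ext i; simp [Fin.tail, Pi.single_apply]
    rw [h0, h1, h2]
    simp [cvec]
  have hk : ∀ m r : Fin N → ℤ, TensorTop.act B μ ν _ _ c _ _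
      (mono (Fin.cons 0 r) (0, Pi.single 0 1, 0)) (TopZero.q m : TopZero N B μ ν c) =
      c • TopZero.q (m + r) := by
    intro m r
    rw [act_q hN, if_pos (show (Fin.cons 0 r : Fin (N + 1) → ℤ) 0 = 0 from rfl), coeff, Fin.tail_cons]
    have h1 : Fin.tail (0 : Fin (N + 1) → ℂ) = 0 := rfl
    simp [h1]
  -- The operators d_p separate monomials. For m ≠ m₀ and a p with m_p ≠ m₀_p, applying d_p - m₀_p
  -- removes the term at m₀ and multiplies the one at m by a non-zero scalar.
  have key : ∀ (s : Finset (Fin N → ℤ)) (a : (Fin N → ℤ) → ℂ),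
      ∑ m ∈ s, a m • TopZero.q m ∈ S → ∀ m ∈ s, a m • TopZero.q m ∈ S := by
    intro s
    induction s using Finset.induction_on with
    | empty => simp
    | insert m₀ s hm₀ ih =>
      intro a ha
      have h1 : ∀ m ∈ s, a m • TopZero.q m ∈ S := by
        intro m hm
        obtain ⟨p, hp⟩ : ∃ p, m p ≠ m₀ p := by
          by_contra! hne
          exact hm₀ (funext hne ▸ hm)
        have h2 := sub_mem (h 0 (0, 0, Pi.single p.succ 1) rfl _ ha)
          (Submodule.smul_mem _ (m₀ p : ℂ) ha)
        have h3 := ih (fun m => a m * (m p - m₀ p)) (by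
          convert h2 using 1
          rw [Finset.sum_insert hm₀, map_add, map_sum, smul_add, Finset.smul_sum, map_smul, hd,
            smul_comm, add_sub_add_left_eq_sub, ← Finset.sum_sub_distrib]
          refine Finset.sum_congr rfl fun m _ => ?_
          rw [map_smul, hd]
          module) m hm
        have hp' : (m p : ℂ) - m₀ p ≠ 0 := by
          rw [sub_ne_zero]; exact_mod_cast hp
        have h4 := Submodule.smul_mem _ ((m p : ℂ) - m₀ p)⁻¹ h3
        rw [smul_smul] at h4
        convert h4 using 2
        field_simp
      intro m hm
      rcases Finset.mem_insert.1 hm with rfl | hm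
      · rw [Finset.sum_insert hm₀] at ha
        exact (Submodule.add_mem_iff_left _ (Submodule.sum_mem _ h1)).1 ha
      · exact h1 m hm
  obtain ⟨t, ht, ht0⟩ := Submodule.exists_mem_ne_zero_of_ne_bot hS
  obtain ⟨a, rfl⟩ := Finsupp.mem_span_range_iff_exists_finsupp.1
    (show t ∈ Submodule.span ℂ (Set.range TopZero.q) by rw [span_q]; trivial)
  obtain ⟨m, hm, hm0⟩ := Finset.exists_ne_zero_of_sum_ne_zero ht0
  have h5 : TopZero.q m ∈ S := by
    have := key _ _ ht m hm
    rwa [Submodule.smul_mem_iff _ (left_ne_zero_of_smul hm0)] at this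
  rw [eq_top_iff, ← span_q, Submodule.span_le]
  rintro _ ⟨r, rfl⟩
  -- From one monomial q^m the elements t^(r-m) k_0, acting by c ≠ 0 times a shift, reach all
  -- others.
  have h6 := h (Fin.cons 0 (r - m)) (0, Pi.single 0 1, 0) rfl _ h5
  rw [hk, add_sub_cancel, Submodule.smul_mem_iff _ hc] at h6
  exact h6

end
end TopZero

/-! ### The maximal submodule of the generalized Verma module -/

namespace Toroidal
variable {N : ℕ} {L : Type*} [LieRing L] [LieAlgebra ℂ L] {B : InvForm L} {μ ν c : ℂ}
variable {M : Type*} [AddCommGroup M] [Module ℂ M] [LieRingModule (Toroidal N B μ ν) M]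
  [LieModule ℂ (Toroidal N B μ ν) M]

/-- Vectors that are killed by `𝔤₊` generate the same `𝔤`-module and `𝔤₀ ⊕ 𝔤₋`-module. -/
theorem lieSpan_le_of_highest_weight {P : Submodule ℂ M}
    (hP : ∀ r : Fin (N + 1) → ℤ, r 0 ≤ 0 → ∀ x, ∀ w ∈ P, ⁅(mono r x : Toroidal N B μ ν), w⁆ ∈ P)
    {Z : Set M} (hZ : Z ⊆ P) (hpos : ∀ r : Fin (N + 1) → ℤ, 0 < r 0 → ∀ x, ∀ z ∈ Z,
      ⁅(mono r x : Toroidal N B μ ν), z⁆ = 0) :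
    (LieSubmodule.lieSpan ℂ (Toroidal N B μ ν) Z : Submodule ℂ M) ≤ P := by
  let C : Set (Submodule ℂ M) := {S | Z ⊆ S ∧ ∀ r : Fin (N + 1) → ℤ, r 0 ≤ 0 → ∀ x, ∀ w ∈ S,
    ⁅(mono r x : Toroidal N B μ ν), w⁆ ∈ S}
  have hmem : sInf C ∈ C := by
    refine ⟨fun z hz => ?_, fun r hr x w hw => ?_⟩
    · rw [SetLike.mem_coe, Submodule.mem_sInf]
      exact fun S hS => hS.1 hz
    · rw [Submodule.mem_sInf] at hw ⊢
      exact fun S hS => hS.2 r hr x w (hw S hS)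
  -- sInf C is the smallest subspace containing Z and stable in degrees ≤ 0. To see that positive
  -- degrees also preserve it, it suffices that S', its part mapped into it by positive degrees,
  -- belongs to C.
  let S' : Submodule ℂ M :=
    { carrier := {w | w ∈ sInf C ∧ ∀ r : Fin (N + 1) → ℤ, 0 < r 0 → ∀ x,
        ⁅(mono r x : Toroidal N B μ ν), w⁆ ∈ sInf C}
      add_mem' := fun ha hb => ⟨add_mem ha.1 hb.1, fun r hr x => by
        rw [lie_add]; exact add_mem (ha.2 r hr x) (hb.2 r hr x)⟩
      zero_mem' := ⟨zero_mem _, fun r hr x => by rw [lie_zero]; exact zero_mem _⟩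
      smul_mem' := fun s w hw => ⟨Submodule.smul_mem _ _ hw.1, fun r hr x => by
        rw [lie_smul]; exact Submodule.smul_mem _ _ (hw.2 r hr x)⟩ }
  have hS' : S' ∈ C := by
    refine ⟨fun z hz => ⟨hmem.1 hz, fun r hr x => ?_⟩, fun m hm y w hw =>
      ⟨hmem.2 m hm y w hw.1, fun r hr x => ?_⟩⟩
    · rw [hpos r hr x z hz]; exact zero_mem _
    -- In x y w = [x, y] w + y x w, the bracket has degree either ≤ 0 or > 0, and both cases are
    -- covered by the membership of w in S'.
    · rw [leibniz_lie, lie_mono]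
      refine add_mem ?_ (hmem.2 m hm y _ (hw.2 r hr x))
      rcases le_or_gt ((r + m) 0) 0 with h | h
      · exact hmem.2 _ h _ w hw.1
      · exact hw.2 _ h _
  have hle : sInf C ≤ S' := sInf_le hS'
  let U : LieSubmodule ℂ (Toroidal N B μ ν) M :=
    { sInf C with
      lie_mem := fun {x w} hw => by
        change w ∈ sInf C at hw
        change _ ∈ sInf C
        induction x using mono_induction with
        | h0 => rw [zero_lie]; exact zero_mem _
        | hadd x y hx hy => rw [add_lie]; exact add_mem hx hy
        | hmono r x =>
          rcases le_or_gt (r 0) 0 with h | h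
          · exact hmem.2 r h x w hw
          · exact (hle hw).2 r h x }
  have h1 : LieSubmodule.lieSpan ℂ (Toroidal N B μ ν) Z ≤ U :=
    LieSubmodule.lieSpan_le.2 hmem.1
  exact le_trans (fun w hw => h1 hw) (sInf_le ⟨hZ, hP⟩ : sInf C ≤ P)

variable (N B μ ν M) in
/-- The sum of the eigenspaces of `L(0)` for the positive integers. -/
def posPart : Submodule ℂ M :=
  ⨆ n : {n : ℤ // 0 < n}, Module.End.eigenspace (genField N B μ ν M (.d0 0) 1) (n : ℂ)

theorem mem_posPart {n : ℤ} (hn : 0 < n) {w : M}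
    (hw : ⁅(moment (.d0 0) 1 : Toroidal N B μ ν), w⁆ = (n : ℂ) • w) : w ∈ posPart N B μ ν M :=
  Submodule.mem_iSup_of_mem ⟨n, hn⟩ (Module.End.mem_eigenspace_iff.2 hw)

theorem lie_d0_lie_mono (r : Fin (N + 1) → ℤ) (x : TorCoeff N L) {w : M} {n : ℤ}
    (hw : ⁅(moment (.d0 0) 1 : Toroidal N B μ ν), w⁆ = (n : ℂ) • w) :
    ⁅(moment (.d0 0) 1 : Toroidal N B μ ν), ⁅(mono r x : Toroidal N B μ ν), w⁆⁆ =
      ((n - r 0 : ℤ) : ℂ) • ⁅(mono r x : Toroidal N B μ ν), w⁆ := by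
  rw [leibniz_lie, lie_moment_d0_one_mono, hw, lie_smul, smul_lie]
  push_cast
  module

theorem lie_mono_mem_posPart {r : Fin (N + 1) → ℤ} (hr : r 0 ≤ 0) (x : TorCoeff N L) {w : M}
    (hw : w ∈ posPart N B μ ν M) : ⁅(mono r x : Toroidal N B μ ν), w⁆ ∈ posPart N B μ ν M := by
  induction hw using Submodule.iSup_induction' with
  | zero => rw [lie_zero]; exact zero_mem _
  | add w w' _ _ h h' => rw [lie_add]; exact add_mem h h'
  | mem n w hw =>
    have hn := n.2
    exact mem_posPart (by lia) (lie_d0_lie_mono r x (Module.End.mem_eigenspace_iff.1 hw))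

open Polynomial in
/-- Elements of `posPart` are killed by polynomials in `L(0)` with non-zero constant term. -/
theorem exists_polynomial_of_mem_posPart {w : M} (hw : w ∈ posPart N B μ ν M) :
    ∃ p : ℂ[X], p.eval 0 ≠ 0 ∧ aeval (genField N B μ ν M (.d0 0) 1) p w = 0 := by
  induction hw using Submodule.iSup_induction' with
  | zero => exact ⟨1, by simp, by simp⟩
  | add w w' _ _ h h' =>
    obtain ⟨p, hp, hpw⟩ := h
    obtain ⟨p', hp', hpw'⟩ := h'
    refine ⟨p * p', by simp [hp, hp'], ?_⟩
    rw [map_add]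
    nth_rw 1 [mul_comm]
    simp only [map_mul, Module.End.mul_apply, hpw, hpw', map_zero, add_zero]
  | mem n w hw =>
    have hn := n.2
    refine ⟨X - C (n : ℂ), ?_, ?_⟩
    · simp only [eval_sub, eval_X, eval_C, zero_sub, ne_eq, neg_eq_zero, Int.cast_eq_zero]
      lia
    · rw [map_sub, aeval_X, aeval_C, LinearMap.sub_apply, Module.End.mem_eigenspace_iff.1 hw,
        Module.algebraMap_end_apply, sub_self]

open Polynomial in
theorem aeval_apply_of_lie_eq_zero {w : M}
    (hw : ⁅(moment (.d0 0) 1 : Toroidal N B μ ν), w⁆ = 0) (p : ℂ[X]) :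
    aeval (genField N B μ ν M (.d0 0) 1) p w = p.eval 0 • w := by
  induction p using Polynomial.induction_on' with
  | add p q hp hq => simp only [map_add, LinearMap.add_apply, hp, hq, eval_add, add_smul]
  | monomial n a =>
    have h0 : genField N B μ ν M (.d0 0) 1 w = 0 := hw
    rcases n with - | n
    · simp
    · rw [aeval_monomial, pow_succ, Module.End.mul_apply, Module.End.mul_apply, h0]
      simp

open Polynomial in
theorem aeval_mem (U : LieSubmodule ℂ (Toroidal N B μ ν) M) {w : M} (hw : w ∈ U) (p : ℂ[X]) :
    aeval (genField N B μ ν M (.d0 0) 1) p w ∈ U := by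
  induction p using Polynomial.induction_on with
  | C a => simpa using U.smul_mem a hw
  | add p q hp hq => rw [map_add]; exact add_mem hp hq
  | monomial n a h =>
    rw [pow_succ', mul_left_comm, map_mul, aeval_X]
    exact U.lie_mem h

theorem eq_zero_of_mem_posPart {w : M} (hw : w ∈ posPart N B μ ν M)
    (h0 : ⁅(moment (.d0 0) 1 : Toroidal N B μ ν), w⁆ = 0) : w = 0 := by
  obtain ⟨p, hp, h⟩ := exists_polynomial_of_mem_posPart hw
  rw [aeval_apply_of_lie_eq_zero h0] at h
  exact (smul_eq_zero.1 h).resolve_left hp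

/-- The `L(0)`-homogeneous component of degree `0` of an element of a submodule. -/
theorem mem_of_add_mem_of_posPart (U : LieSubmodule ℂ (Toroidal N B μ ν) M) {w w' : M}
    (h0 : ⁅(moment (.d0 0) 1 : Toroidal N B μ ν), w⁆ = 0) (hw' : w' ∈ posPart N B μ ν M)
    (h : w + w' ∈ U) : w ∈ U := by
  -- The operator p(L(0)) preserves U, kills the part of positive weight, and multiplies the part of
  -- weight zero by p(0) ≠ 0.
  obtain ⟨p, hp, hpw⟩ := exists_polynomial_of_mem_posPart hw'
  have h1 := aeval_mem U h p
  rw [map_add, hpw, add_zero, aeval_apply_of_lie_eq_zero h0] at h1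
  have h2 := U.smul_mem (p.eval 0)⁻¹ h1
  rwa [smul_smul, inv_mul_cancel₀ hp, one_smul] at h2

theorem moment_d0_one : (moment (.d0 0) 1 : Toroidal N B μ ν) =
    mono 0 (0, ((μ + ν) / 2) • Pi.single 0 1, -Pi.single 0 1) := by
  have : (0, ((μ + ν) / 2) • Pi.single 0 1, -Pi.single 0 1) =
      -((0 : L), (0 : Fin (N + 1) → ℂ), (Pi.single 0 1 : Fin (N + 1) → ℂ))
        + ((μ + ν) / 2) • (0, Pi.single 0 1, 0) := by
    refine Prod.ext ?_ (Prod.ext ?_ ?_) <;> simp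
  rw [this, map_add, map_neg, map_smul, moment, sub_self, cons_zero_zero, td, tk]
  congr 2
  push_cast
  ring

end Toroidal

namespace TopZero
variable {N : ℕ} {L : Type*} [LieRing L] [LieAlgebra ℂ L] {B : InvForm L} {μ ν c : ℂ}
open Toroidal

theorem moment_d0_lie_of (hN : 1 ≤ N) (t : TopZero N B μ ν c) :
    ⁅(moment (.d0 0) 1 : Toroidal N B μ ν),
      (IndModule.of _ t : GenVerma N B μ ν (TopZero N B μ ν c))⁆ = 0 := by
  have h : (LieModule.toEnd ℂ _ (GenVerma N B μ ν (TopZero N B μ ν c))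
      (moment (.d0 0) 1 : Toroidal N B μ ν)) ∘ₗ IndModule.ofₗ _ _ = 0 := by
    refine hom_ext fun m => ?_
    have h0 : cvec (0 : Fin (N + 1) → ℤ) = 0 := by ext; simp [cvec]
    have h1 : Fin.tail (-Pi.single 0 1 : Fin (N + 1) → ℂ) = 0 := by
      ext i; simp [Fin.tail]
    have h2 := lie_of_q (B := B) (μ := μ) (ν := ν) (c := c) hN (r := 0) le_rfl
      (0, ((μ + ν) / 2) • Pi.single 0 1, -Pi.single 0 1) m
    rw [← moment_d0_one, if_pos (Pi.zero_apply 0), coeff, h0, h1] at h2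
    refine h2.trans ?_
    simp
  exact LinearMap.congr_fun h t

theorem pos_lie_of (hN : 1 ≤ N) {r : Fin (N + 1) → ℤ} (hr : 0 < r 0) (x : TorCoeff N L)
    (t : TopZero N B μ ν c) : ⁅(mono r x : Toroidal N B μ ν),
      (IndModule.of _ t : GenVerma N B μ ν (TopZero N B μ ν c))⁆ = 0 := by
  have h : (LieModule.toEnd ℂ _ (GenVerma N B μ ν (TopZero N B μ ν c))
      (mono r x : Toroidal N B μ ν)) ∘ₗ IndModule.ofₗ _ _ = 0 := by
    refine hom_ext fun m => ?_
    have h2 := lie_of_q (B := B) (μ := μ) (ν := ν) (c := c) hN hr.le x m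
    rw [if_neg hr.ne'] at h2
    exact h2
  exact LinearMap.congr_fun h t

/-- T₀ has weight zero and is killed by 𝔤₊, so only degrees ≤ 0 have to be applied to it; negative
degree raises the weight, and degree zero stays inside T₀. -/
theorem range_of_sup_posPart (hN : 1 ≤ N) :
    LinearMap.range (IndModule.ofₗ (nonneg B μ ν (N := N)) (TopZero N B μ ν c)) ⊔
      posPart N B μ ν (GenVerma N B μ ν (TopZero N B μ ν c)) = ⊤ := by
  rw [eq_top_iff]
  have h := lieSpan_le_of_highest_weight (N := N) (B := B) (μ := μ) (ν := ν)
    (P := LinearMap.range (IndModule.ofₗ (nonneg B μ ν (N := N)) (TopZero N B μ ν c)) ⊔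
      posPart N B μ ν (GenVerma N B μ ν (TopZero N B μ ν c)))
    (Z := Set.range (IndModule.of (nonneg B μ ν (N := N)))) ?_ ?_ ?_
  · refine le_trans ?_ h
    rw [IndModule.eq_top_of_stable _ (LieSubmodule.lieSpan ℂ (Toroidal N B μ ν)
      (Set.range (IndModule.of (nonneg B μ ν (N := N)) (T := TopZero N B μ ν c)))).toSubmodule
      (fun t => LieSubmodule.subset_lieSpan ⟨t, rfl⟩)
      (fun x v hv => LieSubmodule.lie_mem _ hv)]
  · intro r hr x w hw
    obtain ⟨_, ⟨t, rfl⟩, w', hw', rfl⟩ := Submodule.mem_sup.1 hw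
    rw [lie_add]
    refine add_mem ?_ (Submodule.mem_sup_right (lie_mono_mem_posPart hr x hw'))
    rcases hr.lt_or_eq with h | h
    · refine Submodule.mem_sup_right (mem_posPart (n := 0 - r 0) (by lia)
        (lie_d0_lie_mono r x ?_))
      rw [Int.cast_zero, zero_smul]
      exact moment_d0_lie_of hN t
    · refine Submodule.mem_sup_left ?_
      exact ⟨_, (IndModule.lie_of (nonneg B μ ν (N := N))
        ⟨mono r x, mono_mem_nonneg h.ge x⟩ t).symm⟩
  · rintro _ ⟨t, rfl⟩
    exact Submodule.mem_sup_left ⟨t, rfl⟩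
  · rintro r hr x _ ⟨t, rfl⟩
    exact pos_lie_of hN hr x t

/-- The weight-zero component of an element of U is again in U. If U met T₀ non-trivially, it would
contain T₀ by irreducibility and hence be everything. -/
theorem le_posPart (hN : 1 ≤ N) (hc : c ≠ 0)
    (U : LieSubmodule ℂ (Toroidal N B μ ν) (GenVerma N B μ ν (TopZero N B μ ν c))) (hU : U ≠ ⊤) :
    U.toSubmodule ≤ posPart N B μ ν (GenVerma N B μ ν (TopZero N B μ ν c)) := by
  intro w hw
  have hsup : w ∈ LinearMap.range (IndModule.ofₗ (nonneg B μ ν (N := N)) (TopZero N B μ ν c)) ⊔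
      posPart N B μ ν (GenVerma N B μ ν (TopZero N B μ ν c)) := by
    rw [range_of_sup_posPart hN]; trivial
  obtain ⟨_, ⟨t, rfl⟩, w', hw', rfl⟩ := Submodule.mem_sup.1 hsup
  have ht : IndModule.of _ t ∈ U :=
    mem_of_add_mem_of_posPart U (moment_d0_lie_of hN t) hw' hw
  have hbot : U.toSubmodule.comap (IndModule.ofₗ _ _) = ⊥ := by
    by_contra hne
    have htop := eq_top_of_stable hN hc _ hne fun r x hr s hs => by
      have h1 := U.lie_mem (x := mono r x) hs
      rw [IndModule.ofₗ_apply] at h1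
      have h2 := IndModule.lie_of (nonneg B μ ν (N := N)) ⟨mono r x, mono_mem_nonneg hr.ge x⟩ s
      rw [show ⁅(mono r x : Toroidal N B μ ν), IndModule.of _ s⁆ = _ from h2] at h1
      exact h1
    apply hU
    rw [← LieSubmodule.toSubmodule_eq_top]
    refine IndModule.eq_top_of_stable _ _ (fun s => ?_) fun x v hv => U.lie_mem hv
    have hs : s ∈ U.toSubmodule.comap (IndModule.ofₗ _ _) := by rw [htop]; trivial
    exact hs
  have ht0 : t ∈ U.toSubmodule.comap (IndModule.ofₗ _ _) := ht
  rw [hbot, Submodule.mem_bot] at ht0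
  rw [ht0, map_zero, zero_add]
  exact hw'

/-- A vector of weight zero in the positive part is zero, whereas q^m stays non-zero in M(T₀) by the
embedding of T₀. -/
theorem of_q_notMem_posPart (hN : 1 ≤ N) (m : Fin N → ℤ) :
    IndModule.of _ (TopZero.q m) ∉ posPart N B μ ν (GenVerma N B μ ν (TopZero N B μ ν c)) := by
  intro h
  have h1 := eq_zero_of_mem_posPart h (moment_d0_lie_of hN _)
  exact q_ne_zero m (TensorTop.of_injective (h1.trans (map_zero (IndModule.ofₗ _ _)).symm))

theorem vermaRad_le_posPart (hN : 1 ≤ N) (hc : c ≠ 0) :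
    (vermaRad N B μ ν (TopZero N B μ ν c)).toSubmodule ≤
      posPart N B μ ν (GenVerma N B μ ν (TopZero N B μ ν c)) := by
  rw [vermaRad, LieSubmodule.sSup_toSubmodule]
  refine sSup_le ?_
  rintro _ ⟨U, hU, rfl⟩
  exact le_posPart hN hc U hU

theorem ne_top_of_le_posPart (hN : 1 ≤ N)
    {U : LieSubmodule ℂ (Toroidal N B μ ν) (GenVerma N B μ ν (TopZero N B μ ν c))}
    (hU : U.toSubmodule ≤ posPart N B μ ν (GenVerma N B μ ν (TopZero N B μ ν c))) : U ≠ ⊤ := by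
  rintro rfl
  exact of_q_notMem_posPart hN 0 (hU trivial)

/-- All proper submodules lie in the positive part, hence so does their sum, which therefore omits
q^0 and is proper. -/
theorem isCoatom_vermaRad (hN : 1 ≤ N) (hc : c ≠ 0) :
    IsCoatom (vermaRad N B μ ν (TopZero N B μ ν c)) := by
  refine ⟨ne_top_of_le_posPart hN (vermaRad_le_posPart hN hc), fun U hU => ?_⟩
  by_contra hne
  exact hU.not_ge (le_sSup hne)

/-- The image of `q^0` in `L(T₀)` is a vacuum vector. -/
theorem isVacuumVector_mk (hN : 1 ≤ N) (hc : c ≠ 0) : IsVacuumVector N B μ ν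
    (LieSubmodule.Quotient.mk' (vermaRad N B μ ν (TopZero N B μ ν c))
      (IndModule.of _ (TopZero.q 0))) where
  lie_eq_zero x hx := by
    induction hx using Submodule.span_induction with
    | zero => rw [zero_lie]
    | add x y _ _ hx hy => rw [add_lie, hx, hy, add_zero]
    | smul s x _ hx => rw [smul_lie, hx, smul_zero]
    | mem y hy =>
      have hyp : y ∈ plus B μ ν (N := N) := Submodule.subset_span hy
      obtain ⟨u, n, hn, rfl⟩ := hy
      obtain ⟨r, x, hx, e⟩ := moment_eq_mono (B := B) (μ := μ) (ν := ν) u hn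
      rw [e] at hyp ⊢
      have hzero : ∀ z ∈ plus B μ ν (N := N), z ∈ nonneg B μ ν (N := N) →
          ⁅z, (IndModule.of _ (TopZero.q 0) : GenVerma N B μ ν (TopZero N B μ ν c))⁆ = 0 := by
        intro z hz hz'
        refine (IndModule.lie_of (nonneg B μ ν (N := N)) ⟨z, hz'⟩ (TopZero.q 0)).trans ?_
        exact (congrArg _ (act_q_zero_of_mem_plus hN hz)).trans (map_zero (IndModule.ofₗ _ _))
      rw [← LieModuleHom.map_lie]
      by_cases hr : 0 ≤ r 0
      · rw [hzero _ hyp (mono_mem_nonneg hr x), map_zero]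
      -- Only t_0^(-1) t^r d̃_0 is left. In M(T₀) it need not kill q^0, but its value z lies in the
      -- radical, since the submodule generated by z has positive weights only.
      have hr1 : r 0 = -1 := by rcases hx with h | ⟨h, -⟩ | ⟨h, -⟩ <;> lia
      rw [LieSubmodule.Quotient.mk_eq_zero]
      set z := ⁅(mono r x : Toroidal N B μ ν),
        (IndModule.of _ (TopZero.q 0) : GenVerma N B μ ν (TopZero N B μ ν c))⁆ with hz
      have h1 : (LieSubmodule.lieSpan ℂ (Toroidal N B μ ν) {z}).toSubmodule ≤
          posPart N B μ ν (GenVerma N B μ ν (TopZero N B μ ν c)) := by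
        refine lieSpan_le_of_highest_weight (fun r hr x w hw => lie_mono_mem_posPart hr x hw) ?_ ?_
        · rintro _ rfl
          refine mem_posPart (n := 0 - r 0) (by lia) (lie_d0_lie_mono r x ?_)
          rw [Int.cast_zero, zero_smul]
          exact moment_d0_lie_of hN _
        -- The vector z is killed by 𝔤₊: the bracket of t^m y with t^r x lies in 𝔤^(+) and has
        -- degree m_0 - 1 ≥ 0, so it kills q^0, and so does t^m y itself.
        · rintro m hm y _ rfl
          have hy : (mono m y : Toroidal N B μ ν) ∈ plus B μ ν (N := N) :=
            mono_mem_plus_of_pos hm y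
          rw [hz, leibniz_lie, pos_lie_of hN hm, lie_zero, add_zero]
          refine hzero _ (LieSubalgebra.lie_mem _ hy hyp) ?_
          rw [lie_mono]
          exact mono_mem_nonneg (by rw [Pi.add_apply]; lia) _
      exact (le_sSup (ne_top_of_le_posPart hN h1) : _ ≤ vermaRad N B μ ν _)
        (LieSubmodule.subset_lieSpan rfl)
  generate S hS h := by
    have h1 : S.comap (LieSubmodule.Quotient.mk' (vermaRad N B μ ν (TopZero N B μ ν c)) :
        GenVerma N B μ ν (TopZero N B μ ν c) →ₗ[ℂ] _) = ⊤ := by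
      have hstable : ∀ x : Toroidal N B μ ν, ∀ w ∈ S.comap (LieSubmodule.Quotient.mk'
          (vermaRad N B μ ν (TopZero N B μ ν c)) : GenVerma N B μ ν (TopZero N B μ ν c) →ₗ[ℂ] _),
          ⁅x, w⁆ ∈ S.comap (LieSubmodule.Quotient.mk' (vermaRad N B μ ν (TopZero N B μ ν c)) :
            GenVerma N B μ ν (TopZero N B μ ν c) →ₗ[ℂ] _) := fun x w hw => h x _ hw
      refine IndModule.eq_top_of_stable _ _ (fun t => ?_) hstable
      -- The preimage of S in T₀ contains q^0 and is stable in degree zero, so irreducibility of T₀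
      -- gives all of T₀, which generates M(T₀).
      have h2 : (S.comap (LieSubmodule.Quotient.mk' (vermaRad N B μ ν (TopZero N B μ ν c)) :
        GenVerma N B μ ν (TopZero N B μ ν c) →ₗ[ℂ] _)).comap (IndModule.ofₗ _ _) = ⊤ := by
        refine eq_top_of_stable hN hc _ (Submodule.ne_bot_iff _ |>.2 ⟨_, hS, q_ne_zero 0⟩)
          fun r x hr s hs => ?_
        have h3 := hstable (mono r x) _ hs
        have h4 := IndModule.lie_of (nonneg B μ ν (N := N)) ⟨mono r x, mono_mem_nonneg hr.ge x⟩ s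
        rw [IndModule.ofₗ_apply, show ⁅(mono r x : Toroidal N B μ ν), IndModule.of _ s⁆ = _ from h4]
          at h3
        exact h3
      have ht : t ∈ (S.comap (LieSubmodule.Quotient.mk' (vermaRad N B μ ν (TopZero N B μ ν c)) :
        GenVerma N B μ ν (TopZero N B μ ν c) →ₗ[ℂ] _)).comap (IndModule.ofₗ _ _) := by
          rw [h2]; trivial
      exact ht
    rw [eq_top_iff]
    rintro w -
    obtain ⟨w, rfl⟩ := LieSubmodule.Quotient.surjective_mk' _ w
    have hw : w ∈ S.comap (LieSubmodule.Quotient.mk' (vermaRad N B μ ν (TopZero N B μ ν c)) :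
        GenVerma N B μ ν (TopZero N B μ ν c) →ₗ[ℂ] _) := by rw [h1]; trivial
    exact hw

end TopZero

/-! ### The level `c` quotient and the generalized Verma module -/

namespace IsVacuumVector
variable {N : ℕ} {L : Type*} [LieRing L] [LieAlgebra ℂ L] {B : InvForm L} {μ ν c : ℂ}
variable {Q : Type*} [AddCommGroup Q] [Module ℂ Q] [LieRingModule (Toroidal N B μ ν) Q]
  [LieModule ℂ (Toroidal N B μ ν) Q] {v : Q}

open Toroidal

/-- In degree zero 𝔤^(+) is the kernel of one functional with value 1 on t^r k_0, so t^r x minus the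
corresponding multiple of t^r k_0 kills v. -/
theorem lie_mono (hv : IsVacuumVector N B μ ν v) {r : Fin (N + 1) → ℤ} (hr : r 0 = 0)
    (x : TorCoeff N L) : ⁅(mono r x : Toroidal N B μ ν), v⁆ =
      (x.2.1 0 + ν * (x.2.2 ⬝ᵥ cvec r) + (μ + ν) / 2 * x.2.2 0) •
        ⁅(tk r 0 : Toroidal N B μ ν), v⁆ := by
  set a := x.2.1 0 + ν * (x.2.2 ⬝ᵥ cvec r) + (μ + ν) / 2 * x.2.2 0 with ha
  have h := hv.lie_eq_zero (mono r (x - a • (0, Pi.single 0 1, 0)))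
    (mono_mem_plus (Or.inr (Or.inl ⟨hr, by simp [ha]; ring⟩)))
  rw [map_sub, map_smul, sub_lie, smul_lie, sub_eq_zero] at h
  exact h

/-- The relations of level `c` for the fields `k_0(r, z)`, on the vacuum vector. -/
theorem lie_mono_lie_tk (hv : IsVacuumVector N B μ ν v)
    (hk : ∀ r m : Fin N → ℤ, ⁅(tk (Fin.cons 0 r) 0 : Toroidal N B μ ν),
      ⁅(tk (Fin.cons 0 m) 0 : Toroidal N B μ ν), v⁆⁆ =
        c • ⁅(tk (Fin.cons 0 (r + m)) 0 : Toroidal N B μ ν), v⁆)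
    {r : Fin (N + 1) → ℤ} (hr : 0 ≤ r 0) (x : TorCoeff N L) (m : Fin N → ℤ) :
    ⁅(mono r x : Toroidal N B μ ν), ⁅(tk (Fin.cons 0 m) 0 : Toroidal N B μ ν), v⁆⁆ =
      if r 0 = 0 then TopZero.coeff μ ν c r x m •
        ⁅(tk (Fin.cons 0 (m + Fin.tail r)) 0 : Toroidal N B μ ν), v⁆ else 0 := by
  rw [leibniz_lie, tk, Toroidal.lie_mono]
  rcases hr.lt_or_eq with h | h
  · rw [if_neg h.ne', hv.lie_eq_zero _ (mono_mem_plus_of_pos h x), lie_zero, add_zero]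
    exact hv.lie_eq_zero _ (mono_mem_plus_of_pos (by rw [Pi.add_apply, Fin.cons_zero]; lia) _)
  · obtain ⟨s, rfl⟩ : ∃ s, r = Fin.cons 0 s :=
      ⟨Fin.tail r, by rw [h]; exact (Fin.cons_self_tail r).symm⟩
    have hm : (mono (Fin.cons 0 m) (0, Pi.single 0 1, 0) : Toroidal N B μ ν) =
      tk (Fin.cons 0 m) 0 := rfl
    rw [if_pos (Fin.cons_zero _ _), Fin.tail_cons, hv.lie_mono (by simp),
      hv.lie_mono (r := Fin.cons 0 s) (Fin.cons_zero _ _), lie_smul, hm, hk, cons_add_cons,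
      add_zero, add_comm s m, smul_smul, ← add_smul]
    congr 1
    have h1 : cvec (Fin.cons 0 s : Fin (N + 1) → ℤ) 0 = 0 := by simp [cvec]
    have h2 : x.2.2 ⬝ᵥ cvec (Fin.cons 0 m : Fin (N + 1) → ℤ) = Fin.tail x.2.2 ⬝ᵥ cvec m := by
      rw [dot_cvec]; simp
    simp [torBracketCoeff, h1, h2, TopZero.coeff]
    ring

/-- The homomorphism from the generalized Verma module to a module with a vacuum vector of
level `c`. -/
def ofVerma (hN : 1 ≤ N) (hv : IsVacuumVector N B μ ν v)
    (hk : ∀ r m : Fin N → ℤ, ⁅(tk (Fin.cons 0 r) 0 : Toroidal N B μ ν),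
      ⁅(tk (Fin.cons 0 m) 0 : Toroidal N B μ ν), v⁆⁆ =
        c • ⁅(tk (Fin.cons 0 (r + m)) 0 : Toroidal N B μ ν), v⁆) :
    GenVerma N B μ ν (TopZero N B μ ν c) →ₗ⁅ℂ, Toroidal N B μ ν⁆ Q :=
  IndModule.lift
    (TopZero.lift fun m => c⁻¹ • ⁅(tk (Fin.cons 0 m) 0 : Toroidal N B μ ν), v⁆) (by
    rintro ⟨x, hx⟩ t
    change TopZero.lift _ (TensorTop.act B μ ν _ _ c _ _ x t) = ⁅x, TopZero.lift _ t⁆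
    induction hx using Submodule.span_induction generalizing t with
    | zero => simp
    | add x y _ _ hx hy => rw [map_add, LinearMap.add_apply, map_add, hx, hy, add_lie]
    | smul s x _ hx => rw [map_smul, LinearMap.smul_apply, map_smul, hx, smul_lie]
    | mem x hx =>
      obtain ⟨r, hr, x, rfl⟩ := hx
      have h : (TopZero.lift fun m => c⁻¹ • ⁅(tk (Fin.cons 0 m) 0 : Toroidal N B μ ν), v⁆) ∘ₗ
          TensorTop.act B μ ν _ _ c _ _ (mono r x) =
          (LieModule.toEnd ℂ _ Q (mono r x : Toroidal N B μ ν)) ∘ₗ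
          (TopZero.lift fun m => c⁻¹ • ⁅(tk (Fin.cons 0 m) 0 : Toroidal N B μ ν), v⁆) := by
        refine TopZero.hom_ext fun m => ?_
        rw [LinearMap.comp_apply, LinearMap.comp_apply, TopZero.act_q hN, TopZero.lift_q,
          LieModule.toEnd_apply_apply, lie_smul, hv.lie_mono_lie_tk hk hr]
        split_ifs
        · rw [map_smul, TopZero.lift_q, smul_comm]
        · simp
      exact LinearMap.congr_fun h t)

theorem ofVerma_of_q (hN : 1 ≤ N) (hv : IsVacuumVector N B μ ν v)
    (hk : ∀ r m : Fin N → ℤ, ⁅(tk (Fin.cons 0 r) 0 : Toroidal N B μ ν),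
      ⁅(tk (Fin.cons 0 m) 0 : Toroidal N B μ ν), v⁆⁆ =
        c • ⁅(tk (Fin.cons 0 (r + m)) 0 : Toroidal N B μ ν), v⁆) (r : Fin N → ℤ) :
    hv.ofVerma hN hk (IndModule.of _ (TopZero.q r)) =
      c⁻¹ • ⁅(tk (Fin.cons 0 r) 0 : Toroidal N B μ ν), v⁆ := by
  rw [ofVerma, IndModule.lift_of, TopZero.lift_q]

theorem ofVerma_of_q_zero (hN : 1 ≤ N) (hv : IsVacuumVector N B μ ν v)
    (hk : ∀ r m : Fin N → ℤ, ⁅(tk (Fin.cons 0 r) 0 : Toroidal N B μ ν),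
      ⁅(tk (Fin.cons 0 m) 0 : Toroidal N B μ ν), v⁆⁆ =
        c • ⁅(tk (Fin.cons 0 (r + m)) 0 : Toroidal N B μ ν), v⁆)
    (h0 : ⁅(tk 0 0 : Toroidal N B μ ν), v⁆ = c • v) (hc : c ≠ 0) :
    hv.ofVerma hN hk (IndModule.of _ (TopZero.q 0)) = v := by
  rw [ofVerma_of_q, cons_zero_zero, h0, smul_smul, inv_mul_cancel₀ hc, one_smul]

/-- Since k_0 acts on v by c, the vector q^0 goes to v, which generates Q. -/
theorem surjective_ofVerma (hN : 1 ≤ N) (hv : IsVacuumVector N B μ ν v)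
    (hk : ∀ r m : Fin N → ℤ, ⁅(tk (Fin.cons 0 r) 0 : Toroidal N B μ ν),
      ⁅(tk (Fin.cons 0 m) 0 : Toroidal N B μ ν), v⁆⁆ =
        c • ⁅(tk (Fin.cons 0 (r + m)) 0 : Toroidal N B μ ν), v⁆)
    (h0 : ⁅(tk 0 0 : Toroidal N B μ ν), v⁆ = c • v) (hc : c ≠ 0) :
    Function.Surjective (hv.ofVerma hN hk) := by
  have h := hv.generate (LinearMap.range
    (hv.ofVerma hN hk : GenVerma N B μ ν (TopZero N B μ ν c) →ₗ[ℂ] Q))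
    ⟨_, hv.ofVerma_of_q_zero hN hk h0 hc⟩ (by
      rintro x _ ⟨w, rfl⟩
      exact ⟨⁅x, w⁆, LieModuleHom.map_lie (hv.ofVerma hN hk) x w⟩)
  exact LinearMap.range_eq_top.1 h

/-- The homomorphism `V_𝔤 → Q` that sends `1` to the vacuum vector `v`. -/
def ofVg (hv : IsVacuumVector N B μ ν v) : Vg N B μ ν →ₗ⁅ℂ, Toroidal N B μ ν⁆ Q :=
  IndModule.lift ((LinearMap.toSpanSingleton ℂ Q v) ∘ₗ
    (TrivialLieModule.equiv ℂ (plus B μ ν (N := N)) ℂ).toLinearMap) fun x t => by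
    rw [LieModule.IsTrivial.trivial, map_zero, LinearMap.comp_apply,
      LinearMap.toSpanSingleton_apply, lie_smul, hv.lie_eq_zero _ x.2, smul_zero]

theorem ofVg_one (hv : IsVacuumVector N B μ ν v) : hv.ofVg (Vg.one N B μ ν) = v := by
  rw [ofVg, Vg.one, IndModule.lift_of, LinearMap.comp_apply, LinearEquiv.coe_coe,
    LinearEquiv.apply_symm_apply, LinearMap.toSpanSingleton_apply, one_smul]

/-- The homomorphism `V_𝔤(c) → Q` that sends `1` to a vacuum vector of level `c`. -/
def ofVgLevel (hv : IsVacuumVector N B μ ν v)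
    (h0 : ⁅(tk 0 0 : Toroidal N B μ ν), v⁆ = c • v)
    (hk : ∀ r m : Fin N → ℤ, ⁅(tk (Fin.cons 0 r) 0 : Toroidal N B μ ν),
      ⁅(tk (Fin.cons 0 m) 0 : Toroidal N B μ ν), v⁆⁆ =
        c • ⁅(tk (Fin.cons 0 (r + m)) 0 : Toroidal N B μ ν), v⁆) :
    VgLevel N B μ ν c →ₗ⁅ℂ, Toroidal N B μ ν⁆ Q :=
  have hle : levelSubmodule N B μ ν c ≤ hv.ofVg.ker := by
    refine LieSubmodule.lieSpan_le.2 ?_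
    rintro _ (rfl | ⟨r, m, rfl⟩)
    · rw [SetLike.mem_coe, LieModuleHom.mem_ker, map_sub, map_smul, LieModuleHom.map_lie,
        hv.ofVg_one, h0, sub_self]
    · rw [SetLike.mem_coe, LieModuleHom.mem_ker, map_sub, map_smul, LieModuleHom.map_lie,
        LieModuleHom.map_lie, LieModuleHom.map_lie, hv.ofVg_one, hk, sub_self]
  { (levelSubmodule N B μ ν c).toSubmodule.liftQ (hv.ofVg : Vg N B μ ν →ₗ[ℂ] Q) hle with
    map_lie' := fun {x w} => by
      obtain ⟨w, rfl⟩ := LieSubmodule.Quotient.surjective_mk' _ w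
      exact LieModuleHom.map_lie hv.ofVg x w }

/-- Homomorphisms of `𝔤`-modules that preserve vacuum vectors are homomorphisms of vertex
algebras. -/
theorem isHom {Q' : Type*} [AddCommGroup Q'] [Module ℂ Q']
    [LieRingModule (Toroidal N B μ ν) Q'] [LieModule ℂ (Toroidal N B μ ν) Q'] {v' : Q'}
    (hv : IsVacuumVector N B μ ν v) (hv' : IsVacuumVector N B μ ν v')
    (f : Q →ₗ⁅ℂ, Toroidal N B μ ν⁆ Q') (hf : f v = v') :
    hv.isGenerating.vertexAlgebra.IsHom hv'.isGenerating.vertexAlgebra (f : Q →ₗ[ℂ] Q') :=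
  hv.isGenerating.isHom hv'.isGenerating _ hf (fun _ => LieModuleHom.map_lie f _ _)
    fun _ _ _ => LieModuleHom.map_lie f _ _

end IsVacuumVector

section
variable {N : ℕ} {L : Type*} [LieRing L] [LieAlgebra ℂ L] {B : InvForm L} {μ ν c : ℂ}

open Toroidal

theorem isVacuumVector_mk_one : IsVacuumVector N B μ ν
    (VgLevel.mk N B μ ν c (Vg.one N B μ ν)) :=
  isVacuumVector_one.map _ (LieSubmodule.Quotient.surjective_mk' _)

theorem VgLevel.tk_zero_lie_one :
    ⁅(tk 0 0 : Toroidal N B μ ν), VgLevel.mk N B μ ν c (Vg.one N B μ ν)⁆ =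
      c • VgLevel.mk N B μ ν c (Vg.one N B μ ν) := by
  rw [← LieModuleHom.map_lie, ← map_smul, ← sub_eq_zero, ← map_sub,
    LieSubmodule.Quotient.mk_eq_zero]
  exact LieSubmodule.subset_lieSpan (Or.inl rfl)

theorem VgLevel.tk_lie_tk_lie_one (r m : Fin N → ℤ) :
    ⁅(tk (Fin.cons 0 r) 0 : Toroidal N B μ ν), ⁅(tk (Fin.cons 0 m) 0 : Toroidal N B μ ν),
      VgLevel.mk N B μ ν c (Vg.one N B μ ν)⁆⁆ =
      c • ⁅(tk (Fin.cons 0 (r + m)) 0 : Toroidal N B μ ν),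
        VgLevel.mk N B μ ν c (Vg.one N B μ ν)⁆ := by
  rw [← LieModuleHom.map_lie, ← LieModuleHom.map_lie, ← LieModuleHom.map_lie, ← map_smul,
    ← sub_eq_zero, ← map_sub, LieSubmodule.Quotient.mk_eq_zero]
  exact LieSubmodule.subset_lieSpan (Or.inr ⟨r, m, rfl⟩)

theorem TopZero.tk_lie_mk (hN : 1 ≤ N) (r m : Fin N → ℤ) :
    ⁅(tk (Fin.cons 0 r) 0 : Toroidal N B μ ν),
      LieSubmodule.Quotient.mk' (vermaRad N B μ ν (TopZero N B μ ν c))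
        (IndModule.of _ (TopZero.q m))⁆ =
      c • LieSubmodule.Quotient.mk' (vermaRad N B μ ν (TopZero N B μ ν c))
        (IndModule.of _ (TopZero.q (r + m))) := by
  have h1 : Fin.tail (0 : Fin (N + 1) → ℂ) = 0 := rfl
  rw [← LieModuleHom.map_lie, tk, TopZero.lie_of_q hN le_rfl, if_pos (Fin.cons_zero _ _),
    map_smul, TopZero.coeff, Fin.tail_cons, add_comm m r]
  simp [h1]

end

end

/-! ### Assembly of the four statements -/

theorem proposition4p2 {N : ℕ} (hN : 1 ≤ N) {L : Type*} [LieRing L] [LieAlgebra ℂ L]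
    [FiniteDimensional ℂ L] [LieAlgebra.IsSimple ℂ L] (B : InvForm L) (μ ν c : ℂ) (hc : c ≠ 0) :
    -- the vertex algebra structure of the universal enveloping vertex algebra on `V_𝔤`
    ∃ 𝒱 : VertexAlgebra (Vg N B μ ν), IsEnveloping 𝒱 ∧
    -- (a) `V_𝔤(c)` is a factor-module of `M(T₀)`
    ∃ π : GenVerma N B μ ν (TopZero N B μ ν c) →ₗ⁅ℂ, Toroidal N B μ ν⁆ VgLevel N B μ ν c,
      Function.Surjective π ∧
      (∀ r : Fin N → ℤ, π (IndModule.of _ (TopZero.q r)) = c⁻¹ • VgLevel.mk N B μ ν c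
        ⁅(Toroidal.tk (Fin.cons 0 r) 0 : Toroidal N B μ ν), Vg.one N B μ ν⁆) ∧
    -- (b) `V_𝔤(c)` inherits a vertex algebra structure from `V_𝔤`
    ∃ 𝒬 : VertexAlgebra (VgLevel N B μ ν c), 𝒱.IsHom 𝒬 (VgLevel.mk N B μ ν c : _ →ₗ[ℂ] _) ∧
    -- (c) `V_𝔤(c)` is a VOA of rank `12 (μ + ν) c` with Virasoro field `d̃_0(z)`
      𝒬.IsVOA (VgLevel.omega N B μ ν c) (12 * (μ + ν) * c) ∧
      𝒬.Y (VgLevel.omega N B μ ν c) = genField N B μ ν (VgLevel N B μ ν c) (.d0 0) ∧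
    -- (d) `M(T₀) → L(T₀)` factors through `V_𝔤(c)`, and `L(T₀)` is a factor-VOA of `V_𝔤(c)`
      IsCoatom (vermaRad N B μ ν (TopZero N B μ ν c)) ∧
      ∃ φ : VgLevel N B μ ν c →ₗ⁅ℂ, Toroidal N B μ ν⁆ IrrQuot N B μ ν (TopZero N B μ ν c),
        Function.Surjective φ ∧
        φ.comp π = LieSubmodule.Quotient.mk' (vermaRad N B μ ν (TopZero N B μ ν c)) ∧
        ∃ ℒ : VertexAlgebra (IrrQuot N B μ ν (TopZero N B μ ν c)),
          𝒬.IsHom ℒ (φ : _ →ₗ[ℂ] _) ∧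
          ℒ.IsVOA (φ (VgLevel.omega N B μ ν c)) (12 * (μ + ν) * c) := by

  have hk := VgLevel.tk_lie_tk_lie_one (N := N) (B := B) (μ := μ) (ν := ν) (c := c)
  have h0 := VgLevel.tk_zero_lie_one (N := N) (B := B) (μ := μ) (ν := ν) (c := c)
  have hv := isVacuumVector_mk_one (N := N) (B := B) (μ := μ) (ν := ν) (c := c)
  have hw := TopZero.isVacuumVector_mk (B := B) (μ := μ) (ν := ν) hN hc
  have hkq := fun r m : Fin N → ℤ =>
    TopZero.tk_lie_mk (B := B) (μ := μ) (ν := ν) (c := c) hN r m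
  -- The case r = m = 0 is the relation that k_0 acts by c on the vacuum of L(T₀).
  have hw0 := hkq 0 0
  rw [Toroidal.cons_zero_zero, add_zero] at hw0
  have hwk : ∀ r m : Fin N → ℤ, ⁅(Toroidal.tk (Fin.cons 0 r) 0 : Toroidal N B μ ν),
      ⁅(Toroidal.tk (Fin.cons 0 m) 0 : Toroidal N B μ ν),
        LieSubmodule.Quotient.mk' (vermaRad N B μ ν (TopZero N B μ ν c))
          (IndModule.of _ (TopZero.q 0))⁆⁆ =
        c • ⁅(Toroidal.tk (Fin.cons 0 (r + m)) 0 : Toroidal N B μ ν),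
          LieSubmodule.Quotient.mk' (vermaRad N B μ ν (TopZero N B μ ν c))
            (IndModule.of _ (TopZero.q 0))⁆ := fun r m => by
    rw [hkq, lie_smul, hkq, hkq, add_zero, add_zero]
  have hφ : hw.ofVgLevel hw0 hwk (VgLevel.mk N B μ ν c (Vg.one N B μ ν)) =
      LieSubmodule.Quotient.mk' (vermaRad N B μ ν (TopZero N B μ ν c))
        (IndModule.of _ (TopZero.q 0)) := hw.ofVg_one
  -- Both maps are determined by the q^r: π sends q^r to c⁻¹ (t^r k_0) 1, and in L(T₀) the element
  -- t^r k_0 sends q^0 to c q^r.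
  have hcomp : (hw.ofVgLevel hw0 hwk).comp (hv.ofVerma hN hk) =
      LieSubmodule.Quotient.mk' (vermaRad N B μ ν (TopZero N B μ ν c)) := by
    refine IndModule.hom_ext fun t => ?_
    have h : ((hw.ofVgLevel hw0 hwk).comp (hv.ofVerma hN hk) :
          GenVerma N B μ ν (TopZero N B μ ν c) →ₗ[ℂ] IrrQuot N B μ ν (TopZero N B μ ν c)) ∘ₗ
          IndModule.ofₗ _ (TopZero N B μ ν c) =
        (LieSubmodule.Quotient.mk' (vermaRad N B μ ν (TopZero N B μ ν c)) :
          GenVerma N B μ ν (TopZero N B μ ν c) →ₗ[ℂ] IrrQuot N B μ ν (TopZero N B μ ν c)) ∘ₗ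
          IndModule.ofₗ _ (TopZero N B μ ν c) := by
      refine TopZero.hom_ext fun r => ?_
      change hw.ofVgLevel hw0 hwk (hv.ofVerma hN hk (IndModule.of _ (TopZero.q r))) =
        LieSubmodule.Quotient.mk' _ (IndModule.of _ (TopZero.q r))
      rw [hv.ofVerma_of_q, map_smul, LieModuleHom.map_lie, hφ, hkq, add_zero, smul_smul,
        inv_mul_cancel₀ hc, one_smul]
    exact LinearMap.congr_fun h t
  have hω : VgLevel.omega N B μ ν c = ⁅(Toroidal.moment (.d0 0) (-1) : Toroidal N B μ ν),
      VgLevel.mk N B μ ν c (Vg.one N B μ ν)⁆ := LieModuleHom.map_lie _ _ _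
  refine ⟨_, isEnveloping_vertexAlgebra, hv.ofVerma hN hk, hv.surjective_ofVerma hN hk h0 hc,
    fun r => ?_, hv.isGenerating.vertexAlgebra, isVacuumVector_one.isHom hv _ rfl, ?_, ?_,
    TopZero.isCoatom_vermaRad hN hc, hw.ofVgLevel hw0 hwk, ?_, hcomp,
    hw.isGenerating.vertexAlgebra, hv.isHom hw _ hφ, ?_⟩
  · rw [hv.ofVerma_of_q, LieModuleHom.map_lie]
  · rw [hω]
    exact hv.isVOA h0
  · rw [hω]
    exact hv.Y_omega
  -- The composite with π is the quotient map, so V_𝔤(c) → L(T₀) is onto.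
  · refine Function.Surjective.of_comp (g := hv.ofVerma hN hk) ?_
    rw [← LieModuleHom.coe_comp, hcomp]
    exact LieSubmodule.Quotient.surjective_mk' _
  · rw [hω, LieModuleHom.map_lie, hφ]
    exact hw.isVOA hw0
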